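/- **Setting.** Let $d\in\mathbb N$, let $\mathcal N=\mathbb Z^d$ or $\mathbb N^d$, and write $|a|=\max_i|a_i|$. For each $K\in\mathbb N$ let $\mathcal N_K\subset\{a\in\mathcal N: |a|\le K\}$ be a finite set and let $\mathcal Z_K=\mathcal N_K\times\{\pm1\}$. A point of $\mathbb C^{\mathcal Z_K}$ is written $z=(z_j)_{j\in\mathcal Z_K}=(\xi,\eta)$ with $z_{(a,1)}=\xi_a$, $z_{(a,-1)}=\eta_a$, and $\|z\|^2=\sum_{j\in\mathcal Z_K}|z_j|^2$. It is called real if $\eta_a=\overline{\xi_a}$ for all $a\in\mathcal N_K$. The actions are $I_a(z)=\xi_a\eta_a$ (so $I_a(z)=|\xi_a|^2$ if $z$ is real). Let $\mathcal U$ be an open subset of $\ell^2(\mathcal N\times\{\pm1\};\mathbb C)$ containing $0$, and let $\mathcal U_K\subset\mathbb C^{\mathcal Z_K}$ be its image under the coordinate projection. For a Hamiltonian $H$ on an open set of $\mathbb C^{\mathcal Z_K}$, $\varphi_H^t$ denotes the (partially defined) flow at time $t$ of $\dot\xi_a=-i\,\partial H/\partial\eta_a$, $\dot\eta_a=i\,\partial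 H/\partial\xi_a$; it is defined at $z$ if the solution starting at $z$ stays in the domain of $H$ on $[0,t]$. **Hypotheses.** Let $(\omega_a)_{a\in\mathcal N}$ be real numbers and $H_0^{(K)}=\sum_{a\in\mathcal N_K}\omega_a I_a$ on $\mathbb C^{\mathcal Z_K}$. Let $P^{(K)}:\mathcal U_K\to\mathbb C$ be $C^\infty$ in the complex variables $z_j$, real valued at the real points of $\mathcal U_K$, and vanishing at $0$ together with its derivatives of order $1$ and $2$. Suppose that there are constants $C(\ell),\beta(\ell)\ge0$ such that for all $\ell\ge2$, all $K\ge1$, all $j_1,\dots,j_\ell\in\mathcal Z_K$ and all $z\in\mathcal U_K$, $$\Big|\frac{\partial^\ell P^{(K)}}{\partial z_{j_1}\cdots\partial z_{j_\ell}}(z)\Big|\le C(\ell)K^{\beta(\ell)} .$$ Let $0<h<h_0$ satisfy the following non-resonance condition: there are constants $\gamma^*(s)>0$ and $\alpha^*(s)\in\mathbb R$, $s\in\mathbb N$, such that for all $s$, all $K\ge1$ and all $(j_1,\dots,j_s)=((a_1,\delta_1),\dots,(a_s,\delta_s))\in\mathcal Z_K^s$ that are not, up to a permutation, of the form $((b_1,1),\dots,(b_m,1),(b_1,-1),\dots,(b_m,-1))$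 with $2m=s$, $$\big|1-e^{ih(\delta_1\omega_{a_1}+\cdots+\delta_s\omega_{a_s})}\big|\ge \frac{h\,\gamma^*(s)}{K^{\alpha^*(s)}} .$$ **Theorem 1.** Let $r\ge1$ be an integer. There exist positive constants $\sigma$, $C$, $\varepsilon_0$, depending only on $r$, $h_0$, the values $C(\ell),\beta(\ell)$ for $2\le\ell\le\max(r,2)$, the constants $\gamma^*(\cdot),\alpha^*(\cdot)$, the index set $\mathcal N$ (in particular $d$) and $\mathcal U$ (and not on the sets $\mathcal N_K$, on $\omega$, $P^{(K)}$, $h$ or $K$), such that the following holds. For all $0<\varepsilon<\varepsilon_0$, all integers $1\le K\le\varepsilon^{-\sigma}$ and all real $z^0\in\mathbb C^{\mathcal Z_K}$ with $\|z^0\|\le\varepsilon$, set $$z^n=\big(\varphi^h_{H_0^{(K)}}\circ\varphi^h_{P^{(K)}}\big)^n(z^0).$$ Then $z^n$ is real for every $n$ for which it is defined; moreover $$z^n\text{ is defined and }\ \|z^n\|\le2\varepsilon\quad\text{for } n\le\varepsilon^{1-r},$$ $$z^n\text{ is defined and }\ |I_a(z^n)-I_a(z^0)|\le C\varepsilon^{5/2}\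 \text{ for all } a\in\mathcal N_K\quad\text{for } n\le\varepsilon^{2-r}.$$ -/

import Mathlib

noncomputable section

namespace Splitting

/-- The phase space `ℂ^{A × {±1}}` with norm `‖z‖² = ∑ |z_j|²`.  For `j = (a, δ)`, the coordinate
`z j` is `ξ_a` if `δ = 1` and `η_a` if `δ = -1`. -/
abbrev Phase (A : Type) [Fintype A] : Type := EuclideanSpace ℂ (A × ℤˣ)

section Hamiltonian

variable {A : Type} [Fintype A] [DecidableEq A]

/-- The conjugate index of `(a, δ)` is `(a, -δ)`. -/
def bar (j : A × ℤˣ) : A × ℤˣ := (j.1, -j.2)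

/-- `z` is real if `z_{bar j}` is the complex conjugate of `z_j` for all `j`. -/
def IsReal (z : Phase A) : Prop := ∀ j, z (bar j) = (starRingEnd ℂ) (z j)

/-- A Hamiltonian on `U` is real if its values at the real points of `U` are real numbers. -/
def IsRealHam (U : Set (Phase A)) (H : Phase A → ℂ) : Prop :=
  ∀ z ∈ U, IsReal z → (H z).im = 0

/-- The partial derivative of order `ℓ`, with respect to the complex variables
`z_{j 0}, …, z_{j (ℓ-1)}`. -/
def partialDeriv {ℓ : ℕ} (H : Phase A → ℂ) (j : Fin ℓ → A × ℤˣ) (z : Phase A) : ℂ :=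
  iteratedFDeriv ℂ ℓ H z fun i => EuclideanSpace.single (j i) (1 : ℂ)

/-- The Hamiltonian vector field for `i ∑ dξ_a ∧ dη_a`, that is
`ξ_a' = -i ∂H/∂η_a` and `η_a' = i ∂H/∂ξ_a`. -/
def hamVF (H : Phase A → ℂ) (z : Phase A) : Phase A :=
  WithLp.toLp 2 fun j =>
    -Complex.I * ((j.2 : ℤ) : ℂ) * fderiv ℂ H z (EuclideanSpace.single (bar j) (1 : ℂ))

/-- `γ` solves the Hamiltonian system of `H` on `[0, T]`, starts at `z` and stays in the domain
`U` of `H`. -/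
def IsTrajectory (U : Set (Phase A)) (H : Phase A → ℂ) (T : ℝ) (z : Phase A)
    (γ : ℝ → Phase A) : Prop :=
  γ 0 = z ∧ ∀ t ∈ Set.Icc 0 T,
    γ t ∈ U ∧ HasDerivWithinAt γ (hamVF H (γ t)) (Set.Icc 0 T) t

/-- The flow at time `T ≥ 0` of the Hamiltonian `H` with domain `U`, a partial map: it is defined
at `z` if the solution that starts at `z` exists in `U` on the whole of `[0, T]`.  (For smooth `H`
on an open `U` that solution is unique on `[0, T]`, so the choice below does not matter.) -/
def flow (U : Set (Phase A)) (H : Phase A → ℂ) (T : ℝ) : Phase A →. Phase A := fun z =>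
  ⟨∃ γ, IsTrajectory U H T z γ, fun hz => hz.choose T⟩

/-- The action `I_a(z) = ξ_a η_a`. -/
def action (a : A) (z : Phase A) : ℂ := z (a, 1) * z (a, -1)

/-- The quadratic Hamiltonian `H₀ = ∑ ω_a I_a`. -/
def quadHam (ω : A → ℝ) (z : Phase A) : ℂ := ∑ a, (ω a : ℂ) * action a z

/-- `z^n = (φ^h_{H₀} ∘ φ^h_P)^n (z⁰)`, as a partial value: it is undefined once one of the flows
is not defined up to time `h`. -/
def iterates (U : Set (Phase A)) (ω : A → ℝ) (P : Phase A → ℂ) (h : ℝ) (z₀ : Phase A)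
    (n : ℕ) : Part (Phase A) :=
  (fun w : Part (Phase A) =>
    w.bind ((flow Set.univ (quadHam ω) h).comp (flow U P h)))^[n] (Part.some z₀)

end Hamiltonian

/-- `Ω(j) = δ₁ ω_{a₁} + ⋯ + δ_s ω_{a_s}` for `j = ((a₁, δ₁), …, (a_s, δ_s))`. -/
def Omega {A : Type} (ω : A → ℝ) {s : ℕ} (j : Fin s → A × ℤˣ) : ℝ :=
  ∑ i, (((j i).2 : ℤ) : ℝ) * ω (j i).1

/-- `j` depends only on the actions: up to a permutation,
`j = ((a₁, 1), …, (a_m, 1), (a₁, -1), …, (a_m, -1))`. -/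
def DependsOnlyOnActions {A : Type} {s : ℕ} (j : Fin s → A × ℤˣ) : Prop :=
  ∃ (m : ℕ) (e : Fin m ⊕ Fin m ≃ Fin s) (a : Fin m → A),
    ∀ i, j (e (Sum.inl i)) = (a i, 1) ∧ j (e (Sum.inr i)) = (a i, -1)

section Discretization

variable {d : ℕ} {N : Set (Fin d → ℤ)}

/-- `ℓ²` of the full index set `N × {±1}`. -/
abbrev FullPhase (N : Set (Fin d → ℤ)) : Type := lp (fun _ : N × ℤˣ => ℂ) 2

/-- The natural projection of `ℓ²` onto the coordinates with index in `NK × {±1}`. -/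
def proj (NK : Finset N) (u : FullPhase N) : Phase NK :=
  WithLp.toLp 2 fun j => u ((j.1 : N), j.2)

/-- The non-resonance condition on the step size `h`, uniform in `K`: for every length `s`, and
every `K ≥ 1`, tuples that do not depend only on the actions satisfy
`|1 - exp (i h Ω(j))| ≥ h γ(s) / K^{α(s)}`. -/
def NonResonant (NK : ℕ → Finset N) (ω : N → ℝ) (h : ℝ) (γ α : ℕ → ℝ) : Prop :=
  ∀ s : ℕ, ∀ K : ℕ, 1 ≤ K → ∀ j : Fin s → NK K × ℤˣ, ¬ DependsOnlyOnActions j →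
    h * γ s / (K : ℝ) ^ α s ≤
      ‖1 - Complex.exp (Complex.I * (h * Omega (fun a : NK K => ω a) j : ℝ))‖

end Discretization

end Splitting

end

/-! One step of the method is the flow of `P` up to time `h` followed by a rotation. It suffices to
find, for each `a`, a polynomial that is close to `I_a` near the origin and hardly changes in one
step. It comes from a normal form computed with formal power series, so no change of variables is
ever carried out on phase space.

Replace `P` by a Taylor polynomial `Q` and insert a formal parameter `X`. Let `R` be composition
with the rotation and let `E` be the formal solution of `E' = {E, hQ}`, `E(0) = R`: it is the
pull-back by the step with `Q` scaled by `X`. One looks for a generator `Y`, with evolution `T' =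
{T, Y}`, `T(0) = id`, such that `J_a = T I_a` satisfies `E J_a = J_a`. Differentiation in `X` shows
that it is enough to have `E Y + hQ - Y = T Z` with some `Z` that commutes with the actions
(`evolve_evolve_eq`).

At order `m` this equation reads `Y_m - R Y_m + Z_m = G_m`, where `G_m` involves lower orders only.
As `R` is diagonal on monomials, `Z_m` takes the resonant monomials of `G_m`, and `Y_m` the others
divided by `1 - eigenvalue`. The small divisors are at least `h` times a power of `1/K`, and `G_m`
is itself of size `h`, so the estimates do not degenerate for small `h` (`Tame.divOp`,
`Tame.normY_normZ`).

The coefficient of `J_a` at order `m` has degree at least `m + 2`. Hence truncation at order `M`,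
with `X = 1`, gives a polynomial that changes by `O(ε^(M+3))` in one step
(`exists_norm_approxInt_step_le`) and differs from `I_a` by `O(ε^3)`
(`exists_norm_approxInt_sub_action_le`). At real points `‖z‖² = 2 ∑ I_a`, so control of the actions
keeps the orbit near the origin, where the next step is defined; induction on `n` closes the
argument (`exists_action_iterates_sub_le`).

The required bounds on the derivatives of `P` follow from those of order two by Cauchy's estimates
(`Admissible.norm_iteratedFDeriv_le`). All constants are powers of `Λ = 2K` with exponents
independent of `K`, and the condition `K ≤ ε^(-σ)` absorbs them. -/

noncomputable section

namespace Splitting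

open PowerSeries Finset.HasAntidiagonal

/-! ### Poisson brackets built from commuting derivations. -/

section Bracket

variable {A : Type}

@[simp]
theorem bar_bar (j : A × ℤˣ) : bar (bar j) = j := by
  simp [bar]

theorem bar_involutive : Function.Involutive (bar : A × ℤˣ → A × ℤˣ) := bar_bar

/-- The coefficients of the Poisson structure: `-i` at `(a, 1)` and `i` at `(a, -1)`. -/
def symp (j : A × ℤˣ) : ℂ := -Complex.I * ((j.2 : ℤ) : ℂ)

theorem symp_bar (j : A × ℤˣ) : symp (bar j) = -symp j := by
  simp [symp, bar]

variable [Fintype A] {B : Type*} [CommRing B] [Algebra ℂ B]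

/-- The Poisson bracket `∑ j, symp j • ∂_j F ∂_{bar j} G` attached to a family of derivations. -/
def bracket (D : A × ℤˣ → Derivation ℂ B B) : B →ₗ[ℂ] B →ₗ[ℂ] B :=
  ∑ j, symp j • (LinearMap.mul ℂ B).compl₁₂ (D j : B →ₗ[ℂ] B) (D (bar j) : B →ₗ[ℂ] B)

theorem bracket_apply (D : A × ℤˣ → Derivation ℂ B B) (F G : B) :
    bracket D F G = ∑ j, symp j • (D j F * D (bar j) G) := by
  simp [bracket, LinearMap.sum_apply]

/-- Serves twice: for the derivations `D j` themselves in the Jacobi identity, and for the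
derivative in the formal parameter. -/
theorem derivation_bracket (D : A × ℤˣ → Derivation ℂ B B) (d : Derivation ℂ B B)
    (hd : ∀ j F, d (D j F) = D j (d F)) (F G : B) :
    d (bracket D F G) = bracket D (d F) G + bracket D F (d G) := by
  simp only [bracket_apply, map_sum, Derivation.map_smul, Derivation.leibniz, smul_eq_mul, hd,
    smul_add, Finset.sum_add_distrib]
  rw [add_comm]
  congr 1
  exact Finset.sum_congr rfl fun j _ => by rw [mul_comm]

/-- The Jacobi identity: the bracket with `H` is a derivation of the bracket. -/
theorem bracket_jacobi (D : A × ℤˣ → Derivation ℂ B B)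
    (hD : ∀ i j F, D i (D j F) = D j (D i F)) (F G H : B) :
    bracket D (bracket D F G) H
      = bracket D (bracket D F H) G + bracket D F (bracket D G H) := by
  have hder : ∀ (X Y : B) (j : A × ℤˣ),
      D j (bracket D X Y) = bracket D (D j X) Y + bracket D X (D j Y) :=
    fun X Y j => derivation_bracket D (D j) (fun i X => hD j i X) X Y
  have hmul : ∀ X Y : B, bracket D (X * Y) H = bracket D X H * Y + X * bracket D Y H := by
    intro X Y
    simp only [bracket_apply, Derivation.leibniz, smul_eq_mul, Finset.sum_mul, Finset.mul_sum,
      ← Finset.sum_add_distrib, smul_mul_assoc, mul_smul_comm, ← smul_add]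
    exact Finset.sum_congr rfl fun j _ => by ring_nf
  -- These are the terms with second derivatives of `H`. They cancel because exchanging the roles of
  -- the two summation indices, with a `bar` on each, reverses the sign.
  have hcancel : (∑ j, symp j • (bracket D F (D j H) * D (bar j) G))
      + ∑ j, symp j • (D j F * bracket D G (D (bar j) H)) = 0 := by
    have h1 : (∑ j, symp j • (bracket D F (D j H) * D (bar j) G))
        = ∑ j, ∑ k, (symp j * symp k) • (D k F * D (bar j) G * D j (D (bar k) H)) := by
      refine Finset.sum_congr rfl fun j _ => ?_
      rw [bracket_apply, Finset.sum_mul, Finset.smul_sum]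
      refine Finset.sum_congr rfl fun k _ => ?_
      rw [smul_mul_assoc, smul_smul, hD j]
      ring_nf
    have h2 : (∑ j, symp j • (D j F * bracket D G (D (bar j) H)))
        = ∑ j, ∑ k, -(symp j * symp k) • (D k F * D (bar j) G * D j (D (bar k) H)) := by
      rw [Finset.sum_comm]
      refine Finset.sum_congr rfl fun k _ => ?_
      rw [bracket_apply, Finset.mul_sum, Finset.smul_sum,
        ← Equiv.sum_comp (bar_involutive (A := A)).toPerm]
      refine Finset.sum_congr rfl fun j _ => ?_
      simp only [Function.Involutive.coe_toPerm, bar_bar, symp_bar]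
      rw [mul_smul_comm, smul_smul]
      ring_nf
    rw [h1, h2, ← Finset.sum_add_distrib]
    refine Finset.sum_eq_zero fun j _ => ?_
    rw [← Finset.sum_add_distrib]
    exact Finset.sum_eq_zero fun k _ => by simp
  have hL : bracket D (bracket D F G) H
      = (∑ j, symp j • (bracket D (D j F) H * D (bar j) G))
        + ∑ j, symp j • (D j F * bracket D (D (bar j) G) H) := by
    conv_lhs => rw [bracket_apply D F G]
    simp only [map_sum, map_smul, LinearMap.sum_apply, LinearMap.smul_apply, hmul, smul_add,
      Finset.sum_add_distrib]
  have h3 : bracket D (bracket D F H) G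
      = (∑ j, symp j • (bracket D (D j F) H * D (bar j) G))
        + ∑ j, symp j • (bracket D F (D j H) * D (bar j) G) := by
    conv_lhs => rw [bracket_apply D _ G]
    simp only [hder, add_mul, smul_add, Finset.sum_add_distrib]
  have h4 : bracket D F (bracket D G H)
      = (∑ j, symp j • (D j F * bracket D (D (bar j) G) H))
        + ∑ j, symp j • (D j F * bracket D G (D (bar j) H)) := by
    conv_lhs => rw [bracket_apply D F]
    simp only [hder, mul_add, smul_add, Finset.sum_add_distrib]
  rw [hL, h3, h4]
  linear_combination -hcancel

end Bracket

/-! ### Extension of the bracket to formal power series. -/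

section PowerSeriesBracket

variable {A : Type} [Fintype A] {S : Type*} [CommRing S] [Algebra ℂ S]

/-- The coefficientwise extension of a derivation to power series. -/
def liftDer (d : Derivation ℂ S S) : Derivation ℂ S⟦X⟧ S⟦X⟧ :=
  Derivation.mk'
    { toFun := fun F => PowerSeries.mk fun n => d (coeff n F)
      map_add' := fun F G => by ext n; simp
      map_smul' := fun c F => by ext n; simp }
    (fun F G => by
      ext n
      simp only [LinearMap.coe_mk, AddHom.coe_mk, coeff_mk, coeff_mul, map_sum,
        Derivation.leibniz, smul_eq_mul, map_add, Finset.sum_add_distrib]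
      congr 1
      rw [← Finset.Nat.sum_antidiagonal_swap]
      rfl)

@[simp]
theorem coeff_liftDer (d : Derivation ℂ S S) (F : S⟦X⟧) (n : ℕ) :
    coeff n (liftDer d F) = d (coeff n F) := by
  simp [liftDer]

/-- The extension of the bracket to power series. -/
abbrev psBracket (D : A × ℤˣ → Derivation ℂ S S) : S⟦X⟧ →ₗ[ℂ] S⟦X⟧ →ₗ[ℂ] S⟦X⟧ :=
  bracket fun j => liftDer (D j)

variable (D : A × ℤˣ → Derivation ℂ S S)

theorem coeff_psBracket (F G : S⟦X⟧) (n : ℕ) :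
    coeff n (psBracket D F G)
      = ∑ p ∈ antidiagonal n, bracket D (coeff p.1 F) (coeff p.2 G) := by
  simp only [psBracket, bracket_apply, map_sum]
  rw [Finset.sum_comm]
  refine Finset.sum_congr rfl fun j _ => ?_
  rw [PowerSeries.coeff_smul, coeff_mul, Finset.smul_sum]
  simp

theorem psBracket_jacobi (hD : ∀ i j F, D i (D j F) = D j (D i F)) (F G H : S⟦X⟧) :
    psBracket D (psBracket D F G) H
      = psBracket D (psBracket D F H) G + psBracket D F (psBracket D G H) :=
  bracket_jacobi _ (fun i j F => by ext n; simp [hD]) F G H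

theorem derivative_psBracket (F G : S⟦X⟧) :
    d⁄dX S (psBracket D F G) = psBracket D (d⁄dX S F) G + psBracket D F (d⁄dX S G) := by
  refine derivation_bracket _ ((d⁄dX S).restrictScalars ℂ) (fun j F => ?_) F G
  ext n
  simp [coeff_derivative, mul_comm]

theorem psBracket_X_mul_left (F G : S⟦X⟧) :
    psBracket D (X * F) G = X * psBracket D F G := by
  ext n
  cases n with
  | zero => simp [coeff_psBracket]
  | succ n =>
    rw [coeff_succ_X_mul, coeff_psBracket, coeff_psBracket, Finset.Nat.antidiagonal_succ]
    simp [coeff_succ_X_mul]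

theorem psBracket_X_mul_right (F G : S⟦X⟧) :
    psBracket D F (X * G) = X * psBracket D F G := by
  ext n
  cases n with
  | zero => simp [coeff_psBracket]
  | succ n =>
    rw [coeff_succ_X_mul, coeff_psBracket, coeff_psBracket, Finset.Nat.antidiagonal_succ']
    simp [coeff_succ_X_mul]

theorem psBracket_C (F G : S) : psBracket D (C F) (C G) = C (bracket D F G) := by
  ext n
  rw [coeff_psBracket]
  cases n with
  | zero => simp
  | succ n =>
    rw [coeff_C, if_neg (Nat.succ_ne_zero n)]
    refine Finset.sum_eq_zero fun p hp => ?_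
    rw [Finset.HasAntidiagonal.mem_antidiagonal] at hp
    rcases Nat.eq_zero_or_pos p.1 with h | h
    · rw [coeff_C (n := p.2), if_neg (by omega), map_zero]
    · rw [coeff_C (n := p.1), if_neg (by omega), map_zero, LinearMap.zero_apply]

/-- Uniqueness for a linear formal differential equation: its coefficient at order `n` expresses `(n
+ 1) F_{n+1}` through `F_0, …, F_n`, and `n + 1` can be cancelled. -/
theorem eq_zero_of_derivative_eq_psBracket [IsAddTorsionFree S] {F V : S⟦X⟧}
    (h0 : coeff 0 F = 0) (h : d⁄dX S F = psBracket D F V) : F = 0 := by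
  ext n
  rw [map_zero]
  induction n using Nat.strong_induction_on with
  | _ n ih =>
    cases n with
    | zero => exact h0
    | succ n =>
      have h1 := congrArg (coeff n) h
      rw [coeff_derivative, coeff_psBracket, Finset.sum_eq_zero] at h1
      · rw [mul_comm, ← Nat.cast_succ, ← nsmul_eq_mul] at h1
        exact (smul_eq_zero.mp h1).resolve_left (Nat.succ_ne_zero n)
      · intro p hp
        rw [Finset.HasAntidiagonal.mem_antidiagonal] at hp
        rw [ih p.1 (by omega), map_zero, LinearMap.zero_apply]

end PowerSeriesBracket

/-! ### Formal evolutions generated by a power series, and transport of integrals. -/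

section Evolution

variable {A : Type} [Fintype A] {S : Type*} [CommRing S] [Algebra ℂ S]
  (D : A × ℤˣ → Derivation ℂ S S)

/-- The coefficients of the formal solution of `E' = {E, Y}`, `E(0) = R`. -/
def evol (Y : ℕ → S) (R : S →ₗ[ℂ] S) : ℕ → S →ₗ[ℂ] S
  | 0 => R
  | m + 1 => ((m + 1 : ℕ) : ℂ)⁻¹ •
      ∑ i : Fin (m + 1), (bracket D).flip (Y (m - i)) ∘ₗ evol Y R i

variable {D}

theorem evol_zero (Y : ℕ → S) (R : S →ₗ[ℂ] S) : evol D Y R 0 = R := by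
  rw [evol]

theorem evol_succ (Y : ℕ → S) (R : S →ₗ[ℂ] S) (m : ℕ) (F : S) :
    evol D Y R (m + 1) F = ((m + 1 : ℕ) : ℂ)⁻¹ •
      ∑ p ∈ antidiagonal m, bracket D (evol D Y R p.1 F) (Y p.2) := by
  rw [evol, Finset.Nat.sum_antidiagonal_eq_sum_range_succ
    (fun i j => bracket D (evol D Y R i F) (Y j)), ← Fin.sum_univ_eq_sum_range
    (fun i => bracket D (evol D Y R i F) (Y (m - i)))]
  simp [LinearMap.sum_apply]

/-- The coefficient at order `m` sees the generator below order `m` only; this is what permits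
solving for `Y` recursively. -/
theorem evol_congr {Y Y' : ℕ → S} (R : S →ₗ[ℂ] S) (m : ℕ) (h : ∀ k < m, Y k = Y' k) :
    evol D Y R m = evol D Y' R m := by
  induction m using Nat.strong_induction_on with
  | _ m ih =>
    cases m with
    | zero => simp [evol_zero]
    | succ m =>
      ext F
      rw [evol_succ, evol_succ]
      congr 1
      refine Finset.sum_congr rfl fun p hp => ?_
      rw [Finset.HasAntidiagonal.mem_antidiagonal] at hp
      rw [ih p.1 (by omega) fun k hk => h k (by omega), h p.2 (by omega)]

/-- A constant generator gives the exponential series of the operator `{·, Q}`, whose terms are the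
Taylor coefficients in time along the flow of `Q`. -/
theorem evol_const (Q : S) (R : S →ₗ[ℂ] S) (m : ℕ) (F : S) :
    evol D (fun k => coeff k (C Q)) R m F
      = ((m.factorial : ℕ) : ℂ)⁻¹ • ((bracket D).flip Q)^[m] (R F) := by
  induction m with
  | zero => simp [evol_zero]
  | succ m ih =>
    rw [evol_succ, Finset.sum_eq_single (m, 0)]
    · rw [ih, Function.iterate_succ_apply', Nat.factorial_succ]
      simp [smul_smul, mul_comm]
    · intro p hp hne
      rw [Finset.HasAntidiagonal.mem_antidiagonal] at hp
      rw [coeff_C, if_neg, map_zero]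
      rintro h2
      exact hne (Prod.ext (by simpa [h2] using hp) h2)
    · simp

/-- The action of the formal evolution on power series. -/
def evolve (D : A × ℤˣ → Derivation ℂ S S) (Y : S⟦X⟧) (R : S →ₗ[ℂ] S) (F : S⟦X⟧) : S⟦X⟧ :=
  PowerSeries.mk fun m => ∑ p ∈ antidiagonal m,
    evol D (fun k => coeff k Y) R p.1 (coeff p.2 F)

theorem coeff_evolve (Y : S⟦X⟧) (R : S →ₗ[ℂ] S) (F : S⟦X⟧) (m : ℕ) :
    coeff m (evolve D Y R F) = ∑ p ∈ antidiagonal m,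
      evol D (fun k => coeff k Y) R p.1 (coeff p.2 F) := by
  simp [evolve]

theorem coeff_zero_evolve (Y : S⟦X⟧) (R : S →ₗ[ℂ] S) (F : S⟦X⟧) :
    coeff 0 (evolve D Y R F) = R (coeff 0 F) := by
  simp [coeff_evolve, evol_zero]

theorem evolve_add (Y : S⟦X⟧) (R : S →ₗ[ℂ] S) (F G : S⟦X⟧) :
    evolve D Y R (F + G) = evolve D Y R F + evolve D Y R G := by
  ext m
  simp [coeff_evolve, Finset.sum_add_distrib]

theorem evolve_zero (Y : S⟦X⟧) (R : S →ₗ[ℂ] S) : evolve D Y R 0 = 0 := by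
  ext m
  simp [coeff_evolve]

theorem evolve_X_mul (Y : S⟦X⟧) (R : S →ₗ[ℂ] S) (F : S⟦X⟧) :
    evolve D Y R (X * F) = X * evolve D Y R F := by
  ext m
  cases m with
  | zero => simp [coeff_evolve]
  | succ m =>
    rw [coeff_succ_X_mul, coeff_evolve, coeff_evolve, Finset.Nat.antidiagonal_succ']
    simp [coeff_succ_X_mul]

theorem coeff_evolve_C (Y : S⟦X⟧) (R : S →ₗ[ℂ] S) (F : S) (m : ℕ) :
    coeff m (evolve D Y R (C F)) = evol D (fun k => coeff k Y) R m F := by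
  rw [coeff_evolve, Finset.sum_eq_single (m, 0)]
  · simp
  · intro p hp hne
    rw [Finset.HasAntidiagonal.mem_antidiagonal] at hp
    rw [coeff_C, if_neg, map_zero]
    rintro h2
    exact hne (Prod.ext (by simpa [h2] using hp) h2)
  · simp

theorem derivative_evolve_C (Y : S⟦X⟧) (R : S →ₗ[ℂ] S) (F : S) :
    d⁄dX S (evolve D Y R (C F)) = psBracket D (evolve D Y R (C F)) Y := by
  ext m
  rw [coeff_derivative, coeff_evolve_C, coeff_psBracket, evol_succ]
  simp only [coeff_evolve_C]
  rw [mul_comm, ← Nat.cast_succ, ← nsmul_eq_mul, ← Nat.cast_smul_eq_nsmul ℂ, smul_smul,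
    mul_inv_cancel₀ (Nat.cast_ne_zero.mpr (Nat.succ_ne_zero m)), one_smul]

/-- Induction principle for coefficientwise statements about power series. -/
theorem coeff_induction {S : Type*} [CommRing S] {p : ℕ → S⟦X⟧ → Prop}
    (hadd : ∀ m F G, p m F → p m G → p m (F + G))
    (hC : ∀ m F, p m (C F)) (hX0 : ∀ F, p 0 (X * F))
    (hX : ∀ m F, p m F → p (m + 1) (X * F)) (m : ℕ) (F : S⟦X⟧) : p m F := by
  induction m generalizing F with
  | zero =>
    rw [eq_X_mul_shift_add_const F]
    exact hadd _ _ _ (hX0 _) (hC _ _)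
  | succ m ih =>
    rw [eq_X_mul_shift_add_const F]
    exact hadd _ _ _ (hX _ _ (ih _)) (hC _ _)

/-- A product rule: one term differentiates the dependence of the argument on `X`, the other the
evolution itself. Since `evolve` is linear over `X`, the case of constants is enough. -/
theorem derivative_evolve (Y : S⟦X⟧) (R : S →ₗ[ℂ] S) (F : S⟦X⟧) :
    d⁄dX S (evolve D Y R F) = evolve D Y R (d⁄dX S F) + psBracket D (evolve D Y R F) Y := by
  have hX : ∀ F : S⟦X⟧, d⁄dX S (X * F) = F + X * d⁄dX S F := by
    intro F
    simp [Derivation.leibniz, add_comm]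
  ext m
  refine coeff_induction (p := fun m F => coeff m (d⁄dX S (evolve D Y R F))
    = coeff m (evolve D Y R (d⁄dX S F) + psBracket D (evolve D Y R F) Y)) ?_ ?_ ?_ ?_ m F
  · intro m F G hF hG
    simp only [map_add, evolve_add, LinearMap.add_apply] at hF hG ⊢
    rw [hF, hG]
    abel
  · intro m F
    rw [derivative_evolve_C, derivative_C, evolve_zero, zero_add]
  · intro F
    simp [evolve_X_mul, hX, evolve_add, psBracket_X_mul_left]
  · intro m F hF
    simp only [map_add, evolve_X_mul, hX, evolve_add, psBracket_X_mul_left,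
      coeff_succ_X_mul] at hF ⊢
    rw [hF]
    abel

/-- A Hamiltonian evolution is symplectic. For constant arguments the difference of both sides
vanishes at order zero and, by the Jacobi identity, solves the linear equation `W' = {W, Y}`; hence
it is zero. Linearity over `X` gives the general case. -/
theorem evolve_psBracket [IsAddTorsionFree S] (hD : ∀ i j F, D i (D j F) = D j (D i F))
    (Y : S⟦X⟧) (R : S →ₗ[ℂ] S) (hR : ∀ F G, R (bracket D F G) = bracket D (R F) (R G))
    (F G : S⟦X⟧) :
    evolve D Y R (psBracket D F G) = psBracket D (evolve D Y R F) (evolve D Y R G) := by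
  have hCC : ∀ F G : S, evolve D Y R (psBracket D (C F) (C G))
      = psBracket D (evolve D Y R (C F)) (evolve D Y R (C G)) := by
    intro F G
    rw [← sub_eq_zero, psBracket_C]
    refine eq_zero_of_derivative_eq_psBracket D (V := Y) ?_ ?_
    · rw [map_sub, coeff_psBracket]
      simp only [Finset.Nat.antidiagonal_zero, Finset.sum_singleton, coeff_zero_evolve,
        coeff_zero_C, hR, sub_self]
    · rw [map_sub, derivative_evolve_C, derivative_psBracket, derivative_evolve_C,
        derivative_evolve_C, map_sub, LinearMap.sub_apply, psBracket_jacobi D hD _ _ Y]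
  ext m
  revert F
  refine fun F => coeff_induction (p := fun m F => ∀ G, coeff m (evolve D Y R (psBracket D F G))
    = coeff m (psBracket D (evolve D Y R F) (evolve D Y R G))) ?_ ?_ ?_ ?_ m F G
  · intro m F F' hF hF' G
    simp only [map_add, evolve_add, LinearMap.add_apply, hF, hF']
  · intro m F G
    refine coeff_induction (p := fun m G => coeff m (evolve D Y R (psBracket D (C F) G))
      = coeff m (psBracket D (evolve D Y R (C F)) (evolve D Y R G))) ?_ ?_ ?_ ?_ m G
    · intro m G G' hG hG'
      simp only [map_add, evolve_add, hG, hG']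
    · intro m G
      rw [hCC]
    · intro G
      simp [psBracket_X_mul_right, evolve_X_mul]
    · intro m G hG
      simp only [psBracket_X_mul_right, evolve_X_mul, coeff_succ_X_mul, hG]
  · intro F G
    simp [psBracket_X_mul_left, evolve_X_mul]
  · intro m F hF G
    simp only [psBracket_X_mul_left, evolve_X_mul, coeff_succ_X_mul, hF]

/-- A solution `(Y, Z)` of the homological equation transports every `I` that commutes with `Z`
to a formal integral of the evolution generated by `Q`. -/
theorem evolve_evolve_eq [IsAddTorsionFree S] (hD : ∀ i j F, D i (D j F) = D j (D i F))
    (R : S →ₗ[ℂ] S) (hR : ∀ F G, R (bracket D F G) = bracket D (R F) (R G))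
    {Q Y Z : S⟦X⟧}
    (hY : evolve D Q R Y + Q - Y = evolve D Y LinearMap.id Z) {I : S} (hI : R I = I)
    (hIZ : psBracket D (C I) Z = 0) :
    evolve D Q R (evolve D Y LinearMap.id (C I)) = evolve D Y LinearMap.id (C I) := by
  set J := evolve D Y LinearMap.id (C I) with hJ
  have hdJ : d⁄dX S J = psBracket D J Y := derivative_evolve_C _ _ _
  have hJW : psBracket D J (evolve D Y LinearMap.id Z) = 0 := by
    rw [hJ, ← evolve_psBracket hD Y LinearMap.id (fun _ _ => rfl), hIZ, evolve_zero]
  -- Put `W = evolve D Y id Z`. By the homological equation the derivative of `E J - J` is `{E J, W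
  -- + Y} - {J, Y}`, which equals `{E J - J, W + Y}` because `{J, W} = 0`. So uniqueness for the
  -- linear equation applies.
  rw [← sub_eq_zero]
  refine eq_zero_of_derivative_eq_psBracket D
    (V := evolve D Y LinearMap.id Z + Y) ?_ ?_
  · simp only [map_sub, coeff_zero_evolve, hJ, coeff_zero_C, LinearMap.id_apply, hI, sub_self]
  · rw [map_sub, derivative_evolve, hdJ, evolve_psBracket hD Q R hR, map_sub,
      LinearMap.sub_apply, map_add, map_add, hJW, ← hY]
    simp only [map_add, map_sub]
    abel

end Evolution

end Splitting

end

noncomputable section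

namespace Splitting

open PowerSeries Finset.HasAntidiagonal
open scoped Pointwise

/-! ### The coefficient norm, degree filtrations and diagonal operators on polynomials. -/

section PolynomialNorm

variable {σ : Type*}

/-- The `ℓ¹` norm of the coefficients of a polynomial. -/
def l1 (F : MvPolynomial σ ℂ) : ℝ := ∑ μ ∈ F.support, ‖F.coeff μ‖

theorem l1_eq_sum_of_subset {F : MvPolynomial σ ℂ} {s : Finset (σ →₀ ℕ)} (h : F.support ⊆ s) :
    l1 F = ∑ μ ∈ s, ‖F.coeff μ‖ :=
  Finset.sum_subset h fun μ _ hμ => by simpa using hμ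

theorem l1_nonneg (F : MvPolynomial σ ℂ) : 0 ≤ l1 F :=
  Finset.sum_nonneg fun _ _ => norm_nonneg _

@[simp]
theorem l1_zero : l1 (0 : MvPolynomial σ ℂ) = 0 := by
  simp [l1]

theorem l1_add_le (F G : MvPolynomial σ ℂ) : l1 (F + G) ≤ l1 F + l1 G := by
  classical
  rw [l1_eq_sum_of_subset (MvPolynomial.support_add (p := F) (q := G)),
    l1_eq_sum_of_subset (Finset.subset_union_left (s₁ := F.support) (s₂ := G.support)),
    l1_eq_sum_of_subset (Finset.subset_union_right (s₁ := F.support) (s₂ := G.support)),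
    ← Finset.sum_add_distrib]
  exact Finset.sum_le_sum fun μ _ => by
    rw [MvPolynomial.coeff_add]
    exact norm_add_le _ _

theorem l1_sum_le {ι : Type*} (s : Finset ι) (F : ι → MvPolynomial σ ℂ) :
    l1 (∑ i ∈ s, F i) ≤ ∑ i ∈ s, l1 (F i) :=
  Finset.le_sum_of_subadditive _ l1_zero.le l1_add_le s F

theorem l1_smul (c : ℂ) (F : MvPolynomial σ ℂ) : l1 (c • F) = ‖c‖ * l1 F := by
  rw [l1_eq_sum_of_subset MvPolynomial.support_smul, l1, Finset.mul_sum]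
  simp

theorem l1_monomial (μ : σ →₀ ℕ) (c : ℂ) : l1 (MvPolynomial.monomial μ c) = ‖c‖ := by
  classical
  rw [l1_eq_sum_of_subset MvPolynomial.support_monomial_subset, Finset.sum_singleton,
    MvPolynomial.coeff_monomial, if_pos rfl]

theorem l1_map_le (T : MvPolynomial σ ℂ →ₗ[ℂ] MvPolynomial σ ℂ) (F : MvPolynomial σ ℂ) {k : ℝ}
    (h : ∀ μ ∈ F.support, ∀ c, l1 (T (MvPolynomial.monomial μ c)) ≤ k * ‖c‖) :
    l1 (T F) ≤ k * l1 F := by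
  conv_lhs => rw [F.as_sum, map_sum]
  refine (l1_sum_le _ _).trans ?_
  rw [l1, Finset.mul_sum]
  exact Finset.sum_le_sum fun μ hμ => h μ hμ _

theorem l1_mul_le (F G : MvPolynomial σ ℂ) : l1 (F * G) ≤ l1 F * l1 G := by
  rw [mul_comm, mul_comm (l1 F)]
  refine l1_map_le (LinearMap.mulLeft ℂ G) F fun μ _ c => ?_
  rw [LinearMap.mulLeft_apply, mul_comm, mul_comm (l1 G)]
  refine l1_map_le (LinearMap.mulLeft ℂ (MvPolynomial.monomial μ c)) G fun ν _ d => ?_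
  rw [LinearMap.mulLeft_apply, MvPolynomial.monomial_mul, l1_monomial, norm_mul]

theorem mem_of_mem_support {s : Set (σ →₀ ℕ)} {F : MvPolynomial σ ℂ}
    (hF : F ∈ MvPolynomial.restrictSupport ℂ s) {μ : σ →₀ ℕ} (hμ : μ ∈ F.support) : μ ∈ s :=
  (MvPolynomial.mem_restrictSupport_iff _).mp hF (Finset.mem_coe.mpr hμ)

theorem map_mem_of_monomial {s : Set (σ →₀ ℕ)} {M : Submodule ℂ (MvPolynomial σ ℂ)}
    (T : MvPolynomial σ ℂ →ₗ[ℂ] MvPolynomial σ ℂ)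
    (h : ∀ μ ∈ s, ∀ c, T (MvPolynomial.monomial μ c) ∈ M) {F : MvPolynomial σ ℂ}
    (hF : F ∈ MvPolynomial.restrictSupport ℂ s) : T F ∈ M := by
  rw [F.as_sum, map_sum]
  exact Submodule.sum_mem _ fun μ hμ => h μ (mem_of_mem_support hF hμ) _

/-- The polynomials all of whose monomials have degree at least `n`. -/
def lowDeg (σ : Type*) (n : ℕ) : Submodule ℂ (MvPolynomial σ ℂ) :=
  MvPolynomial.restrictSupport ℂ {μ | n ≤ μ.degree}

/-- The polynomials all of whose monomials have degree at most `n`. -/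
def upDeg (σ : Type*) (n : ℕ) : Submodule ℂ (MvPolynomial σ ℂ) :=
  MvPolynomial.restrictSupport ℂ {μ | μ.degree ≤ n}

theorem lowDeg_mono {m n : ℕ} (h : m ≤ n) : lowDeg σ n ≤ lowDeg σ m :=
  MvPolynomial.restrictSupport_mono ℂ fun _ hμ => le_trans h hμ

theorem upDeg_mono {m n : ℕ} (h : m ≤ n) : upDeg σ m ≤ upDeg σ n :=
  MvPolynomial.restrictSupport_mono ℂ fun _ hμ => le_trans hμ h

theorem mul_mem_restrictSupport {s t u : Set (σ →₀ ℕ)} (h : ∀ μ ∈ s, ∀ ν ∈ t, μ + ν ∈ u)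
    {F G : MvPolynomial σ ℂ} (hF : F ∈ MvPolynomial.restrictSupport ℂ s)
    (hG : G ∈ MvPolynomial.restrictSupport ℂ t) : F * G ∈ MvPolynomial.restrictSupport ℂ u := by
  refine MvPolynomial.restrictSupport_mono ℂ (s := s + t) ?_ ?_
  · rintro _ ⟨μ, hμ, ν, hν, rfl⟩
    exact h μ hμ ν hν
  · rw [MvPolynomial.restrictSupport_add]
    exact Submodule.mul_mem_mul hF hG

theorem mul_mem_lowDeg {m n : ℕ} {F G : MvPolynomial σ ℂ} (hF : F ∈ lowDeg σ m)
    (hG : G ∈ lowDeg σ n) : F * G ∈ lowDeg σ (m + n) :=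
  mul_mem_restrictSupport (fun μ hμ ν hν => by
    simp only [Set.mem_ofPred_eq, map_add] at *; omega) hF hG

theorem mul_mem_upDeg {m n : ℕ} {F G : MvPolynomial σ ℂ} (hF : F ∈ upDeg σ m)
    (hG : G ∈ upDeg σ n) : F * G ∈ upDeg σ (m + n) :=
  mul_mem_restrictSupport (fun μ hμ ν hν => by
    simp only [Set.mem_ofPred_eq, map_add] at *; omega) hF hG

theorem degree_sub_single {μ : σ →₀ ℕ} {j : σ} (h : μ j ≠ 0) :
    (μ - Finsupp.single j 1).degree + 1 = μ.degree := by
  classical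
  have h1 : μ - Finsupp.single j 1 + Finsupp.single j 1 = μ := by
    ext k
    rcases eq_or_ne j k with rfl | hk
    · simp; omega
    · simp [hk]
  conv_rhs => rw [← h1, map_add, Finsupp.degree_single]

theorem pderiv_mem_restrictSupport (j : σ) {s t : Set (σ →₀ ℕ)}
    (h : ∀ μ ∈ s, μ j ≠ 0 → μ - Finsupp.single j 1 ∈ t) {F : MvPolynomial σ ℂ}
    (hF : F ∈ MvPolynomial.restrictSupport ℂ s) :
    MvPolynomial.pderiv j F ∈ MvPolynomial.restrictSupport ℂ t := by
  refine map_mem_of_monomial (MvPolynomial.pderiv j : Derivation ℂ (MvPolynomial σ ℂ) _).toLinearMap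
    (fun μ hμ c => ?_) hF
  rw [Derivation.coeFn_coe, MvPolynomial.pderiv_monomial,
    MvPolynomial.monomial_mem_restrictSupport]
  by_cases h0 : μ j = 0
  · simp [h0]
  · exact Or.inl (h μ hμ h0)

theorem pderiv_mem_lowDeg (j : σ) {n : ℕ} {F : MvPolynomial σ ℂ} (hF : F ∈ lowDeg σ (n + 1)) :
    MvPolynomial.pderiv j F ∈ lowDeg σ n :=
  pderiv_mem_restrictSupport j (fun μ hμ h0 => by
    have := degree_sub_single h0
    simp only [Set.mem_ofPred_eq] at *; omega) hF

theorem pderiv_mem_upDeg (j : σ) {n : ℕ} {F : MvPolynomial σ ℂ} (hF : F ∈ upDeg σ n) :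
    MvPolynomial.pderiv j F ∈ upDeg σ n :=
  pderiv_mem_restrictSupport j (fun μ hμ h0 => by
    have := degree_sub_single h0
    simp only [Set.mem_ofPred_eq] at *; omega) hF

theorem l1_pderiv_le (j : σ) {n : ℕ} {F : MvPolynomial σ ℂ} (hF : F ∈ upDeg σ n) :
    l1 (MvPolynomial.pderiv j F) ≤ n * l1 F := by
  refine l1_map_le (MvPolynomial.pderiv j : Derivation ℂ (MvPolynomial σ ℂ) _).toLinearMap F
    fun μ hμ c => ?_
  rw [Derivation.coeFn_coe, MvPolynomial.pderiv_monomial, l1_monomial, norm_mul,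
    mul_comm (n : ℝ), Complex.norm_natCast]
  gcongr
  exact (Finsupp.le_degree j μ).trans (mem_of_mem_support hF hμ)

theorem pderiv_comm (i j : σ) (F : MvPolynomial σ ℂ) :
    MvPolynomial.pderiv i (MvPolynomial.pderiv j F)
      = MvPolynomial.pderiv j (MvPolynomial.pderiv i F) := by
  classical
  have h : ⁅(MvPolynomial.pderiv i : Derivation ℂ (MvPolynomial σ ℂ) (MvPolynomial σ ℂ)),
      (MvPolynomial.pderiv j : Derivation ℂ (MvPolynomial σ ℂ) (MvPolynomial σ ℂ))⁆ = 0 := by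
    refine MvPolynomial.derivation_ext fun k => ?_
    simp only [Derivation.commutator_apply, MvPolynomial.pderiv_X, Derivation.coe_zero,
      Pi.zero_apply]
    simp only [Pi.single_apply]
    split_ifs <;> simp
  have := DFunLike.congr_fun h F
  rwa [Derivation.commutator_apply, Derivation.coe_zero, Pi.zero_apply, sub_eq_zero] at this

/-- Since `ρ ≤ 1`, the monomials of lowest degree dominate: every monomial is at most `ρ ^ n`. -/
theorem norm_eval_le {n : ℕ} {F : MvPolynomial σ ℂ} (hF : F ∈ lowDeg σ n) {z : σ → ℂ} {ρ : ℝ}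
    (hz : ∀ j, ‖z j‖ ≤ ρ) (hρ0 : 0 ≤ ρ) (hρ : ρ ≤ 1) :
    ‖MvPolynomial.eval z F‖ ≤ l1 F * ρ ^ n := by
  rw [MvPolynomial.eval_eq, l1, Finset.sum_mul]
  refine (norm_sum_le _ _).trans (Finset.sum_le_sum fun μ hμ => ?_)
  rw [norm_mul]
  gcongr
  rw [norm_prod]
  calc ∏ i ∈ μ.support, ‖z i ^ μ i‖ ≤ ∏ i ∈ μ.support, ρ ^ μ i :=
        Finset.prod_le_prod (fun _ _ => norm_nonneg _) fun i _ => by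
          rw [norm_pow]
          exact pow_le_pow_left₀ (norm_nonneg _) (hz i) _
    _ = ρ ^ μ.degree := by rw [Finset.prod_pow_eq_pow_sum, Finsupp.degree_apply]
    _ ≤ ρ ^ n := pow_le_pow_of_le_one hρ0 hρ (mem_of_mem_support hF hμ)

/-- The operator that multiplies the monomial with exponent `μ` by `w μ`. -/
def diag (w : (σ →₀ ℕ) → ℂ) : MvPolynomial σ ℂ →ₗ[ℂ] MvPolynomial σ ℂ :=
  (MvPolynomial.basisMonomials σ ℂ).constr ℂ fun μ => MvPolynomial.monomial μ (w μ)

@[simp]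
theorem diag_monomial (w : (σ →₀ ℕ) → ℂ) (μ : σ →₀ ℕ) (c : ℂ) :
    diag w (MvPolynomial.monomial μ c) = MvPolynomial.monomial μ (w μ * c) := by
  have h : MvPolynomial.monomial μ c = c • MvPolynomial.basisMonomials σ ℂ μ := by
    simp [MvPolynomial.smul_monomial]
  rw [h, map_smul, diag, Module.Basis.constr_basis, MvPolynomial.smul_monomial, smul_eq_mul,
    mul_comm]

@[simp]
theorem coeff_diag (w : (σ →₀ ℕ) → ℂ) (F : MvPolynomial σ ℂ) (μ : σ →₀ ℕ) :
    (diag w F).coeff μ = w μ * F.coeff μ := by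
  classical
  induction F using MvPolynomial.induction_on' with
  | monomial ν c =>
    rw [diag_monomial, MvPolynomial.coeff_monomial, MvPolynomial.coeff_monomial]
    split_ifs with h
    · rw [h]
    · simp
  | add F G hF hG => rw [map_add, MvPolynomial.coeff_add, MvPolynomial.coeff_add, hF, hG, mul_add]

theorem diag_mem_restrictSupport (w : (σ →₀ ℕ) → ℂ) {s : Set (σ →₀ ℕ)} {F : MvPolynomial σ ℂ}
    (hF : F ∈ MvPolynomial.restrictSupport ℂ s) :
    diag w F ∈ MvPolynomial.restrictSupport ℂ s := by
  rw [MvPolynomial.mem_restrictSupport_iff]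
  intro μ hμ
  rw [Finset.mem_coe, MvPolynomial.mem_support_iff, coeff_diag] at hμ
  exact mem_of_mem_support hF (MvPolynomial.mem_support_iff.mpr (right_ne_zero_of_mul hμ))

theorem l1_diag_le (w : (σ →₀ ℕ) → ℂ) (F : MvPolynomial σ ℂ) {k : ℝ}
    (h : ∀ μ ∈ F.support, ‖w μ‖ ≤ k) : l1 (diag w F) ≤ k * l1 F := by
  refine l1_map_le _ F fun μ hμ c => ?_
  rw [diag_monomial, l1_monomial, norm_mul]
  gcongr
  exact h μ hμ

end PolynomialNorm

/-! ### The linear step and the resonant projection on polynomials. -/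

section Polynomials

variable {A : Type}

/-- Polynomials in the variables `z_j`. -/
abbrev Poly (A : Type) : Type := MvPolynomial (A × ℤˣ) ℂ

/-- The partial derivatives of a polynomial. -/
abbrev pd (j : A × ℤˣ) : Derivation ℂ (Poly A) (Poly A) := MvPolynomial.pderiv j

/-- The linear form `Ω(μ) = ∑ δ_j ω_j μ_j` on exponents. -/
def freq (ω : A → ℝ) : (A × ℤˣ →₀ ℕ) →+ ℝ :=
  Finsupp.liftAddHom fun j => (AddMonoidHom.mulLeft (((j.2 : ℤ) : ℝ) * ω j.1)).comp
    (Nat.castAddMonoidHom ℝ)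

@[simp]
theorem freq_single (ω : A → ℝ) (j : A × ℤˣ) (n : ℕ) :
    freq ω (Finsupp.single j n) = ((j.2 : ℤ) : ℝ) * ω j.1 * n := by
  simp [freq]

/-- An exponent is resonant if the monomial depends only on the actions. -/
def Resonant (μ : A × ℤˣ →₀ ℕ) : Prop := ∀ a, μ (a, 1) = μ (a, -1)

/-- The eigenvalue of the linear step on the monomial with exponent `μ`. -/
def eigen (ω : A → ℝ) (h : ℝ) (μ : A × ℤˣ →₀ ℕ) : ℂ :=
  Complex.exp (-(Complex.I * ((h * freq ω μ : ℝ) : ℂ)))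

theorem eigen_add (ω : A → ℝ) (h : ℝ) (μ ν : A × ℤˣ →₀ ℕ) :
    eigen ω h (μ + ν) = eigen ω h μ * eigen ω h ν := by
  rw [eigen, eigen, eigen, ← Complex.exp_add, map_add]
  congr 1
  push_cast
  ring

@[simp]
theorem norm_eigen (ω : A → ℝ) (h : ℝ) (μ : A × ℤˣ →₀ ℕ) : ‖eigen ω h μ‖ = 1 := by
  rw [eigen, mul_comm, ← neg_mul, ← Complex.ofReal_neg, Complex.norm_exp_ofReal_mul_I]

theorem eigen_single_mul_bar (ω : A → ℝ) (h : ℝ) (j : A × ℤˣ) :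
    eigen ω h (Finsupp.single j 1 + Finsupp.single (bar j) 1) = 1 := by
  simp [eigen, bar]

/-- The composition with the linear step, on polynomials. -/
def rotOp (ω : A → ℝ) (h : ℝ) : Poly A →ₗ[ℂ] Poly A := diag (eigen ω h)

open Classical in
/-- The projection to the resonant monomials. -/
def resOp : Poly A →ₗ[ℂ] Poly A := diag fun μ => if Resonant μ then 1 else 0

open Classical in
/-- The inverse of `1 - rotOp` on the nonresonant monomials, extended by zero. -/
def divOp (ω : A → ℝ) (h : ℝ) : Poly A →ₗ[ℂ] Poly A :=
  diag fun μ => if Resonant μ then 0 else (1 - eigen ω h μ)⁻¹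

/-- Solves the homological equation at a single order; the three operators are diagonal on
monomials, so it is a scalar identity for each exponent. -/
theorem divOp_sub_rotOp (ω : A → ℝ) (h : ℝ) (hne : ∀ μ, ¬ Resonant μ → eigen ω h μ ≠ 1)
    (G : Poly A) : divOp ω h G - rotOp ω h (divOp ω h G) + resOp G = G := by
  ext μ
  simp only [divOp, rotOp, resOp, MvPolynomial.coeff_add, MvPolynomial.coeff_sub, coeff_diag]
  by_cases hμ : Resonant μ
  · simp [hμ]
  · have := sub_ne_zero.mpr (hne μ hμ).symm
    simp only [if_neg hμ]
    field_simp
    ring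

theorem norm_symp (j : A × ℤˣ) : ‖symp j‖ = 1 := by
  rcases Int.units_eq_one_or j.2 with h | h <;> simp [symp, h]

/-- The action `ξ_a η_a` as a polynomial. -/
def actionPoly (a : A) : Poly A := MvPolynomial.X (a, 1) * MvPolynomial.X (a, -1)

theorem actionPoly_eq_monomial (a : A) : actionPoly a
    = MvPolynomial.monomial (Finsupp.single (a, 1) 1 + Finsupp.single (a, -1) 1) 1 := by
  rw [actionPoly, MvPolynomial.X, MvPolynomial.X, MvPolynomial.monomial_mul, one_mul]

theorem rotOp_actionPoly (ω : A → ℝ) (h : ℝ) (a : A) :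
    rotOp ω h (actionPoly a) = actionPoly a := by
  have := eigen_single_mul_bar ω h (a, 1)
  rw [bar] at this
  rw [actionPoly_eq_monomial, rotOp, diag_monomial, this, mul_one]

theorem actionPoly_mem_lowDeg (a : A) : actionPoly a ∈ lowDeg (A × ℤˣ) 2 := by
  rw [actionPoly_eq_monomial, lowDeg, MvPolynomial.monomial_mem_restrictSupport]
  left
  simp

theorem actionPoly_mem_upDeg (a : A) : actionPoly a ∈ upDeg (A × ℤˣ) 2 := by
  rw [actionPoly_eq_monomial, upDeg, MvPolynomial.monomial_mem_restrictSupport]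
  left
  simp

theorem l1_actionPoly (a : A) : l1 (actionPoly a) = 1 := by
  rw [actionPoly_eq_monomial, l1_monomial, norm_one]

variable [Fintype A]

theorem bracket_mem_lowDeg {m n : ℕ} {F G : Poly A} (hF : F ∈ lowDeg _ (m + 1))
    (hG : G ∈ lowDeg _ (n + 1)) : bracket pd F G ∈ lowDeg (A × ℤˣ) (m + n) := by
  rw [bracket_apply]
  exact Submodule.sum_mem _ fun j _ => Submodule.smul_mem _ _
    (mul_mem_lowDeg (pderiv_mem_lowDeg j hF) (pderiv_mem_lowDeg _ hG))

theorem bracket_mem_upDeg {m n : ℕ} {F G : Poly A} (hF : F ∈ upDeg _ m)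
    (hG : G ∈ upDeg _ n) : bracket pd F G ∈ upDeg (A × ℤˣ) (m + n) := by
  rw [bracket_apply]
  exact Submodule.sum_mem _ fun j _ => Submodule.smul_mem _ _
    (mul_mem_upDeg (pderiv_mem_upDeg j hF) (pderiv_mem_upDeg _ hG))

theorem l1_bracket_le {m n : ℕ} {F G : Poly A} (hF : F ∈ upDeg _ m) (hG : G ∈ upDeg _ n) :
    l1 (bracket pd F G) ≤ Fintype.card (A × ℤˣ) * ((m * l1 F) * (n * l1 G)) := by
  rw [bracket_apply]
  refine (l1_sum_le _ _).trans ?_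
  rw [← nsmul_eq_mul]
  refine Finset.sum_le_card_nsmul _ _ _ fun j _ => ?_
  rw [l1_smul, norm_symp, one_mul]
  refine (l1_mul_le _ _).trans ?_
  exact mul_le_mul (l1_pderiv_le j hF) (l1_pderiv_le _ hG) (l1_nonneg _)
    (mul_nonneg (Nat.cast_nonneg _) (l1_nonneg _))

/-- The rotation is symplectic: each term of the bracket removes one variable `j` and one variable
`bar j`, whose eigenvalues have product `1`, so the eigenvalue of the result is still the product of
the two given ones. -/
theorem rotOp_bracket (ω : A → ℝ) (h : ℝ) (F G : Poly A) :
    rotOp ω h (bracket pd F G) = bracket pd (rotOp ω h F) (rotOp ω h G) := by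
  induction F using MvPolynomial.induction_on' with
  | add F F' hF hF' => simp only [map_add, LinearMap.add_apply, hF, hF']
  | monomial μ c =>
    induction G using MvPolynomial.induction_on' with
    | add G G' hG hG' => simp only [map_add, hG, hG']
    | monomial ν d =>
      simp only [rotOp, diag_monomial, bracket_apply, map_sum, map_smul]
      refine Finset.sum_congr rfl fun j _ => ?_
      simp only [MvPolynomial.pderiv_monomial, MvPolynomial.monomial_mul, diag_monomial]
      congr 2
      by_cases h1 : μ j = 0
      · simp [h1]
      by_cases h2 : ν (bar j) = 0
      · simp [h2]
      have key : eigen ω h (μ - Finsupp.single j 1 + (ν - Finsupp.single (bar j) 1))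
          = eigen ω h μ * eigen ω h ν := by
        rw [← eigen_add, ← mul_one (eigen ω h (_ + (_ - _))), ← eigen_single_mul_bar ω h j,
          ← eigen_add]
        congr 1
        rw [add_add_add_comm, tsub_add_cancel_of_le, tsub_add_cancel_of_le]
        · exact Finsupp.single_le_iff.mpr (Nat.one_le_iff_ne_zero.mpr h2)
        · exact Finsupp.single_le_iff.mpr (Nat.one_le_iff_ne_zero.mpr h1)
      rw [key]
      ring

/-- The bracket with `I_a` multiplies a monomial, up to a factor of modulus one, by the difference
of its exponents at `(a, 1)` and `(a, -1)`; that difference vanishes for resonant monomials. -/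
theorem bracket_actionPoly_resOp (a : A) (G : Poly A) :
    bracket pd (actionPoly a) (resOp G) = 0 := by
  classical
  induction G using MvPolynomial.induction_on' with
  | add G G' hG hG' => simp only [map_add, hG, hG', add_zero]
  | monomial ν c =>
    rw [resOp, diag_monomial]
    by_cases hν : Resonant ν
    · rw [bracket_apply, Fintype.sum_prod_type, Finset.sum_eq_single a]
      · rw [show (Finset.univ : Finset ℤˣ) = {1, -1} from rfl, Finset.sum_pair (by decide)]
        simp only [actionPoly, Derivation.leibniz, MvPolynomial.pderiv_X, bar, neg_neg,
          smul_eq_mul]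
        rw [Pi.single_eq_of_ne (by simp), Pi.single_eq_same, Pi.single_eq_same,
          Pi.single_eq_of_ne (by simp)]
        simp only [mul_zero, zero_add, add_zero, mul_one, MvPolynomial.X_mul_pderiv_monomial]
        simp [symp, hν a]
      · intro a' _ ha'
        refine Finset.sum_eq_zero fun δ _ => ?_
        have h1 : pd (a', δ) (actionPoly a) = 0 := by
          rw [actionPoly, Derivation.leibniz, MvPolynomial.pderiv_X, MvPolynomial.pderiv_X,
            Pi.single_eq_of_ne (by simp [ha'.symm]), Pi.single_eq_of_ne (by simp [ha'.symm])]
          simp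
        rw [h1, zero_mul, smul_zero]
      · simp
    · simp [hν]

/-- The order in `X` is tied to the degree: a bracket with `Y_k`, of degree at least `k + 3`, raises
the order by `k + 1` and the lower bound for the degree by `k + 1` as well. -/
theorem evol_mem_lowDeg {Y : ℕ → Poly A} {R : Poly A →ₗ[ℂ] Poly A}
    (hR : ∀ n, ∀ F ∈ lowDeg (A × ℤˣ) n, R F ∈ lowDeg _ n) {n : ℕ} {F : Poly A}
    (hF : F ∈ lowDeg _ (n + 2)) (m : ℕ) (hY : ∀ k < m, Y k ∈ lowDeg _ (k + 3)) :
    evol pd Y R m F ∈ lowDeg _ (n + m + 2) := by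
  induction m using Nat.strong_induction_on with
  | _ m ih =>
    cases m with
    | zero =>
      rw [evol_zero]
      exact hR _ _ hF
    | succ m =>
      rw [evol_succ]
      refine Submodule.smul_mem _ _ (Submodule.sum_mem _ fun p hp => ?_)
      rw [Finset.HasAntidiagonal.mem_antidiagonal] at hp
      refine lowDeg_mono ?_ (bracket_mem_lowDeg (m := n + p.1 + 1) (n := p.2 + 2)
        (ih p.1 (by omega) fun k hk => hY k (by omega)) (hY p.2 (by omega)))
      omega

end Polynomials

end Splitting

end

noncomputable section

namespace Splitting

open PowerSeries Finset.HasAntidiagonal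
open scoped Pointwise

/-! ### Recursive solution of the homological equation and the formal integrals. -/

section NormalForm

variable {A : Type} [Fintype A]

/-- The generator `h Q` of the nonlinear step, as a constant power series. -/
abbrev stepSeries (h : ℝ) (Q : Poly A) : (Poly A)⟦X⟧ := C ((h : ℂ) • Q)

/-- The right hand side of the homological equation at order `m`. -/
def homRhs (ω : A → ℝ) (h : ℝ) (Q : Poly A) (Y Z : ℕ → Poly A) (m : ℕ) : Poly A :=
  coeff m (stepSeries h Q)
    + ∑ p ∈ antidiagonal m, evol pd (fun k => coeff k (stepSeries h Q)) (rotOp ω h) p.1 (Y p.2)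
    - ∑ p ∈ antidiagonal m, evol pd Y LinearMap.id p.1 (Z p.2)

/-- The solution `(Y, Z)` of the homological equation, by recursion on the order. -/
def normalPair (ω : A → ℝ) (h : ℝ) (Q : Poly A) (m : ℕ) : Poly A × Poly A :=
  let G := homRhs ω h Q (fun k => if _ : k < m then (normalPair ω h Q k).1 else 0)
    (fun k => if _ : k < m then (normalPair ω h Q k).2 else 0) m
  (divOp ω h G, resOp G)

variable (ω : A → ℝ) (h : ℝ) (Q : Poly A)

/-- The generator of the normalizing transformation. -/
def normY (m : ℕ) : Poly A := (normalPair ω h Q m).1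

/-- The normal form. -/
def normZ (m : ℕ) : Poly A := (normalPair ω h Q m).2

/-- The truncated right hand side at order `m`, in which only orders below `m` enter. -/
def normG (m : ℕ) : Poly A :=
  homRhs ω h Q (fun k => if k < m then normY ω h Q k else 0)
    (fun k => if k < m then normZ ω h Q k else 0) m

theorem normY_eq (m : ℕ) : normY ω h Q m = divOp ω h (normG ω h Q m) := by
  rw [normY, normalPair]
  rfl

theorem normZ_eq (m : ℕ) : normZ ω h Q m = resOp (normG ω h Q m) := by
  rw [normZ, normalPair]
  rfl

/-- The formal integral that starts at the action `I_a`. -/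
def normJ (a : A) (m : ℕ) : Poly A := evol pd (normY ω h Q) LinearMap.id m (actionPoly a)

variable {ω h Q}

/-- Isolates the one term in which the unknown of order `m` occurs; the truncated summand `g` has a
zero in its place. -/
theorem sum_antidiagonal_truncate {M : Type*} [AddCommGroup M] (m : ℕ) (f g : ℕ → ℕ → M)
    (hfg : ∀ i j, i + j = m → j < m → f i j = g i j) (hg : g 0 m = 0) :
    ∑ p ∈ antidiagonal m, f p.1 p.2 = f 0 m + ∑ p ∈ antidiagonal m, g p.1 p.2 := by
  have hm : (0, m) ∈ antidiagonal m := by simp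
  rw [← Finset.add_sum_erase _ (fun p : ℕ × ℕ => f p.1 p.2) hm,
    ← Finset.add_sum_erase _ (fun p : ℕ × ℕ => g p.1 p.2) hm]
  simp only [hg, zero_add]
  congr 1
  refine Finset.sum_congr rfl fun p hp => ?_
  rw [Finset.mem_erase, Finset.HasAntidiagonal.mem_antidiagonal] at hp
  refine hfg _ _ hp.2 (lt_of_le_of_ne (by omega) fun h2 => hp.1 (Prod.ext ?_ h2))
  simp only
  omega

/-- Once the unknowns of order `m` are separated from the lower orders on both sides, what is left
at order `m` is `Y_m - R Y_m + Z_m = G_m`. -/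
theorem homological_equation (hne : ∀ μ, ¬ Resonant μ → eigen ω h μ ≠ 1) :
    evolve pd (stepSeries h Q) (rotOp ω h) (PowerSeries.mk (normY ω h Q)) + stepSeries h Q
      - PowerSeries.mk (normY ω h Q)
      = evolve pd (PowerSeries.mk (normY ω h Q)) LinearMap.id (PowerSeries.mk (normZ ω h Q)) := by
  ext1 m
  simp only [map_add, map_sub, coeff_evolve, coeff_mk]
  have key := divOp_sub_rotOp ω h hne (normG ω h Q m)
  rw [← normY_eq, ← normZ_eq] at key
  rw [sum_antidiagonal_truncate m
      (fun i j => evol pd (fun k => coeff k (stepSeries h Q)) (rotOp ω h) i (normY ω h Q j))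
      (fun i j => evol pd (fun k => coeff k (stepSeries h Q)) (rotOp ω h) i
        (if j < m then normY ω h Q j else 0))
      (fun i j _ hj => by simp [hj]) (by simp),
    sum_antidiagonal_truncate m
      (fun i j => evol pd (normY ω h Q) LinearMap.id i (normZ ω h Q j))
      (fun i j => evol pd (fun k => if k < m then normY ω h Q k else 0) LinearMap.id i
        (if j < m then normZ ω h Q j else 0))
      (fun i j hij hj => by
        simp only [hj, if_true]
        rw [evol_congr _ i fun k hk => (if_pos (show k < m by omega)).symm]) (by simp)]
  simp only [evol_zero, LinearMap.id_apply]
  rw [normG, homRhs] at key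
  linear_combination -key

/-- The formal integrals are invariant under the formal splitting step. -/
theorem sum_evol_normJ (hne : ∀ μ, ¬ Resonant μ → eigen ω h μ ≠ 1) (a : A) (m : ℕ) :
    ∑ p ∈ antidiagonal m, evol pd (fun k => coeff k (stepSeries h Q)) (rotOp ω h) p.1
      (normJ ω h Q a p.2) = normJ ω h Q a m := by
  have hIZ : psBracket pd (C (actionPoly a)) (PowerSeries.mk (normZ ω h Q)) = 0 := by
    ext1 m
    rw [coeff_psBracket, map_zero]
    refine Finset.sum_eq_zero fun p _ => ?_
    rw [coeff_C, coeff_mk, normZ_eq]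
    split_ifs
    · exact bracket_actionPoly_resOp a _
    · rw [map_zero, LinearMap.zero_apply]
  have := congrArg (coeff m) (evolve_evolve_eq pderiv_comm (rotOp ω h) (rotOp_bracket ω h)
    (homological_equation hne) (rotOp_actionPoly ω h a) hIZ)
  rw [coeff_evolve] at this
  simpa only [normJ, coeff_evolve_C, coeff_mk] using this

theorem coeff_stepSeries_mem_lowDeg {A : Type} {h : ℝ} {Q : Poly A} (hQ : Q ∈ lowDeg _ 3) (k : ℕ) :
    coeff k (stepSeries h Q) ∈ lowDeg (A × ℤˣ) (k + 3) := by
  rw [stepSeries, coeff_C]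
  split_ifs with hk
  · rw [hk]
    exact Submodule.smul_mem _ _ hQ
  · exact Submodule.zero_mem _

theorem normY_normZ_mem_lowDeg (hQ : Q ∈ lowDeg _ 3) (m : ℕ) :
    normY ω h Q m ∈ lowDeg (A × ℤˣ) (m + 3) ∧ normZ ω h Q m ∈ lowDeg (A × ℤˣ) (m + 3) := by
  induction m using Nat.strong_induction_on with
  | _ m ih =>
    have hY : ∀ k, (if k < m then normY ω h Q k else 0) ∈ lowDeg (A × ℤˣ) (k + 3) := by
      intro k
      split_ifs with hk
      · exact (ih k hk).1
      · exact Submodule.zero_mem _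
    have hZ : ∀ k, (if k < m then normZ ω h Q k else 0) ∈ lowDeg (A × ℤˣ) (k + 3) := by
      intro k
      split_ifs with hk
      · exact (ih k hk).2
      · exact Submodule.zero_mem _
    have hG : normG ω h Q m ∈ lowDeg (A × ℤˣ) (m + 3) := by
      refine Submodule.sub_mem _ (Submodule.add_mem _ (coeff_stepSeries_mem_lowDeg hQ m)
        (Submodule.sum_mem _ fun p hp => ?_)) (Submodule.sum_mem _ fun p hp => ?_)
      all_goals
        rw [Finset.HasAntidiagonal.mem_antidiagonal] at hp
      · refine lowDeg_mono (by omega) (evol_mem_lowDeg (n := p.2 + 1)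
          (fun n F hF => diag_mem_restrictSupport _ hF) (hY p.2) p.1
          fun k _ => coeff_stepSeries_mem_lowDeg hQ k)
      · refine lowDeg_mono (by omega) (evol_mem_lowDeg (n := p.2 + 1)
          (fun n F hF => hF) (hZ p.2) p.1 fun k _ => hY k)
    rw [normY_eq, normZ_eq]
    exact ⟨diag_mem_restrictSupport _ hG, diag_mem_restrictSupport _ hG⟩

theorem normJ_mem_lowDeg (hQ : Q ∈ lowDeg _ 3) (a : A) (m : ℕ) :
    normJ ω h Q a m ∈ lowDeg (A × ℤˣ) (m + 2) := by
  have := evol_mem_lowDeg (n := 0) (R := LinearMap.id) (fun n F hF => hF)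
    (actionPoly_mem_lowDeg a) m fun k _ => (normY_normZ_mem_lowDeg (ω := ω) (h := h) hQ k).1
  simpa [normJ] using this

theorem normJ_zero (a : A) : normJ ω h Q a 0 = actionPoly a := by
  simp [normJ, evol_zero]

end NormalForm

/-! ### Bounds by powers of `Λ`, uniform over all models. -/

section Tame

/-- Polynomial bounds in `Λ`: the coefficients of `F` are summable to at most `Λ ^ p` and the
degree of `F` is at most `p`. -/
def Bd {σ : Type*} (Λ : ℝ) (p : ℕ) (F : MvPolynomial σ ℂ) : Prop := l1 F ≤ Λ ^ p ∧ F ∈ upDeg σ p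

theorem Bd.mono {σ : Type*} {Λ : ℝ} (hΛ : 2 ≤ Λ) {p q : ℕ} (hpq : p ≤ q) {F : MvPolynomial σ ℂ}
    (hF : Bd Λ p F) : Bd Λ q F :=
  ⟨hF.1.trans (pow_le_pow_right₀ (by linarith) hpq), upDeg_mono hpq hF.2⟩

theorem natCast_le_pow {Λ : ℝ} (hΛ : 2 ≤ Λ) (p : ℕ) : (p : ℝ) ≤ Λ ^ p := by
  have h1 : (p : ℝ) ≤ 2 ^ p := by exact_mod_cast Nat.lt_two_pow_self.le
  exact h1.trans (pow_le_pow_left₀ (by norm_num) hΛ p)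

/-- The data of a polynomial splitting step, with all quantities bounded by powers of `Λ`. -/
structure Model (c : ℕ) (b : ℕ → ℕ) where
  A : Type
  [fin : Fintype A]
  [dec : DecidableEq A]
  ω : A → ℝ
  h : ℝ
  Λ : ℝ
  Q : Poly A
  two_le : 2 ≤ Λ
  card_le : (Fintype.card (A × ℤˣ) : ℝ) ≤ Λ ^ c
  h_pos : 0 < h
  h_le : h ≤ Λ ^ c
  Q_bd : Bd Λ c Q
  Q_low : Q ∈ lowDeg (A × ℤˣ) 3
  nonres : ∀ μ : A × ℤˣ →₀ ℕ, ¬ Resonant μ → h ≤ Λ ^ b μ.degree * ‖1 - eigen ω h μ‖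

attribute [instance] Model.fin Model.dec

variable {c : ℕ} {b : ℕ → ℕ} {ι : Type*}

/-- A family of polynomials is tame if it is bounded uniformly by a power of `Λ`. -/
def Tame (s : ι → Model c b) (F : ∀ i, Poly (s i).A) : Prop := ∃ p, ∀ i, Bd (s i).Λ p (F i)

variable {s : ι → Model c b}

theorem Tame.zero : Tame s fun _ => 0 :=
  ⟨0, fun i => ⟨by simp, Submodule.zero_mem _⟩⟩

theorem Tame.add {F G : ∀ i, Poly (s i).A} (hF : Tame s F) (hG : Tame s G) :
    Tame s fun i => F i + G i := by
  obtain ⟨p, hp⟩ := hF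
  obtain ⟨q, hq⟩ := hG
  refine ⟨max p q + 1, fun i => ⟨?_, ?_⟩⟩
  · have hΛ := (s i).two_le
    have h1 := ((hp i).mono hΛ (le_max_left p q)).1
    have h2 := ((hq i).mono hΛ (le_max_right p q)).1
    have h3 : 0 ≤ (s i).Λ ^ max p q := by positivity
    rw [pow_succ]
    nlinarith [l1_add_le (F i) (G i)]
  · exact Submodule.add_mem _ (upDeg_mono (by omega) (hp i).2) (upDeg_mono (by omega) (hq i).2)

theorem Tame.smul {F : ∀ i, Poly (s i).A} (hF : Tame s F) {k : ι → ℂ} {q : ℕ}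
    (hk : ∀ i, ‖k i‖ ≤ (s i).Λ ^ q) : Tame s fun i => k i • F i := by
  obtain ⟨p, hp⟩ := hF
  refine ⟨q + p, fun i => ⟨?_, Submodule.smul_mem _ _ (upDeg_mono (by omega) (hp i).2)⟩⟩
  have hΛ := (s i).two_le
  rw [l1_smul, pow_add]
  exact mul_le_mul (hk i) (hp i).1 (l1_nonneg _) (by positivity)

theorem Tame.sub {F G : ∀ i, Poly (s i).A} (hF : Tame s F) (hG : Tame s G) :
    Tame s fun i => F i - G i := by
  have := hF.add (hG.smul (k := fun _ => -1) (q := 0) (by simp))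
  simpa [sub_eq_add_neg] using this

theorem Tame.sum {κ : Type*} (t : Finset κ) {F : κ → ∀ i, Poly (s i).A}
    (hF : ∀ k ∈ t, Tame s (F k)) : Tame s fun i => ∑ k ∈ t, F k i := by
  classical
  induction t using Finset.induction_on with
  | empty => simpa using Tame.zero
  | insert k t hk ih =>
    simp only [Finset.sum_insert hk]
    exact (hF k (by simp)).add (ih fun k' hk' => hF k' (by simp [hk']))

theorem Tame.bracket {F G : ∀ i, Poly (s i).A} (hF : Tame s F) (hG : Tame s G) :
    Tame s fun i => bracket pd (F i) (G i) := by
  obtain ⟨p, hp⟩ := hF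
  obtain ⟨q, hq⟩ := hG
  refine ⟨c + ((p + p) + (q + q)), fun i =>
    ⟨?_, upDeg_mono (by omega) (bracket_mem_upDeg (hp i).2 (hq i).2)⟩⟩
  have hΛ := (s i).two_le
  refine (l1_bracket_le (hp i).2 (hq i).2).trans ?_
  rw [pow_add, pow_add _ (p + p), pow_add _ p, pow_add _ q]
  have h1 := natCast_le_pow hΛ p
  have h2 := natCast_le_pow hΛ q
  have h3 := l1_nonneg (F i)
  have h4 := l1_nonneg (G i)
  have h5 := (hp i).1
  have h6 := (hq i).1
  have h7 := (s i).card_le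
  gcongr

theorem Tame.diag {F : ∀ i, Poly (s i).A} (hF : Tame s F)
    {w : ∀ i, ((s i).A × ℤˣ →₀ ℕ) → ℂ} {k : ℕ → ℕ}
    (hw : ∀ i μ, ‖w i μ‖ ≤ (s i).Λ ^ k μ.degree) : Tame s fun i => diag (w i) (F i) := by
  obtain ⟨p, hp⟩ := hF
  -- Only degrees up to `p` occur in `F i`, so this sum dominates every exponent `k n` that matters.
  set q := ∑ n ∈ Finset.range (p + 1), k n
  refine ⟨q + p, fun i => ⟨?_, ?_⟩⟩
  · have hΛ := (s i).two_le
    rw [pow_add]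
    refine (l1_diag_le (w i) (F i) (k := (s i).Λ ^ q) fun μ hμ => ?_).trans ?_
    · refine (hw i μ).trans (pow_le_pow_right₀ (by linarith) ?_)
      have hμ' : μ.degree ≤ p := mem_of_mem_support (hp i).2 hμ
      exact Finset.single_le_sum (f := k) (fun _ _ => Nat.zero_le _)
        (Finset.mem_range.mpr (by omega))
    · gcongr
      exact (hp i).1
  · exact diag_mem_restrictSupport _ (upDeg_mono (by omega) (hp i).2)

theorem Tame.rotOp {F : ∀ i, Poly (s i).A} (hF : Tame s F) :
    Tame s fun i => rotOp (s i).ω (s i).h (F i) :=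
  hF.diag (k := fun _ => 0) fun i μ => by simp

theorem Tame.resOp {F : ∀ i, Poly (s i).A} (hF : Tame s F) : Tame s fun i => resOp (F i) := by
  classical
  refine hF.diag (k := fun _ => 0) fun i μ => ?_
  split_ifs <;> simp

/-- The divisor is only bounded below by `h` times a power of `Λ⁻¹`, so tameness is required of `h⁻¹
F`; the weight `h / (1 - eigenvalue)` is then bounded by a power of `Λ`. -/
theorem Tame.divOp {F : ∀ i, Poly (s i).A} (hF : Tame s fun i => ((s i).h : ℂ)⁻¹ • F i) :
    Tame s fun i => divOp (s i).ω (s i).h (F i) := by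
  classical
  have h1 := hF.diag (k := b) (w := fun i μ =>
    if Resonant μ then 0 else ((s i).h : ℂ) * (1 - eigen (s i).ω (s i).h μ)⁻¹) ?_
  · convert h1 using 2 with i
    have hne : ((s i).h : ℂ) ≠ 0 := by exact_mod_cast (s i).h_pos.ne'
    ext μ
    simp only [Splitting.divOp, coeff_diag, MvPolynomial.coeff_smul, smul_eq_mul]
    split_ifs
    · simp
    · field_simp
  · intro i μ
    have hΛ := (s i).two_le
    split_ifs with hμ
    · rw [norm_zero]
      positivity
    · have h2 := (s i).nonres μ hμ
      have hpos : 0 < ‖1 - eigen (s i).ω (s i).h μ‖ := by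
        by_contra hcon
        have h3 : ‖1 - eigen (s i).ω (s i).h μ‖ = 0 := le_antisymm (not_lt.mp hcon) (norm_nonneg _)
        rw [h3, mul_zero] at h2
        exact absurd (s i).h_pos (not_lt.mpr h2)
      rw [norm_mul, norm_inv, Complex.norm_real, Real.norm_eq_abs, abs_of_pos (s i).h_pos,
        ← div_eq_mul_inv, div_le_iff₀ hpos]
      exact h2

theorem Tame.evol {Y : ℕ → ∀ i, Poly (s i).A} {R : ∀ i, Poly (s i).A →ₗ[ℂ] Poly (s i).A}
    (hR : ∀ F, Tame s F → Tame s fun i => R i (F i)) {F : ∀ i, Poly (s i).A} (hF : Tame s F)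
    (m : ℕ) (hY : ∀ k < m, Tame s (Y k)) :
    Tame s fun i => evol pd (fun k => Y k i) (R i) m (F i) := by
  induction m using Nat.strong_induction_on with
  | _ m ih =>
    cases m with
    | zero =>
      simp only [evol_zero]
      exact hR F hF
    | succ m =>
      simp only [evol_succ]
      refine (Tame.sum _ fun p hp => ?_).smul (q := 0) fun i => ?_
      · rw [Finset.HasAntidiagonal.mem_antidiagonal] at hp
        exact (ih p.1 (by omega) fun k hk => hY k (by omega)).bracket (hY p.2 (by omega))
      · rw [norm_inv, Complex.norm_natCast, pow_zero]
        exact inv_le_one_of_one_le₀ (by exact_mod_cast Nat.le_add_left 1 m)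

theorem Tame.Q : Tame s fun i => (s i).Q := ⟨c, fun i => (s i).Q_bd⟩

theorem norm_h_le (i : ι) : ‖((s i).h : ℂ)‖ ≤ (s i).Λ ^ c := by
  rw [Complex.norm_real, Real.norm_eq_abs, abs_of_pos (s i).h_pos]
  exact (s i).h_le

theorem inv_smul_stepSeries (i : ι) (k : ℕ) :
    ((s i).h : ℂ)⁻¹ • coeff k (stepSeries (s i).h (s i).Q) = coeff k (C (s i).Q) := by
  have hne : ((s i).h : ℂ) ≠ 0 := by exact_mod_cast (s i).h_pos.ne'
  rw [stepSeries, coeff_C, coeff_C]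
  split_ifs
  · rw [smul_smul, inv_mul_cancel₀ hne, one_smul]
  · simp

theorem Tame.coeff_C_Q (k : ℕ) : Tame s fun i => coeff k (C (s i).Q) := by
  by_cases hk : k = 0
  · simpa [coeff_C, hk] using Tame.Q
  · simpa [coeff_C, hk] using Tame.zero

theorem Tame.stepSeries (k : ℕ) :
    Tame s fun i => coeff k (stepSeries (s i).h (s i).Q) := by
  have := (Tame.coeff_C_Q (s := s) k).smul (norm_h_le (s := s))
  convert this using 2 with i
  have hne : ((s i).h : ℂ) ≠ 0 := by exact_mod_cast (s i).h_pos.ne'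
  rw [← inv_smul_stepSeries, smul_smul, mul_inv_cancel₀ hne, one_smul]

theorem inv_smul_evol_succ (i : ι) (R : Poly (s i).A →ₗ[ℂ] Poly (s i).A) (l : ℕ)
    (F : Poly (s i).A) :
    ((s i).h : ℂ)⁻¹ • evol pd (fun k => coeff k (stepSeries (s i).h (s i).Q)) R (l + 1) F
      = ((l + 1 : ℕ) : ℂ)⁻¹ • ∑ p ∈ antidiagonal l,
        bracket pd (evol pd (fun k => coeff k (stepSeries (s i).h (s i).Q)) R p.1 F)
          (coeff p.2 (C (s i).Q)) := by
  rw [evol_succ, smul_comm, Finset.smul_sum]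
  congr 1
  refine Finset.sum_congr rfl fun p _ => ?_
  rw [← map_smul, inv_smul_stepSeries]

/-- From order one on, the evolution generated by `h Q` contains at least one bracket with `h Q`,
hence a factor `h` that can be divided out. -/
theorem Tame.inv_smul_evol_succ {F : ∀ i, Poly (s i).A} (hF : Tame s F) (l : ℕ) :
    Tame s fun i => ((s i).h : ℂ)⁻¹ • Splitting.evol pd
      (fun k => coeff k (Splitting.stepSeries (s i).h (s i).Q))
      (Splitting.rotOp (s i).ω (s i).h) (l + 1) (F i) := by
  simp only [Splitting.inv_smul_evol_succ]
  refine (Tame.sum _ fun p _ => ?_).smul (q := 0) fun i => ?_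
  · exact (Tame.evol (Y := fun k i => coeff k (Splitting.stepSeries (s i).h (s i).Q))
      (fun F hF => hF.rotOp) hF p.1 fun k _ => Tame.stepSeries k).bracket (Tame.coeff_C_Q p.2)
  · rw [norm_inv, Complex.norm_natCast, pow_zero]
    exact inv_le_one_of_one_le₀ (by exact_mod_cast Nat.le_add_left 1 l)

/-- The induction carries two different scales: `Y` is bounded, while `Z` is of size `h`. Together
they make the right hand side of the next order of size `h`, as the division requires. -/
theorem Tame.normY_normZ (m : ℕ) :
    Tame s (fun i => normY (s i).ω (s i).h (s i).Q m) ∧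
      Tame s fun i => ((s i).h : ℂ)⁻¹ • normZ (s i).ω (s i).h (s i).Q m := by
  induction m using Nat.strong_induction_on with
  | _ m ih =>
    have hY : ∀ k, Tame s fun i => if k < m then normY (s i).ω (s i).h (s i).Q k else 0 := by
      intro k
      by_cases hk : k < m
      · simpa only [hk, if_true] using (ih k hk).1
      · simpa only [hk, if_false] using Tame.zero
    have hZ : ∀ k, Tame s fun i =>
        ((s i).h : ℂ)⁻¹ • if k < m then normZ (s i).ω (s i).h (s i).Q k else 0 := by
      intro k
      by_cases hk : k < m
      · simpa only [hk, if_true] using (ih k hk).2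
      · simpa only [hk, if_false, smul_zero] using Tame.zero
    have hG : Tame s fun i => ((s i).h : ℂ)⁻¹ • normG (s i).ω (s i).h (s i).Q m := by
      simp only [normG, homRhs, smul_sub, smul_add, Finset.smul_sum, inv_smul_stepSeries]
      refine ((Tame.coeff_C_Q m).add (Tame.sum _ fun p hp => ?_)).sub (Tame.sum _ fun p hp => ?_)
      all_goals rw [Finset.HasAntidiagonal.mem_antidiagonal] at hp
      · obtain ⟨p1, p2⟩ := p
        cases p1 with
        | zero =>
          -- The term with `p1 = 0` is the rotation of the unknown of order `m`, which carries no
          -- factor `h`. In the truncated right hand side it is replaced by zero.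
          have : ¬ p2 < m := by simp at hp; omega
          simpa only [this, if_false, map_zero, smul_zero] using Tame.zero
        | succ l =>
          exact Tame.inv_smul_evol_succ (hY p2) l
      · simp only [← map_smul]
        exact Tame.evol (Y := fun k i => if k < m then normY (s i).ω (s i).h (s i).Q k else 0)
          (fun F hF => hF) (hZ p.2) p.1 fun k _ => hY k
    simp only [normY_eq, normZ_eq, ← map_smul]
    exact ⟨hG.divOp, hG.resOp⟩

theorem Tame.normJ (a : ∀ i, (s i).A) (m : ℕ) :
    Tame s fun i => normJ (s i).ω (s i).h (s i).Q (a i) m := by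
  refine Tame.evol (Y := fun k i => normY (s i).ω (s i).h (s i).Q k) (fun F hF => hF)
    ⟨2, fun i => ⟨?_, actionPoly_mem_upDeg _⟩⟩ m fun k _ => (Tame.normY_normZ k).1
  rw [l1_actionPoly]
  exact one_le_pow₀ (by linarith [(s i).two_le])

end Tame

end Splitting

end

noncomputable section

namespace Splitting

open PowerSeries Finset.HasAntidiagonal

/-! ### Evaluation of polynomials along trajectories and a perturbed Taylor formula. -/

section Evaluation

theorem hasDerivWithinAt_eval {σ : Type*} [Fintype σ] (F : MvPolynomial σ ℂ) {γ : ℝ → σ → ℂ}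
    {v : σ → ℂ} {s : Set ℝ} {t : ℝ} (hγ : ∀ j, HasDerivWithinAt (fun t => γ t j) (v j) s t) :
    HasDerivWithinAt (fun t => MvPolynomial.eval (γ t) F)
      (∑ j, MvPolynomial.eval (γ t) (MvPolynomial.pderiv j F) * v j) s t := by
  classical
  induction F using MvPolynomial.induction_on with
  | C c => simpa using hasDerivWithinAt_const t s c
  | add F G hF hG =>
    simp only [map_add, add_mul, Finset.sum_add_distrib]
    exact hF.add hG
  | mul_X F i hF =>
    simp only [map_mul, MvPolynomial.eval_X]
    refine (hF.mul (hγ i)).congr_deriv (Eq.symm ?_)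
    simp only [Derivation.leibniz, MvPolynomial.pderiv_X, smul_eq_mul, map_add, map_mul,
      MvPolynomial.eval_X, add_mul, Finset.sum_add_distrib, Finset.sum_mul]
    rw [add_comm]
    congr 1
    · exact Finset.sum_congr rfl fun j _ => by ring
    · rw [Finset.sum_eq_single i]
      · simp
      · intro j _ hj
        rw [Pi.single_eq_of_ne hj.symm]
        simp
      · simp

variable {A : Type} [Fintype A]

/-- The linear step `z_j ↦ exp (-i h δ_j ω_j) z_j`. -/
def rotMap (ω : A → ℝ) (h : ℝ) (z : Phase A) : Phase A :=
  WithLp.toLp 2 fun j => eigen ω h (Finsupp.single j 1) * z j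

theorem eigen_eq_prod {A : Type} (ω : A → ℝ) (h : ℝ) (μ : A × ℤˣ →₀ ℕ) :
    eigen ω h μ = μ.prod fun j n => eigen ω h (Finsupp.single j 1) ^ n := by
  classical
  have h0 : eigen ω h 0 = 1 := by simp [eigen]
  induction μ using Finsupp.induction_linear with
  | zero => simp [h0]
  | add μ ν hμ hν =>
    rw [eigen_add, Finsupp.prod_add_index' (by simp) (fun _ _ _ => pow_add _ _ _), hμ, hν]
  | single j n =>
    rw [Finsupp.prod_single_index (by simp)]
    induction n with
    | zero => simp [h0]
    | succ n ih => rw [Finsupp.single_add, eigen_add, ih, pow_succ]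

theorem eval_rotOp (ω : A → ℝ) (h : ℝ) (F : Poly A) (z : Phase A) :
    MvPolynomial.eval z (rotOp ω h F) = MvPolynomial.eval (rotMap ω h z) F := by
  induction F using MvPolynomial.induction_on' with
  | add F G hF hG => simp only [map_add, hF, hG]
  | monomial μ c =>
    rw [rotOp, diag_monomial, MvPolynomial.eval_monomial, MvPolynomial.eval_monomial,
      eigen_eq_prod]
    simp only [rotMap, mul_pow, Finsupp.prod_mul]
    ring

/-- A Taylor formula for a chain of functions each of which is, up to an error, the derivative
of its predecessor. -/
theorem norm_taylor_chain_le {f e : ℕ → ℝ → ℂ} {h H B : ℝ} (M : ℕ) (h0 : 0 ≤ h) (hH : h ≤ H)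
    (hH1 : 1 ≤ H)
    (hf : ∀ q ≤ M, ∀ t ∈ Set.Icc 0 h,
      HasDerivWithinAt (f q) (f (q + 1) t + e q t) (Set.Icc 0 h) t)
    (hfB : ∀ t ∈ Set.Icc 0 h, ‖f (M + 1) t‖ ≤ B)
    (heB : ∀ q ≤ M, ∀ t ∈ Set.Icc 0 h, ‖e q t‖ ≤ B) :
    ‖f 0 h - ∑ q ∈ Finset.range (M + 1), ((h : ℂ) ^ q / (q.factorial : ℂ)) * f q 0‖
      ≤ (M + 2) * H ^ (M + 1) * B := by
  have hpow : ∀ (q : ℕ) (t : ℝ), HasDerivAt (fun t : ℝ => (((h : ℂ) - t) ^ (q + 1) /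
      ((q + 1).factorial : ℂ))) (-(((h : ℂ) - t) ^ q / (q.factorial : ℂ))) t := by
    intro q t
    have h1 : HasDerivAt (fun t : ℝ => (h : ℂ) - t) (-1) t := by
      simpa using (Complex.ofRealCLM.hasDerivAt (x := t)).const_sub (h : ℂ)
    refine ((h1.pow (q + 1)).div_const ((q + 1).factorial : ℂ)).congr_deriv (Eq.symm ?_)
    have h2 : (q.factorial : ℂ) ≠ 0 := Nat.cast_ne_zero.mpr q.factorial_ne_zero
    have h3 : (q : ℂ) + 1 ≠ 0 := Nat.cast_add_one_ne_zero q
    rw [Nat.factorial_succ]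
    push_cast
    field_simp
  -- The derivative telescopes, leaving the last `f (N + 1)` and the errors. The function
  -- differentiated here is `f 0 h` at `t = h` and the Taylor sum at `t = 0`.
  have hder : ∀ N ≤ M, ∀ t ∈ Set.Icc 0 h, HasDerivWithinAt
      (fun t => ∑ q ∈ Finset.range (N + 1), (((h : ℂ) - t) ^ q / (q.factorial : ℂ)) * f q t)
      ((((h : ℂ) - t) ^ N / (N.factorial : ℂ)) * f (N + 1) t
        + ∑ q ∈ Finset.range (N + 1), (((h : ℂ) - t) ^ q / (q.factorial : ℂ)) * e q t)
      (Set.Icc 0 h) t := by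
    intro N hN t ht
    induction N with
    | zero => simpa using hf 0 (Nat.zero_le _) t ht
    | succ N ih =>
      have h1 := (ih (by omega)).add ((hpow N t).hasDerivWithinAt.mul (hf (N + 1) hN t ht))
      simp only [Finset.sum_range_succ _ (N + 1)]
      exact h1.congr_deriv (by ring)
  have hcoef : ∀ q ≤ M, ∀ t ∈ Set.Icc 0 h, ‖(((h : ℂ) - t) ^ q / (q.factorial : ℂ))‖ ≤ H ^ M := by
    intro q hq t ht
    rw [norm_div, norm_pow, ← Complex.ofReal_sub, Complex.norm_real, Real.norm_eq_abs,
      abs_of_nonneg (by linarith [ht.2]), Complex.norm_natCast]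
    calc (h - t) ^ q / (q.factorial : ℝ) ≤ (h - t) ^ q := by
          refine div_le_self (pow_nonneg (by linarith [ht.2]) _) ?_
          exact_mod_cast q.factorial_pos
      _ ≤ H ^ q := pow_le_pow_left₀ (by linarith [ht.2]) (by linarith [ht.1]) _
      _ ≤ H ^ M := pow_le_pow_right₀ hH1 hq
  have hHM : 0 ≤ H ^ M := by positivity
  have hB0 : 0 ≤ B := (norm_nonneg _).trans (hfB 0 ⟨le_rfl, h0⟩)
  have hmv := norm_image_sub_le_of_norm_deriv_le_segment' (C := (M + 2) * H ^ M * B)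
    (hder M le_rfl) (fun t ht => ?_) h ⟨h0, le_rfl⟩
  · have e1 : (∑ q ∈ Finset.range (M + 1), (((h : ℂ) - (h : ℝ)) ^ q / (q.factorial : ℂ)) * f q h)
        = f 0 h := by
      rw [Finset.sum_range_succ']
      simp
    simp only [e1, Complex.ofReal_zero, sub_zero] at hmv
    refine hmv.trans ?_
    rw [pow_succ]
    have : 0 ≤ ((M : ℝ) + 2) * H ^ M * B := by positivity
    nlinarith
  · have ht' : t ∈ Set.Icc 0 h := ⟨ht.1, ht.2.le⟩
    refine (norm_add_le _ _).trans ?_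
    have h1 : ‖(((h : ℂ) - t) ^ M / (M.factorial : ℂ)) * f (M + 1) t‖ ≤ H ^ M * B := by
      rw [norm_mul]
      exact mul_le_mul (hcoef M le_rfl t ht') (hfB t ht') (norm_nonneg _) hHM
    have h2 : ‖∑ q ∈ Finset.range (M + 1), (((h : ℂ) - t) ^ q / (q.factorial : ℂ)) * e q t‖
        ≤ (M + 1) * (H ^ M * B) := by
      refine (norm_sum_le_of_le _ (f := fun q => (((h : ℂ) - t) ^ q / (q.factorial : ℂ)) * e q t)
        (n := fun _ => H ^ M * B) fun q hq => ?_).trans_eq (by simp)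
      have hq' : q ≤ M := by simpa [Nat.lt_succ_iff] using hq
      rw [norm_mul]
      exact mul_le_mul (hcoef q hq' t ht') (heB q hq' t ht') (norm_nonneg _) hHM
    linarith

/-- Along a trajectory of `P`, the derivative of a polynomial is its bracket with `Q`, up to the
error `∑ j, symp j * ∂_j F * (∂_{bar j} P - ∂_{bar j} Q)`. -/
theorem hasDerivWithinAt_eval_hamVF [DecidableEq A] (P : Phase A → ℂ) (F Q : Poly A)
    {γ : ℝ → Phase A} {s : Set ℝ} {t : ℝ} (hγ : HasDerivWithinAt γ (hamVF P (γ t)) s t) :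
    HasDerivWithinAt (fun t => MvPolynomial.eval (γ t) F)
      (MvPolynomial.eval (γ t) (bracket pd F Q)
        + ∑ j, symp j * (MvPolynomial.eval (γ t) (pd j F) *
          (fderiv ℂ P (γ t) (EuclideanSpace.single (bar j) 1)
            - MvPolynomial.eval (γ t) (pd (bar j) Q)))) s t := by
  refine (hasDerivWithinAt_eval F (γ := fun t j => γ t j) (v := fun j => hamVF P (γ t) j)
    (fun j => ?_)).congr_deriv (Eq.symm ?_)
  · exact ((EuclideanSpace.proj j : Phase A →L[ℂ] ℂ).restrictScalars ℝ).hasFDerivAt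
      |>.comp_hasDerivWithinAt t hγ
  · rw [bracket_apply, map_sum, ← Finset.sum_add_distrib]
    refine Finset.sum_congr rfl fun j _ => ?_
    rw [MvPolynomial.smul_eval, map_mul, hamVF, symp]
    ring

end Evaluation

/-! ### The truncated integrals and their drift in one step. -/

section OneStep

variable {c : ℕ} {b : ℕ → ℕ} {ι : Type*} {s : ι → Model c b}

theorem eigen_ne_one (m : Model c b) (μ : m.A × ℤˣ →₀ ℕ) (hμ : ¬ Resonant μ) :
    eigen m.ω m.h μ ≠ 1 := by
  intro h1
  have := m.nonres μ hμ
  rw [h1, sub_self, norm_zero, mul_zero] at this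
  exact absurd m.h_pos (not_lt.mpr this)

/-- The approximate integral of order `M` that starts at the action `I_a`. -/
def approxInt (m : Model c b) (M : ℕ) (a : m.A) : Poly m.A :=
  ∑ k ∈ Finset.range (M + 1), normJ m.ω m.h m.Q a k

/-- The part of order larger than `M` in the formal image of `approxInt`. -/
def remainder (m : Model c b) (M : ℕ) (a : m.A) : Poly m.A :=
  ∑ q ∈ Finset.range (M + 1), ∑ k ∈ Finset.Ico (M + 1 - q) (M + 1),
    evol pd (fun k => coeff k (stepSeries m.h m.Q)) (rotOp m.ω m.h) q (normJ m.ω m.h m.Q a k)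

/-- In the double sum over `q, k ≤ M` the terms with `q + k ≤ M` reproduce `approxInt`, because the
formal integral is invariant order by order; the terms with `q + k > M` form `remainder`. -/
theorem sum_evol_approxInt (m : Model c b) (M : ℕ) (a : m.A) :
    ∑ q ∈ Finset.range (M + 1), evol pd (fun k => coeff k (stepSeries m.h m.Q))
      (rotOp m.ω m.h) q (approxInt m M a) = approxInt m M a + remainder m M a := by
  have h1 : approxInt m M a = ∑ q ∈ Finset.range (M + 1), ∑ k ∈ Finset.range (M + 1 - q),
      evol pd (fun k => coeff k (stepSeries m.h m.Q)) (rotOp m.ω m.h) q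
        (normJ m.ω m.h m.Q a k) := by
    rw [← Finset.sum_range_diag_flip (M + 1) fun q k =>
      evol pd (fun k => coeff k (stepSeries m.h m.Q)) (rotOp m.ω m.h) q
        (normJ m.ω m.h m.Q a k)]
    refine Finset.sum_congr rfl fun k _ => ?_
    rw [← sum_evol_normJ (eigen_ne_one m) a k, Finset.Nat.sum_antidiagonal_eq_sum_range_succ
      fun q k => evol pd (fun k => coeff k (stepSeries m.h m.Q)) (rotOp m.ω m.h) q
        (normJ m.ω m.h m.Q a k)]
  conv_rhs => rw [h1]
  rw [remainder, ← Finset.sum_add_distrib]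
  refine Finset.sum_congr rfl fun q _ => ?_
  rw [Finset.sum_range_add_sum_Ico _ (Nat.sub_le _ _), approxInt, map_sum]

theorem normJ_mem_lowDeg' (m : Model c b) (a : m.A) (k : ℕ) :
    normJ m.ω m.h m.Q a k ∈ lowDeg (m.A × ℤˣ) (k + 2) :=
  normJ_mem_lowDeg m.Q_low a k

theorem approxInt_mem_lowDeg (m : Model c b) (M : ℕ) (a : m.A) :
    approxInt m M a ∈ lowDeg (m.A × ℤˣ) 2 :=
  Submodule.sum_mem _ fun k _ => lowDeg_mono (by omega) (normJ_mem_lowDeg' m a k)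

theorem approxInt_sub_mem_lowDeg (m : Model c b) (M : ℕ) (a : m.A) :
    approxInt m M a - actionPoly a ∈ lowDeg (m.A × ℤˣ) 3 := by
  rw [approxInt, Finset.sum_range_succ', normJ_zero, add_sub_cancel_right]
  exact Submodule.sum_mem _ fun k _ => lowDeg_mono (by omega) (normJ_mem_lowDeg' m a (k + 1))

theorem remainder_mem_lowDeg (m : Model c b) (M : ℕ) (a : m.A) :
    remainder m M a ∈ lowDeg (m.A × ℤˣ) (M + 3) := by
  refine Submodule.sum_mem _ fun q hq => Submodule.sum_mem _ fun k hk => ?_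
  rw [Finset.mem_range] at hq
  rw [Finset.mem_Ico] at hk
  exact lowDeg_mono (by omega) (evol_mem_lowDeg (n := k)
    (fun n F hF => diag_mem_restrictSupport _ hF) (normJ_mem_lowDeg' m a k) q
    fun l _ => coeff_stepSeries_mem_lowDeg m.Q_low l)

theorem Tame.actionPoly (a : ∀ i, (s i).A) : Tame s fun i => actionPoly (a i) := by
  simpa only [normJ_zero] using Tame.normJ a 0

theorem Tame.approxInt (M : ℕ) (a : ∀ i, (s i).A) :
    Tame s fun i => approxInt (s i) M (a i) :=
  Tame.sum _ fun k _ => Tame.normJ a k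

theorem Tame.remainder (M : ℕ) (a : ∀ i, (s i).A) :
    Tame s fun i => remainder (s i) M (a i) :=
  Tame.sum _ fun q _ => Tame.sum _ fun k _ =>
    Tame.evol (Y := fun k i => coeff k (Splitting.stepSeries (s i).h (s i).Q))
      (fun _ hF => hF.rotOp) (Tame.normJ a k) q fun l _ => Tame.stepSeries l

theorem iterate_bracket_smul {A : Type} [Fintype A] (k : ℂ) (Q F : Poly A) (q : ℕ) :
    ((bracket pd).flip (k • Q))^[q] F = k ^ q • ((bracket pd).flip Q)^[q] F := by
  induction q with
  | zero => simp
  | succ q ih =>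
    rw [Function.iterate_succ_apply', Function.iterate_succ_apply', ih]
    simp [smul_smul, pow_succ]

theorem iterate_bracket_mem_lowDeg {A : Type} [Fintype A] {Q F : Poly A}
    (hQ : Q ∈ lowDeg (A × ℤˣ) 3) {n : ℕ} (hF : F ∈ lowDeg (A × ℤˣ) (n + 1)) (q : ℕ) :
    ((bracket pd).flip Q)^[q] F ∈ lowDeg (A × ℤˣ) (n + q + 1) := by
  induction q with
  | zero => exact hF
  | succ q ih =>
    rw [Function.iterate_succ_apply']
    exact lowDeg_mono (by omega) (bracket_mem_lowDeg (n := 2) ih hQ)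

theorem Tame.iterate_bracket {F : ∀ i, Poly (s i).A} (hF : Tame s F) (q : ℕ) :
    Tame s fun i => ((Splitting.bracket pd).flip (s i).Q)^[q] (F i) := by
  induction q with
  | zero => exact hF
  | succ q ih =>
    simp only [Function.iterate_succ_apply']
    exact ih.bracket Tame.Q

theorem Tame.norm_eval_le {F : ∀ i, Poly (s i).A} (hF : Tame s F) {n : ℕ}
    (hn : ∀ i, F i ∈ lowDeg _ n) : ∃ p : ℕ, ∀ i (z : Phase (s i).A) (ρ : ℝ), ‖z‖ ≤ ρ → ρ ≤ 1 →
      ‖MvPolynomial.eval z (F i)‖ ≤ (s i).Λ ^ p * ρ ^ n := by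
  obtain ⟨p, hp⟩ := hF
  refine ⟨p, fun i z ρ hz hρ => ?_⟩
  have hρ0 := (norm_nonneg z).trans hz
  refine (Splitting.norm_eval_le (hn i) (fun j => (PiLp.norm_apply_le z j).trans hz) hρ0
    hρ).trans ?_
  gcongr
  exact (hp i).1

theorem Tame.norm_eval_pderiv_le {F : ∀ i, Poly (s i).A} (hF : Tame s F) {n : ℕ}
    (hn : ∀ i, F i ∈ lowDeg _ (n + 1)) : ∃ p : ℕ, ∀ i (z : Phase (s i).A) (ρ : ℝ) j, ‖z‖ ≤ ρ →
      ρ ≤ 1 → ‖MvPolynomial.eval z (pd j (F i))‖ ≤ (s i).Λ ^ p * ρ ^ n := by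
  obtain ⟨p, hp⟩ := hF
  refine ⟨p + p, fun i z ρ j hz hρ => ?_⟩
  have hρ0 := (norm_nonneg z).trans hz
  have hΛ := (s i).two_le
  refine (Splitting.norm_eval_le (pderiv_mem_lowDeg j (hn i))
    (fun j => (PiLp.norm_apply_le z j).trans hz) hρ0 hρ).trans ?_
  gcongr
  refine (l1_pderiv_le j (hp i).2).trans ?_
  rw [pow_add]
  exact mul_le_mul (natCast_le_pow hΛ p) (hp i).1 (l1_nonneg _) (by positivity)

/-- The drift of the approximate integrals in one step of the splitting method. -/
theorem exists_norm_approxInt_step_le (M : ℕ) (a : ∀ i, (s i).A) :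
    ∃ p : ℕ, ∀ (i : ι) (P : Phase (s i).A → ℂ) (γ : ℝ → Phase (s i).A) (ρ : ℝ), ρ ≤ 1 →
      (∀ t ∈ Set.Icc 0 (s i).h, ‖γ t‖ ≤ ρ) →
      (∀ t ∈ Set.Icc 0 (s i).h, HasDerivWithinAt γ (hamVF P (γ t)) (Set.Icc 0 (s i).h) t) →
      (∀ t ∈ Set.Icc 0 (s i).h, ∀ j, ‖fderiv ℂ P (γ t) (EuclideanSpace.single j 1)
        - MvPolynomial.eval (γ t) (pd j (s i).Q)‖ ≤ (s i).Λ ^ c * ρ ^ (M + 2)) →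
      ‖MvPolynomial.eval (rotMap (s i).ω (s i).h (γ (s i).h)) (approxInt (s i) M (a i))
        - MvPolynomial.eval (γ 0) (approxInt (s i) M (a i))‖ ≤ (s i).Λ ^ p * ρ ^ (M + 3) := by
  -- The rotation acts last on points, hence first on functions: `F` at the end point `γ h` is
  -- `approxInt` after the complete step.
  set F : ∀ i, Poly (s i).A := fun i =>
    rotOp (s i).ω (s i).h (approxInt (s i) M (a i)) with hFdef
  have hFt : Tame s F := (Tame.approxInt M a).rotOp
  have hFl : ∀ i, F i ∈ lowDeg _ (1 + 1) := fun i =>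
    diag_mem_restrictSupport _ (approxInt_mem_lowDeg (s i) M (a i))
  have hlow : ∀ q i, ((Splitting.bracket pd).flip (s i).Q)^[q] (F i) ∈ lowDeg _ (1 + q + 1) :=
    fun q i => iterate_bracket_mem_lowDeg (s i).Q_low (hFl i) q
  obtain ⟨p₁, hp₁⟩ := (hFt.iterate_bracket (M + 1)).norm_eval_le (hlow (M + 1))
  choose p₂ hp₂ using fun q => (hFt.iterate_bracket q).norm_eval_pderiv_le (n := 1)
    fun i => lowDeg_mono (by omega) (hlow q i)
  obtain ⟨p₃, hp₃⟩ := (Tame.remainder M a).norm_eval_le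
    fun i => remainder_mem_lowDeg (s i) M (a i)
  set p₄ := c + (∑ q ∈ Finset.range (M + 1), p₂ q) + c with hp₄
  set p₅ := p₁ + p₄ with hp₅
  -- The summands pay for the factors of the Taylor estimate: `M + 2 ≤ Λ ^ (M + 2)`, then `H ^ (M +
  -- 1)` with `H = Λ ^ c`, then the bound `B`.
  set p₆ := (M + 2) + c * (M + 1) + p₅ with hp₆
  refine ⟨max p₆ p₃ + 1, fun i P γ ρ hρ hγ hder hPQ => ?_⟩
  have hΛ := (s i).two_le
  have hΛ1 : (1 : ℝ) ≤ (s i).Λ := by linarith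
  have h0 := (s i).h_pos.le
  have hρ0 : 0 ≤ ρ := (norm_nonneg _).trans (hγ 0 ⟨le_rfl, h0⟩)
  set L := (Splitting.bracket (pd (A := (s i).A))).flip (s i).Q with hL
  -- The chain consists of the iterated brackets with `Q`. The last one has degree at least `2 + (M
  -- + 1)`. The errors pair a gradient of size `ρ` with the gradient of `P - Q`, of size `ρ ^ (M +
  -- 2)`. Both give `ρ ^ (M + 3)`.
  have hchain := norm_taylor_chain_le M
    (f := fun q t => MvPolynomial.eval (γ t) (L^[q] (F i)))
    (e := fun q t => ∑ j, symp j * (MvPolynomial.eval (γ t) (pd j (L^[q] (F i))) *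
          (fderiv ℂ P (γ t) (EuclideanSpace.single (bar j) 1)
            - MvPolynomial.eval (γ t) (pd (bar j) (s i).Q))))
    (B := (s i).Λ ^ p₅ * ρ ^ (M + 3)) h0 (s i).h_le (one_le_pow₀ hΛ1)
    (fun q _ t ht => by
      have := hasDerivWithinAt_eval_hamVF P (L^[q] (F i)) (s i).Q (hder t ht)
      rwa [← LinearMap.flip_apply, ← hL, ← Function.iterate_succ_apply' L] at this)
    (fun t ht => by
      refine (hp₁ i (γ t) ρ (hγ t ht) hρ).trans ?_
      rw [show 1 + (M + 1) + 1 = M + 3 by ring]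
      gcongr
      omega)
    (fun q hq t ht => by
      have hq' : p₂ q ≤ ∑ q ∈ Finset.range (M + 1), p₂ q :=
        Finset.single_le_sum (f := p₂) (fun _ _ => Nat.zero_le _)
          (Finset.mem_range.mpr (by omega))
      calc _ ≤ ∑ j : (s i).A × ℤˣ, ((s i).Λ ^ p₂ q * ρ ^ 1) * ((s i).Λ ^ c * ρ ^ (M + 2)) := by
            refine norm_sum_le_of_le _ fun j _ => ?_
            rw [norm_mul, norm_symp, one_mul, norm_mul]
            exact mul_le_mul (hp₂ q i (γ t) ρ j (hγ t ht) hρ) (hPQ t ht (bar j)) (norm_nonneg _)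
              (by positivity)
        _ = Fintype.card ((s i).A × ℤˣ) * ((s i).Λ ^ p₂ q * (s i).Λ ^ c) * ρ ^ (M + 3) := by
            rw [Finset.sum_const, Finset.card_univ, nsmul_eq_mul]
            ring
        _ ≤ (s i).Λ ^ c * ((s i).Λ ^ p₂ q * (s i).Λ ^ c) * ρ ^ (M + 3) := by
            gcongr
            exact (s i).card_le
        _ = (s i).Λ ^ (c + p₂ q + c) * ρ ^ (M + 3) := by ring
        _ ≤ _ := by
            gcongr
            omega)
  have hsum : ∑ q ∈ Finset.range (M + 1), (((s i).h : ℂ) ^ q / (q.factorial : ℂ)) *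
      MvPolynomial.eval (γ 0) (L^[q] (F i))
      = MvPolynomial.eval (γ 0) (approxInt (s i) M (a i))
        + MvPolynomial.eval (γ 0) (remainder (s i) M (a i)) := by
    rw [← map_add, ← sum_evol_approxInt, map_sum]
    refine Finset.sum_congr rfl fun q _ => ?_
    rw [evol_const, iterate_bracket_smul, MvPolynomial.smul_eval, MvPolynomial.smul_eval]
    ring
  simp only [hsum] at hchain
  rw [Function.iterate_zero, id_eq, hFdef, eval_rotOp] at hchain
  have hrem := hp₃ i (γ 0) ρ (hγ 0 ⟨le_rfl, h0⟩) hρ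
  have hB : ((M : ℝ) + 2) * ((s i).Λ ^ c) ^ (M + 1) * ((s i).Λ ^ p₅ * ρ ^ (M + 3))
      ≤ (s i).Λ ^ p₆ * ρ ^ (M + 3) := by
    have h1 := natCast_le_pow hΛ (M + 2)
    push_cast at h1
    calc _ ≤ (s i).Λ ^ (M + 2) * ((s i).Λ ^ c) ^ (M + 1) * ((s i).Λ ^ p₅ * ρ ^ (M + 3)) := by
          gcongr
      _ = _ := by
          rw [hp₆]
          ring
  set v := MvPolynomial.eval (rotMap (s i).ω (s i).h (γ (s i).h)) (approxInt (s i) M (a i))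
  set v₀ := MvPolynomial.eval (γ 0) (approxInt (s i) M (a i))
  set w := MvPolynomial.eval (γ 0) (remainder (s i) M (a i))
  have hm : ∀ q ≤ max p₆ p₃, (s i).Λ ^ q * ρ ^ (M + 3) ≤ (s i).Λ ^ max p₆ p₃ * ρ ^ (M + 3) := by
    intro q hq
    gcongr
  calc ‖v - v₀‖ = ‖(v - (v₀ + w)) + w‖ := by ring_nf
    _ ≤ ‖v - (v₀ + w)‖ + ‖w‖ := norm_add_le _ _
    _ ≤ (s i).Λ ^ max p₆ p₃ * ρ ^ (M + 3) + (s i).Λ ^ max p₆ p₃ * ρ ^ (M + 3) :=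
        add_le_add ((hchain.trans hB).trans (hm _ (le_max_left _ _)))
          (hrem.trans (hm _ (le_max_right _ _)))
    _ ≤ (s i).Λ ^ (max p₆ p₃ + 1) * ρ ^ (M + 3) := by
        rw [pow_succ (s i).Λ]
        have : 0 ≤ (s i).Λ ^ max p₆ p₃ * ρ ^ (M + 3) := by positivity
        nlinarith

/-- The approximate integrals are close to the actions. -/
theorem exists_norm_approxInt_sub_action_le (M : ℕ) (a : ∀ i, (s i).A) :
    ∃ p : ℕ, ∀ (i : ι) (z : Phase (s i).A) (ρ : ℝ), ‖z‖ ≤ ρ → ρ ≤ 1 →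
      ‖MvPolynomial.eval z (approxInt (s i) M (a i)) - action (a i) z‖
        ≤ (s i).Λ ^ p * ρ ^ 3 := by
  obtain ⟨p, hp⟩ := ((Tame.approxInt M a).sub (Tame.actionPoly a)).norm_eval_le
    fun i => approxInt_sub_mem_lowDeg (s i) M (a i)
  refine ⟨p, fun i z ρ hz hρ => ?_⟩
  have := hp i z ρ hz hρ
  rwa [map_sub, actionPoly, map_mul, MvPolynomial.eval_X, MvPolynomial.eval_X] at this

end OneStep

end Splitting

end

noncomputable section

namespace Splitting

open PowerSeries Finset.HasAntidiagonal

/-! ### Cauchy estimates for holomorphic maps on balls. -/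

section Cauchy

variable {E F : Type*} [NormedAddCommGroup E] [NormedSpace ℂ E] [NormedAddCommGroup F]
  [NormedSpace ℂ F]

/-- Cauchy's estimate for the derivative of a holomorphic map on a normed space. -/
theorem norm_fderiv_le_of_forall_closedBall {g : E → F} {z : E} {δ C : ℝ} (hδ : 0 < δ)
    (hC0 : 0 ≤ C) (hg : ∀ w ∈ Metric.closedBall z δ, DifferentiableAt ℂ g w)
    (hC : ∀ w ∈ Metric.closedBall z δ, ‖g w‖ ≤ C) : ‖fderiv ℂ g z‖ ≤ C / δ := by
  refine ContinuousLinearMap.opNorm_le_bound _ (by positivity) fun v => ?_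
  rcases eq_or_ne v 0 with rfl | hv
  · simp
  have hv0 : 0 < ‖v‖ := norm_pos_iff.mpr hv
  have hmem : ∀ t ∈ Metric.closedBall (0 : ℂ) (δ / ‖v‖), z + t • v ∈ Metric.closedBall z δ := by
    intro t ht
    rw [mem_closedBall_zero_iff, le_div_iff₀ hv0] at ht
    simpa [norm_smul] using ht
  have hline : ∀ t : ℂ, HasDerivAt (fun t : ℂ => z + t • v) v t := fun t => by
    simpa using ((hasDerivAt_id t).smul_const v).const_add z
  have hder : ∀ t ∈ Metric.closedBall (0 : ℂ) (δ / ‖v‖),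
      HasDerivAt (fun t : ℂ => g (z + t • v)) (fderiv ℂ g (z + t • v) v) t := fun t ht =>
    (hg _ (hmem t ht)).hasFDerivAt.comp_hasDerivAt t (hline t)
  have h0 : (0 : ℂ) ∈ Metric.closedBall (0 : ℂ) (δ / ‖v‖) := by
    simp only [Metric.mem_closedBall, dist_self]
    positivity
  -- The one-variable estimate is applied on the complex line through `z` in direction `v`, where
  -- the disc of radius `δ / ‖v‖` stays in the ball.
  have key := Complex.norm_deriv_le_of_forall_mem_sphere_norm_le (c := 0) (C := C)
    (f := fun t : ℂ => g (z + t • v)) (div_pos hδ hv0)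
    (DifferentiableOn.diffContOnCl_ball
      (fun t ht => (hder t ht).differentiableAt.differentiableWithinAt) subset_rfl)
    (fun t ht => hC _ (hmem t (Metric.sphere_subset_closedBall ht)))
  rw [(hder 0 h0).deriv, zero_smul, add_zero] at key
  refine key.trans_eq ?_
  field_simp

variable {P : E → F} {ρ : ℝ}

theorem contDiffAt_of_mem_ball {n : WithTop ℕ∞} (hP : ContDiffOn ℂ n P (Metric.ball 0 ρ)) {z : E}
    (hz : ‖z‖ < ρ) : ContDiffAt ℂ n P z :=
  hP.contDiffAt (Metric.isOpen_ball.mem_nhds (by simpa using hz))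

theorem differentiableAt_iteratedFDeriv
    (hP : ContDiffOn ℂ ((⊤ : ℕ∞) : WithTop ℕ∞) P (Metric.ball 0 ρ)) (k : ℕ) {z : E}
    (hz : ‖z‖ < ρ) : DifferentiableAt ℂ (iteratedFDeriv ℂ k P) z :=
  (contDiffAt_of_mem_ball hP hz).differentiableAt_iteratedFDeriv
    (by exact_mod_cast WithTop.coe_lt_top k)

/-- The bounds on the derivatives of order at least `2` that follow from a bound at order `2`. -/
theorem norm_iteratedFDeriv_le (hρ : 0 < ρ)
    (hP : ContDiffOn ℂ ((⊤ : ℕ∞) : WithTop ℕ∞) P (Metric.ball 0 ρ)) {B : ℝ} (hB : 0 ≤ B)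
    (h2 : ∀ z : E, ‖z‖ < ρ → ‖iteratedFDeriv ℂ 2 P z‖ ≤ B) (k : ℕ) {z : E}
    (hz : ‖z‖ < ρ / 2 ^ k) : ‖iteratedFDeriv ℂ (2 + k) P z‖ ≤ B * (2 ^ k / ρ) ^ k := by
  induction k generalizing z with
  | zero => simpa using h2 z (by simpa using hz)
  | succ k ih =>
    have hle : ρ / 2 ^ k ≤ ρ := div_le_self hρ.le (one_le_pow₀ (by norm_num))
    have hsplit : ρ / 2 ^ (k + 1) + ρ / 2 ^ (k + 1) = ρ / 2 ^ k := by
      rw [pow_succ]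
      field_simp
      ring
    have hmem : ∀ w ∈ Metric.closedBall z (ρ / 2 ^ (k + 1)), ‖w‖ < ρ / 2 ^ k := by
      intro w hw
      rw [mem_closedBall_iff_norm] at hw
      have := norm_add_le (w - z) z
      rw [sub_add_cancel] at this
      linarith
    rw [← add_assoc, ← norm_fderiv_iteratedFDeriv]
    -- Each further derivative halves the radius; a ball of radius `ρ / 2 ^ (k + 1)` about `z` stays
    -- in the domain of the previous bound.
    refine (norm_fderiv_le_of_forall_closedBall (C := B * (2 ^ k / ρ) ^ k) (by positivity)
      (by positivity)
      (fun w hw => differentiableAt_iteratedFDeriv hP _ ((hmem w hw).trans_le hle))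
      (fun w hw => ih (hmem w hw))).trans ?_
    calc B * (2 ^ k / ρ) ^ k / (ρ / 2 ^ (k + 1)) = B * ((2 ^ k / ρ) ^ k * (2 ^ (k + 1) / ρ)) := by
          field_simp
      _ ≤ B * ((2 ^ (k + 1) / ρ) ^ k * (2 ^ (k + 1) / ρ)) := by
          gcongr
          · norm_num
          · omega
      _ = _ := by rw [pow_succ (_ / _) k]

end Cauchy

/-! ### Taylor polynomials in the coordinates of phase space and their remainders. -/

section Taylor

variable {A : Type} [Fintype A] [DecidableEq A]

theorem multilinear_eq_sum {k : ℕ}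
    (f : ContinuousMultilinearMap ℂ (fun _ : Fin k => Phase A) ℂ) (v : Fin k → Phase A) :
    f v = ∑ j : Fin k → A × ℤˣ, (∏ i, v i (j i)) *
      f fun i => EuclideanSpace.single (j i) (1 : ℂ) := by
  have h : v = fun i => ∑ j, v i j • EuclideanSpace.single j (1 : ℂ) := by
    funext i
    ext l
    simp [Finset.sum_apply, Pi.single_apply]
  conv_lhs => rw [h, ContinuousMultilinearMap.map_sum]
  refine Finset.sum_congr rfl fun j _ => ?_
  rw [ContinuousMultilinearMap.map_smul_univ, smul_eq_mul]

/-- Turns bounds on single partial derivatives into operator norm bounds; the loss is a power of the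
number of coordinates, which is polynomial in `K`. -/
theorem norm_multilinear_le {k : ℕ}
    (f : ContinuousMultilinearMap ℂ (fun _ : Fin k => Phase A) ℂ) {C : ℝ} (hC : 0 ≤ C)
    (h : ∀ j : Fin k → A × ℤˣ, ‖f fun i => EuclideanSpace.single (j i) (1 : ℂ)‖ ≤ C) :
    ‖f‖ ≤ (Fintype.card (A × ℤˣ) : ℝ) ^ k * C := by
  refine ContinuousMultilinearMap.opNorm_le_bound (by positivity) fun v => ?_
  rw [multilinear_eq_sum f v]
  refine (norm_sum_le_of_le (n := fun _ => (∏ i, ‖v i‖) * C) _ fun j _ => ?_).trans_eq ?_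
  · rw [norm_mul, norm_prod]
    exact mul_le_mul (Finset.prod_le_prod (fun _ _ => norm_nonneg _)
      fun i _ => PiLp.norm_apply_le (v i) (j i)) (h j) (norm_nonneg _)
      (Finset.prod_nonneg fun _ _ => norm_nonneg _)
  · rw [Finset.sum_const, Finset.card_univ, Fintype.card_fun, Fintype.card_fin, nsmul_eq_mul]
    push_cast
    ring

/-- The homogeneous part of degree `k` of the Taylor polynomial of `P` at `0`. -/
def taylorPart (P : Phase A → ℂ) (k : ℕ) : Poly A :=
  ∑ j : Fin k → A × ℤˣ, MvPolynomial.monomial (∑ i, Finsupp.single (j i) 1)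
    ((k.factorial : ℂ)⁻¹ *
      iteratedFDeriv ℂ k P 0 fun i => EuclideanSpace.single (j i) (1 : ℂ))

/-- The Taylor polynomial of `P` at `0` of degree less than `n`. -/
def taylorPoly (P : Phase A → ℂ) (n : ℕ) : Poly A := ∑ k ∈ Finset.range n, taylorPart P k

theorem eval_taylorPart (P : Phase A → ℂ) (k : ℕ) (z : Phase A) :
    MvPolynomial.eval z (taylorPart P k)
      = (k.factorial : ℂ)⁻¹ * iteratedFDeriv ℂ k P 0 fun _ => z := by
  rw [taylorPart, map_sum, multilinear_eq_sum, Finset.mul_sum]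
  refine Finset.sum_congr rfl fun j _ => ?_
  have h : (∑ i, Finsupp.single (j i) 1 : A × ℤˣ →₀ ℕ).prod (fun l e => z l ^ e)
      = ∏ i, z (j i) := by
    rw [← Finsupp.prod_finsetSum_index (fun _ => pow_zero _) (fun _ _ _ => pow_add _ _ _)]
    simp
  rw [MvPolynomial.eval_monomial, h]
  ring

theorem taylorPart_mem (P : Phase A → ℂ) (k : ℕ) :
    taylorPart P k ∈ lowDeg (A × ℤˣ) k ∧ taylorPart P k ∈ upDeg (A × ℤˣ) k := by
  refine ⟨Submodule.sum_mem _ fun j _ => ?_, Submodule.sum_mem _ fun j _ => ?_⟩ <;>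
  · refine (MvPolynomial.monomial_mem_restrictSupport _).mpr ?_
    left
    simp

theorem l1_taylorPart_le (P : Phase A → ℂ) (k : ℕ) :
    l1 (taylorPart P k) ≤ (Fintype.card (A × ℤˣ) : ℝ) ^ k * ‖iteratedFDeriv ℂ k P 0‖ := by
  refine (l1_sum_le _ _).trans ((Finset.sum_le_card_nsmul _ _ ‖iteratedFDeriv ℂ k P 0‖
    fun j _ => ?_).trans_eq ?_)
  · rw [l1_monomial, norm_mul, norm_inv, Complex.norm_natCast]
    have h1 : ((k.factorial : ℝ))⁻¹ ≤ 1 :=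
      inv_le_one_of_one_le₀ (by exact_mod_cast k.factorial_pos)
    have h2 := (iteratedFDeriv ℂ k P 0).le_opNorm fun i => EuclideanSpace.single (j i) (1 : ℂ)
    simp only [PiLp.norm_single, norm_one, Finset.prod_const_one, mul_one] at h2
    exact (mul_le_of_le_one_left (norm_nonneg _) h1).trans h2
  · rw [Finset.card_univ, Fintype.card_fun, Fintype.card_fin, nsmul_eq_mul]
    push_cast
    ring

theorem taylorPoly_mem_lowDeg {P : Phase A → ℂ} (h0 : ∀ k < 3, iteratedFDeriv ℂ k P 0 = 0)
    (n : ℕ) : taylorPoly P n ∈ lowDeg (A × ℤˣ) 3 := by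
  refine Submodule.sum_mem _ fun k _ => ?_
  by_cases hk : k < 3
  · have : taylorPart P k = 0 := by simp [taylorPart, h0 k hk]
    rw [this]
    exact Submodule.zero_mem _
  · exact lowDeg_mono (by omega) (taylorPart_mem P k).1

theorem taylorPoly_mem_upDeg (P : Phase A → ℂ) (n : ℕ) : taylorPoly P n ∈ upDeg (A × ℤˣ) n :=
  Submodule.sum_mem _ fun k hk =>
    upDeg_mono (Finset.mem_range.mp hk).le (taylorPart_mem P k).2

theorem differentiable_eval {A : Type} [Fintype A] (F : Poly A) :
    Differentiable ℂ fun z : Phase A => MvPolynomial.eval z F := by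
  induction F using MvPolynomial.induction_on with
  | C c => simp
  | add F G hF hG =>
    simp only [map_add]
    exact hF.add hG
  | mul_X F i hF =>
    simp only [map_mul, MvPolynomial.eval_X]
    exact hF.mul (EuclideanSpace.proj i : Phase A →L[ℂ] ℂ).differentiable

theorem fderiv_eval_single (F : Poly A) (z : Phase A) (j : A × ℤˣ) :
    fderiv ℂ (fun z : Phase A => MvPolynomial.eval z F) z (EuclideanSpace.single j 1)
      = MvPolynomial.eval z (pd j F) := by
  have hline : HasDerivAt (fun t : ℝ => z + (t : ℂ) • EuclideanSpace.single j (1 : ℂ))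
      (EuclideanSpace.single j (1 : ℂ)) 0 := by
    simpa using ((Complex.ofRealCLM.hasDerivAt (x := 0)).smul_const
      (EuclideanSpace.single j (1 : ℂ) : Phase A)).const_add z
  have h1 := (((differentiable_eval F) (z + ((0 : ℝ) : ℂ) • EuclideanSpace.single j
    (1 : ℂ))).hasFDerivAt.restrictScalars ℝ).comp_hasDerivAt (0 : ℝ) hline
  have h2 := hasDerivWithinAt_eval F (s := Set.univ) (t := 0)
    (γ := fun t l => (z + (t : ℂ) • EuclideanSpace.single j (1 : ℂ) : Phase A) l)
    (v := fun l => (EuclideanSpace.single j (1 : ℂ) : Phase A) l)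
    (fun l => (((EuclideanSpace.proj l : Phase A →L[ℂ] ℂ).restrictScalars ℝ).hasFDerivAt
      |>.comp_hasDerivWithinAt 0 hline.hasDerivWithinAt))
  rw [hasDerivWithinAt_univ] at h2
  have h3 := h1.unique h2
  rw [Finset.sum_eq_single j (fun l _ hl => by simp [hl]) (by simp)] at h3
  simpa using h3

variable {P : Phase A → ℂ} {ρ : ℝ}

theorem hasDerivAt_iteratedFDeriv_line {A : Type} [Fintype A] {P : Phase A → ℂ} {ρ : ℝ}
    (hP : ContDiffOn ℂ ((⊤ : ℕ∞) : WithTop ℕ∞) P (Metric.ball 0 ρ)) (k : ℕ) (z : Phase A) (t : ℝ)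
    (hz : ‖(t : ℂ) • z‖ < ρ) :
    HasDerivAt (fun t : ℝ => iteratedFDeriv ℂ k P ((t : ℂ) • z) fun _ => z)
      (iteratedFDeriv ℂ (k + 1) P ((t : ℂ) • z) fun _ => z) t := by
  have hline : HasDerivAt (fun t : ℝ => (t : ℂ) • z) z t := by
    simpa using (Complex.ofRealCLM.hasDerivAt (x := t)).smul_const z
  have h1 := ((differentiableAt_iteratedFDeriv hP k hz).hasFDerivAt.restrictScalars
    ℝ).comp_hasDerivAt t hline
  have h2 := ((ContinuousMultilinearMap.apply ℂ (fun _ : Fin k => Phase A) ℂ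
    fun _ => z).restrictScalars ℝ).hasFDerivAt.comp_hasDerivAt t h1
  exact h2.congr_deriv (by rw [iteratedFDeriv_succ_apply_left]; rfl)

/-- The Taylor chain estimate on the segment from `0` to `z`, where successive derivatives follow
each other exactly and the errors are zero. -/
theorem norm_sub_eval_taylorPoly_le
    (hP : ContDiffOn ℂ ((⊤ : ℕ∞) : WithTop ℕ∞) P (Metric.ball 0 ρ)) (n : ℕ) {B : ℝ} {z : Phase A}
    (hz : ‖z‖ < ρ) (hB : ∀ w : Phase A, ‖w‖ ≤ ‖z‖ → ‖iteratedFDeriv ℂ (n + 1) P w‖ ≤ B) :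
    ‖P z - MvPolynomial.eval z (taylorPoly P (n + 1))‖ ≤ (n + 2) * (B * ‖z‖ ^ (n + 1)) := by
  have hle : ∀ t ∈ Set.Icc (0 : ℝ) 1, ‖(t : ℂ) • z‖ ≤ ‖z‖ := by
    intro t ht
    rw [norm_smul, Complex.norm_real, Real.norm_eq_abs, abs_of_nonneg ht.1]
    exact mul_le_of_le_one_left (norm_nonneg _) ht.2
  have hB0 : 0 ≤ B := (norm_nonneg _).trans (hB z le_rfl)
  have key := norm_taylor_chain_le n (h := 1) (H := 1) (B := B * ‖z‖ ^ (n + 1))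
    (f := fun k t => iteratedFDeriv ℂ k P ((t : ℂ) • z) fun _ => z) (e := fun _ _ => 0)
    zero_le_one le_rfl le_rfl
    (fun q _ t ht => by
      rw [add_zero]
      exact (hasDerivAt_iteratedFDeriv_line hP q z t ((hle t ht).trans_lt hz)).hasDerivWithinAt)
    (fun t ht => by
      refine (ContinuousMultilinearMap.le_opNorm _ _).trans ?_
      rw [Finset.prod_const, Finset.card_univ, Fintype.card_fin]
      gcongr
      exact hB _ (hle t ht))
    (fun q _ t _ => by rw [norm_zero]; positivity)
  rw [one_pow, mul_one] at key
  convert key using 3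
  · simp
  · rw [taylorPoly, map_sum]
    refine Finset.sum_congr rfl fun k _ => ?_
    rw [eval_taylorPart]
    simp

/-- The gradient of the Taylor remainder. -/
theorem norm_fderiv_sub_eval_pderiv_le (hρ : 0 < ρ)
    (hP : ContDiffOn ℂ ((⊤ : ℕ∞) : WithTop ℕ∞) P (Metric.ball 0 ρ)) (n : ℕ) {B : ℝ}
    (hB : ∀ w : Phase A, ‖w‖ < ρ → ‖iteratedFDeriv ℂ (n + 1) P w‖ ≤ B) {z : Phase A} {τ : ℝ}
    (hτ : 0 < τ) (hzτ : ‖z‖ ≤ τ) (hτρ : 2 * τ < ρ) (j : A × ℤˣ) :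
    ‖fderiv ℂ P z (EuclideanSpace.single j 1)
      - MvPolynomial.eval z (pd j (taylorPoly P (n + 1)))‖
        ≤ (n + 2) * (B * 2 ^ (n + 1)) * τ ^ n := by
  have hB0 : 0 ≤ B := (norm_nonneg _).trans (hB 0 (by simpa using hρ))
  have hmem : ∀ w ∈ Metric.closedBall z τ, ‖w‖ ≤ 2 * τ := by
    intro w hw
    rw [mem_closedBall_iff_norm] at hw
    have := norm_add_le (w - z) z
    rw [sub_add_cancel] at this
    linarith
  have hPd : ∀ w : Phase A, ‖w‖ < ρ → DifferentiableAt ℂ P w := fun w hw =>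
    (contDiffAt_of_mem_ball hP hw).differentiableAt (by simp)
  -- Cauchy's estimate on a ball of radius `τ` is applied to the Taylor remainder itself: points of
  -- that ball have norm at most `2 τ`, whence the factor `2 ^ (n + 1)`, and division by `τ` leaves
  -- `τ ^ n`.
  have h1 := norm_fderiv_le_of_forall_closedBall
    (g := fun w : Phase A => P w - MvPolynomial.eval w (taylorPoly P (n + 1))) (z := z)
    (C := (n + 2) * (B * (2 * τ) ^ (n + 1))) hτ (by positivity)
    (fun w hw => (hPd w ((hmem w hw).trans_lt hτρ)).sub (differentiable_eval _ w))
    (fun w hw => by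
      refine (norm_sub_eval_taylorPoly_le hP n ((hmem w hw).trans_lt hτρ)
        fun x hx => hB x (hx.trans_lt ((hmem w hw).trans_lt hτρ))).trans ?_
      gcongr
      exact hmem w hw)
  have h2 : fderiv ℂ (fun w : Phase A => P w - MvPolynomial.eval w (taylorPoly P (n + 1))) z
      = fderiv ℂ P z - fderiv ℂ (fun w : Phase A =>
        MvPolynomial.eval w (taylorPoly P (n + 1))) z :=
    fderiv_sub (hPd z (by linarith)) (differentiable_eval _ z)
  have h3 := ContinuousLinearMap.le_opNorm (fderiv ℂ (fun w : Phase A =>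
    P w - MvPolynomial.eval w (taylorPoly P (n + 1))) z) (EuclideanSpace.single j 1)
  rw [PiLp.norm_single, norm_one, mul_one] at h3
  rw [h2, sub_apply, fderiv_eval_single] at h3
  refine h3.trans ?_
  rw [← h2]
  refine h1.trans_eq ?_
  rw [mul_pow]
  field_simp
  ring

end Taylor

end Splitting

end

noncomputable section

namespace Splitting

open Filter Topology

/-! ### Vanishing of solutions of a local differential inequality. -/

section LocalGronwall

variable {E : Type*} [NormedAddCommGroup E] [NormedSpace ℝ E]

/-- A function that starts at zero and satisfies a differential inequality `‖u'‖ ≤ K ‖u‖` near each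
of its zeros vanishes identically. -/
theorem eq_zero_of_local_gronwall {u u' : ℝ → E} {T : ℝ} (h0 : u 0 = 0)
    (hu : ∀ t ∈ Set.Icc 0 T, HasDerivWithinAt u (u' t) (Set.Icc 0 T) t)
    (hloc : ∀ t ∈ Set.Ico 0 T, u t = 0 →
      ∃ K : ℝ, ∀ᶠ s in 𝓝[Set.Icc 0 T] t, ‖u' s‖ ≤ K * ‖u s‖) :
    ∀ t ∈ Set.Icc 0 T, u t = 0 := by
  have hcont : ContinuousOn u (Set.Icc 0 T) := fun t ht => (hu t ht).continuousWithinAt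
  have hclosed : IsClosed ({t | u t = 0} ∩ Set.Icc 0 T) := by
    have := hcont.preimage_isClosed_of_isClosed isClosed_Icc (isClosed_singleton (x := (0 : E)))
    rwa [Set.inter_comm] at this
  -- Continuous induction: the zero set is closed, and the local inequality extends it a little to
  -- the right of each of its points.
  refine fun t ht => (hclosed.Icc_subset_of_forall_exists_gt h0 ?_) ht
  rintro x ⟨hx0, hx⟩ y hy
  obtain ⟨K, hK⟩ := hloc x hx hx0
  have hK' : ∀ᶠ s in 𝓝[≥] x, ‖u' s‖ ≤ K * ‖u s‖ := by
    have hmem := Icc_mem_nhdsGE_of_mem hx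
    have := nhdsWithin_inter_of_mem hmem
    rw [← this]
    exact hK.filter_mono (nhdsWithin_mono _ Set.inter_subset_left)
  obtain ⟨w, hw, hws⟩ := mem_nhdsGE_iff_exists_Ico_subset.mp hK'
  set b := min w (min y T)
  have hxb : x < b := lt_min hw (lt_min hy hx.2)
  have hbT : b ≤ T := (min_le_right _ _).trans (min_le_right _ _)
  have hsub : Set.Icc x b ⊆ Set.Icc 0 T := Set.Icc_subset_Icc hx.1 hbT
  have hz := eq_zero_of_abs_deriv_le_mul_abs_self_of_eq_zero_right (K := K) (f := u) (f' := u')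
    (hcont.mono hsub) (fun s hs => ?_) hx0 (fun s hs => hws ⟨hs.1, hs.2.trans_le (min_le_left _ _)⟩)
    b ⟨hxb.le, le_rfl⟩
  · exact ⟨b, hz, hxb, (min_le_right _ _).trans (min_le_left _ _)⟩
  · have hs' : s ∈ Set.Ico 0 T := ⟨hx.1.trans hs.1, hs.2.trans_le hbT⟩
    exact (hu s ⟨hs'.1, hs'.2.le⟩).mono_of_mem_nhdsWithin (Icc_mem_nhdsGE_of_mem hs')

end LocalGronwall

/-- The Picard-Lindelöf theorem, with a solution that stays in the ball of the hypotheses. -/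
theorem exists_solution_mem_closedBall {E : Type*} [NormedAddCommGroup E] [NormedSpace ℝ E]
    [CompleteSpace E] {f : ℝ → E → E} {tmin tmax : ℝ} {t₀ : Set.Icc tmin tmax} {x₀ : E}
    {a L K : NNReal} (hf : IsPicardLindelof f t₀ x₀ a 0 L K) :
    ∃ α : ℝ → E, α t₀ = x₀ ∧ ∀ t ∈ Set.Icc tmin tmax, α t ∈ Metric.closedBall x₀ a ∧
      HasDerivWithinAt α (f t (α t)) (Set.Icc tmin tmax) t := by
  have hx : x₀ ∈ Metric.closedBall x₀ ((0 : NNReal) : ℝ) := Metric.mem_closedBall_self le_rfl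
  obtain ⟨α, hα⟩ := ODE.FunSpace.exists_isFixedPt_next hf hx
  refine ⟨α.compProj, by rw [ODE.FunSpace.compProj_val, ← hα, ODE.FunSpace.next_apply₀],
    fun t ht => ⟨α.compProj_mem_closedBall hf.mul_max_le, ?_⟩⟩
  refine (ODE.hasDerivWithinAt_picard_Icc t₀.2 hf.continuousOn_uncurry
    α.continuous_compProj.continuousOn (fun _ _ => α.compProj_mem_closedBall hf.mul_max_le)
    x₀ ht).congr_of_mem ?_ ht
  intro t' ht'
  nth_rw 1 [← hα]
  rw [ODE.FunSpace.compProj_of_mem ht', ODE.FunSpace.next_apply]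

/-! ### Complex conjugation on phase space and real Hamiltonians. -/

section Conjugation

variable {A : Type} [Fintype A] {U : Set (Phase A)} {z : Phase A}

/-- The conjugation of phase space whose fixed points are the real points. -/
def conjPhase : Phase A →ₗᵢ[ℝ] Phase A where
  toFun z := WithLp.toLp 2 fun j => (starRingEnd ℂ) (z (bar j))
  map_add' z w := by ext j; simp
  map_smul' c z := by ext j; simp
  norm_map' z := by
    simp only [LinearMap.coe_mk, AddHom.coe_mk, EuclideanSpace.norm_eq, RCLike.norm_conj]
    exact congrArg _ (Equiv.sum_comp (bar_involutive (A := A)).toPerm fun j => ‖z j‖ ^ 2)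

theorem conjPhase_apply (z : Phase A) (j : A × ℤˣ) :
    conjPhase z j = (starRingEnd ℂ) (z (bar j)) := rfl

theorem isReal_iff_conjPhase (z : Phase A) : IsReal z ↔ conjPhase z = z := by
  constructor
  · intro hz
    ext j
    rw [conjPhase_apply, hz j, Complex.conj_conj]
  · intro hz j
    have := congrArg (fun w : Phase A => w (bar j)) hz
    simp only [conjPhase_apply, bar_bar] at this
    exact this.symm

theorem conjPhase_conjPhase (z : Phase A) : conjPhase (conjPhase z) = z := by
  ext j
  simp [conjPhase_apply]

/-- On the real line through `z` in a real direction all points are real, so `P` has imaginary part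
zero near `z` on that line. -/
theorem fderiv_im_eq_zero {P : Phase A → ℂ} (hU : IsOpen U) (hP : IsRealHam U P)
    (hd : DifferentiableAt ℂ P z) (hzU : z ∈ U) (hz : IsReal z) {v : Phase A} (hv : IsReal v) :
    (fderiv ℂ P z v).im = 0 := by
  have hline : HasDerivAt (fun t : ℝ => z + (t : ℂ) • v) v 0 := by
    simpa using ((Complex.ofRealCLM.hasDerivAt (x := 0)).smul_const v).const_add z
  have hz0 : z + ((0 : ℝ) : ℂ) • v = z := by simp
  have h1 : HasDerivAt (fun t : ℝ => P (z + (t : ℂ) • v)) (fderiv ℂ P z v) 0 := by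
    have hd' : HasFDerivAt P ((fderiv ℂ P z).restrictScalars ℝ) (z + ((0 : ℝ) : ℂ) • v) := by
      rw [hz0]
      exact hd.hasFDerivAt.restrictScalars ℝ
    exact hd'.comp_hasDerivAt (0 : ℝ) hline
  have h2 := Complex.imCLM.hasFDerivAt.comp_hasDerivAt (0 : ℝ) h1
  have h3 : (fun t : ℝ => Complex.imCLM (P (z + (t : ℂ) • v))) =ᶠ[𝓝 0] fun _ => 0 := by
    have hmem : ∀ᶠ t : ℝ in 𝓝 0, z + (t : ℂ) • v ∈ U :=
      hline.continuousAt.eventually (by simp only [hz0]; exact hU.mem_nhds hzU)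
    filter_upwards [hmem] with t ht
    refine hP _ ht fun j => ?_
    simp [hz j, hv j]
  exact h2.unique ((hasDerivAt_const (0 : ℝ) (0 : ℝ)).congr_of_eventuallyEq h3)

end Conjugation

theorem norm_le_sum_norm {ι : Type*} [Fintype ι] (v : EuclideanSpace ℂ ι) :
    ‖v‖ ≤ ∑ j, ‖v j‖ := by
  classical
  have h : v = ∑ j, EuclideanSpace.single j (v j) := by
    ext l
    simp [Finset.sum_apply, Pi.single_apply]
  conv_lhs => rw [h]
  exact norm_sum_le_of_le _ fun j _ => (PiLp.norm_single 2 (fun _ => ℂ) j (v j)).le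

/-! ### Uniqueness, reality and existence of Hamiltonian trajectories; the linear flow. -/

section HamiltonianFlow

variable {A : Type} [Fintype A] [DecidableEq A]

theorem hamVF_apply (H : Phase A → ℂ) (z : Phase A) (j : A × ℤˣ) :
    hamVF H z j = symp j * fderiv ℂ H z (EuclideanSpace.single (bar j) 1) := rfl

theorem one_add_one_le_top : (1 : WithTop ℕ∞) + 1 ≤ ((⊤ : ℕ∞) : WithTop ℕ∞) := by
  have h : (1 : WithTop ℕ∞) + 1 = (((1 : ℕ∞) + 1 : ℕ∞) : WithTop ℕ∞) := rfl
  rw [h]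
  exact WithTop.coe_le_coe.mpr le_top

theorem contDiffAt_hamVF {H : Phase A → ℂ} {z : Phase A}
    (hH : ContDiffAt ℂ ((⊤ : ℕ∞) : WithTop ℕ∞) H z) : ContDiffAt ℂ 1 (hamVF H) z := by
  rw [contDiffAt_euclidean]
  intro j
  simp only [hamVF_apply]
  exact contDiffAt_const.mul ((hH.fderiv_right (m := 1) one_add_one_le_top).clm_apply
    contDiffAt_const)

variable {U : Set (Phase A)} {H : Phase A → ℂ} {T : ℝ} {z : Phase A} {γ γ' : ℝ → Phase A}

theorem IsTrajectory.unique (hU : IsOpen U)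
    (hH : ContDiffOn ℂ ((⊤ : ℕ∞) : WithTop ℕ∞) H U) (h : IsTrajectory U H T z γ)
    (h' : IsTrajectory U H T z γ') : ∀ t ∈ Set.Icc 0 T, γ t = γ' t := by
  intro t ht
  rw [← sub_eq_zero]
  refine eq_zero_of_local_gronwall (u := fun t => γ t - γ' t)
    (u' := fun t => hamVF H (γ t) - hamVF H (γ' t)) (by simp [h.1, h'.1])
    (fun t ht => (h.2 t ht).2.sub (h'.2 t ht).2) (fun t ht h0 => ?_) t ht
  have ht' : t ∈ Set.Icc 0 T := ⟨ht.1, ht.2.le⟩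
  rw [sub_eq_zero] at h0
  obtain ⟨K, N, hN, hK⟩ := (contDiffAt_hamVF
    (hH.contDiffAt (hU.mem_nhds (h.2 t ht').1))).exists_lipschitzOnWith
  refine ⟨K, ?_⟩
  have h1 := (h.2 t ht').2.continuousWithinAt.tendsto.eventually hN
  rw [h0] at hN
  have h2 := (h'.2 t ht').2.continuousWithinAt.tendsto.eventually hN
  filter_upwards [h1, h2] with s hs1 hs2
  exact hK.norm_sub_le hs1 hs2

theorem flow_eq_some (hU : IsOpen U) (hH : ContDiffOn ℂ ((⊤ : ℕ∞) : WithTop ℕ∞) H U)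
    (hT : 0 ≤ T) (h : IsTrajectory U H T z γ) : flow U H T z = Part.some (γ T) := by
  have hz : ∃ γ, IsTrajectory U H T z γ := ⟨γ, h⟩
  refine Part.ext' (by simpa [flow] using hz) fun h1 _ => ?_
  exact IsTrajectory.unique hU hH h1.choose_spec h T ⟨hT, le_rfl⟩

theorem exists_of_mem_flow {w : Phase A} (hw : w ∈ flow U H T z) :
    ∃ γ, IsTrajectory U H T z γ ∧ w = γ T := by
  obtain ⟨hz, rfl⟩ := hw
  exact ⟨hz.choose, hz.choose_spec, rfl⟩

/-- The vector field of a real Hamiltonian is real at the real points. -/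
theorem conjPhase_hamVF {P : Phase A → ℂ} (hU : IsOpen U) (hP : IsRealHam U P)
    (hd : DifferentiableAt ℂ P z) (hzU : z ∈ U) (hz : IsReal z) :
    conjPhase (hamVF P z) = hamVF P z := by
  have key : ∀ j : A × ℤˣ, fderiv ℂ P z (EuclideanSpace.single (bar j) 1)
      = (starRingEnd ℂ) (fderiv ℂ P z (EuclideanSpace.single j 1)) := by
    intro j
    have hne : j ≠ bar j := fun h => by
      have := congrArg Prod.snd h
      simp only [bar] at this
      rcases Int.units_eq_one_or j.2 with h1 | h1 <;> rw [h1] at this <;>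
        exact absurd this (by decide)
    have hsj : ∀ l : A × ℤˣ, bar l = j ↔ l = bar j := fun l =>
      ⟨fun h => by rw [← h, bar_bar], fun h => by rw [h, bar_bar]⟩
    -- The directions `e_j + e_{bar j}` and `i (e_j - e_{bar j})` are real. The derivatives along
    -- them give the imaginary and the real part of the claimed identity.
    have hv1 : IsReal (EuclideanSpace.single j (1 : ℂ) + EuclideanSpace.single (bar j)
        (1 : ℂ)) := by
      intro l
      simp only [PiLp.add_apply, PiLp.single_apply, map_add, hsj]
      have : bar l = bar j ↔ l = j := bar_involutive.injective.eq_iff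
      simp only [this, apply_ite (starRingEnd ℂ), map_one, map_zero]
      ring
    have hv2 : IsReal (Complex.I • EuclideanSpace.single j (1 : ℂ)
        - Complex.I • EuclideanSpace.single (bar j) (1 : ℂ)) := by
      intro l
      simp only [PiLp.sub_apply, PiLp.smul_apply, PiLp.single_apply, map_sub, hsj, smul_eq_mul,
        map_mul, Complex.conj_I]
      have : bar l = bar j ↔ l = j := bar_involutive.injective.eq_iff
      simp only [this, apply_ite (starRingEnd ℂ), map_one, map_zero]
      ring
    have h1 := fderiv_im_eq_zero hU hP hd hzU hz hv1
    have h2 := fderiv_im_eq_zero hU hP hd hzU hz hv2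
    rw [map_add, Complex.add_im] at h1
    rw [map_sub, map_smul, map_smul, Complex.sub_im, smul_eq_mul, smul_eq_mul, Complex.I_mul_im,
      Complex.I_mul_im] at h2
    apply Complex.ext
    · rw [Complex.conj_re]
      linarith
    · rw [Complex.conj_im]
      linarith
  ext j
  rw [conjPhase_apply, hamVF_apply, hamVF_apply, bar_bar, map_mul, symp_bar, ← key j, symp]
  simp

/-- The flow of a real Hamiltonian preserves the real points. -/
theorem IsTrajectory.isReal (hU : IsOpen U)
    (hH : ContDiffOn ℂ ((⊤ : ℕ∞) : WithTop ℕ∞) H U) (hreal : IsRealHam U H)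
    (h : IsTrajectory U H T z γ) (hz : IsReal z) : ∀ t ∈ Set.Icc 0 T, IsReal (γ t) := by
  intro t ht
  rw [isReal_iff_conjPhase, eq_comm, ← sub_eq_zero]
  refine eq_zero_of_local_gronwall (u := fun t => γ t - conjPhase (γ t))
    (u' := fun t => hamVF H (γ t) - conjPhase (hamVF H (γ t)))
    (by simp [h.1, (isReal_iff_conjPhase z).mp hz])
    (fun t ht => (h.2 t ht).2.sub (HasFDerivAt.comp_hasDerivWithinAt t
      (conjPhase (A := A)).toContinuousLinearMap.hasFDerivAt (h.2 t ht).2)) (fun t ht h0 => ?_) t ht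
  have ht' : t ∈ Set.Icc 0 T := ⟨ht.1, ht.2.le⟩
  have hUt := hU.mem_nhds (h.2 t ht').1
  obtain ⟨K, N, hN, hK⟩ := (contDiffAt_hamVF (hH.contDiffAt hUt)).exists_lipschitzOnWith
  obtain ⟨δ, hδ, hball⟩ := Metric.mem_nhds_iff.mp (inter_mem hN hUt)
  refine ⟨K, ?_⟩
  have h1 := (h.2 t ht').2.continuousWithinAt.tendsto.eventually (Metric.ball_mem_nhds _ hδ)
  have hfix : conjPhase (γ t) = γ t := (sub_eq_zero.mp h0).symm
  filter_upwards [h1] with s hs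
  set w := γ s
  -- The domain need not be invariant under conjugation, so the field is not evaluated at `conjPhase
  -- w`. Near a real point the midpoint of `w` and `conjPhase w` is in the domain, and the field is
  -- real there; both halves of the difference are compared with it.
  set w₀ := (1 / 2 : ℝ) • (w + conjPhase w) with hw₀
  have hw₀real : IsReal w₀ := by
    rw [isReal_iff_conjPhase, hw₀, map_smul, map_add, conjPhase_conjPhase, add_comm]
  have hw₀ball : w₀ ∈ Metric.ball (γ t) δ := by
    rw [mem_ball_iff_norm]
    rw [dist_eq_norm] at hs
    have e1 : w₀ - γ t = (1 / 2 : ℝ) • ((w - γ t) + conjPhase (w - γ t)) := by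
      rw [hw₀, map_sub, hfix]
      module
    rw [e1, norm_smul]
    have := norm_add_le (w - γ t) (conjPhase (w - γ t))
    rw [LinearIsometry.norm_map] at this
    rw [Real.norm_eq_abs, abs_of_pos (by norm_num)]
    linarith
  have hX₀ := conjPhase_hamVF hU hreal
    ((hH.contDiffAt (hU.mem_nhds (hball hw₀ball).2)).differentiableAt (by simp))
    (hball hw₀ball).2 hw₀real
  have e2 : hamVF H w - conjPhase (hamVF H w)
      = (hamVF H w - hamVF H w₀) - conjPhase (hamVF H w - hamVF H w₀) := by
    rw [map_sub, hX₀]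
    abel
  have e3 : w - w₀ = (1 / 2 : ℝ) • (w - conjPhase w) := by
    rw [hw₀]
    module
  have h4 := hK.norm_sub_le (hball hs).1 (hball hw₀ball).1
  rw [e3, norm_smul] at h4
  rw [e2]
  refine (norm_sub_le _ _).trans ?_
  rw [LinearIsometry.norm_map]
  norm_num at h4
  linarith

variable {ρ B L : ℝ}

/-- The flow of `H` exists up to time `T` and moves `z` by at most `a` if `T` times the size of the
vector field is at most `a`. -/
theorem exists_isTrajectory (hU : Metric.ball 0 ρ ⊆ U)
    (hH : ContDiffOn ℂ ((⊤ : ℕ∞) : WithTop ℕ∞) H (Metric.ball 0 ρ)) (hT : 0 ≤ T) {a : ℝ}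
    (ha : 0 ≤ a) (hza : ‖z‖ + a < ρ) (hL0 : 0 ≤ L)
    (hL : ∀ w ∈ Metric.closedBall z a, ‖hamVF H w‖ ≤ L) (hLT : L * T ≤ a) :
    ∃ γ, IsTrajectory U H T z γ ∧ ∀ t ∈ Set.Icc 0 T, γ t ∈ Metric.closedBall z a := by
  have hsub : Metric.closedBall z a ⊆ Metric.ball 0 ρ := by
    intro w hw
    rw [mem_closedBall_iff_norm] at hw
    rw [mem_ball_zero_iff]
    have := norm_add_le (w - z) z
    rw [sub_add_cancel] at this
    linarith
  -- The size of this Lipschitz constant is irrelevant: the existence time depends only on the bound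
  -- `L` and the radius `a`.
  obtain ⟨K, hK⟩ : ∃ K, LipschitzOnWith K (hamVF H) (Metric.closedBall z a) := by
    have hloc : LocallyLipschitzOn (Metric.closedBall z a) (hamVF H) := fun w hw => by
      obtain ⟨K, N, hN, hK⟩ := (contDiffAt_hamVF (contDiffAt_of_mem_ball hH
        (mem_ball_zero_iff.mp (hsub hw)))).exists_lipschitzOnWith
      exact ⟨K, N, mem_nhdsWithin_of_mem_nhds hN, hK⟩
    exact hloc.exists_lipschitzOnWith_of_compact (isCompact_closedBall z a)
  lift a to NNReal using ha
  lift L to NNReal using hL0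
  have hpl : IsPicardLindelof (fun _ => hamVF H) (tmin := 0) (tmax := T)
      ⟨0, ⟨le_rfl, hT⟩⟩ z a 0 L K :=
    { lipschitzOnWith := fun _ _ => hK
      continuousOn := fun _ _ => continuousOn_const
      norm_le := fun _ _ w hw => hL w hw
      mul_max_le := by simpa [hT] using hLT }
  obtain ⟨γ, h0, hγ⟩ := exists_solution_mem_closedBall hpl
  exact ⟨γ, ⟨h0, fun t ht => ⟨hU (hsub (hγ t ht).1), (hγ t ht).2⟩⟩, fun t ht => (hγ t ht).1⟩

/-- The quadratic Hamiltonian as a polynomial. -/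
theorem quadHam_eq_eval {A : Type} [Fintype A] (ω : A → ℝ) (z : Phase A) :
    quadHam ω z = MvPolynomial.eval z (∑ a, MvPolynomial.C (ω a : ℂ) * actionPoly a) := by
  simp [quadHam, action, actionPoly]

theorem hamVF_quadHam (ω : A → ℝ) (z : Phase A) (j : A × ℤˣ) :
    hamVF (quadHam ω) z j = symp j * (ω j.1 * z j) := by
  have h1 : quadHam ω = fun z : Phase A =>
      MvPolynomial.eval z (∑ a, MvPolynomial.C (ω a : ℂ) * actionPoly a) :=
    funext (quadHam_eq_eval ω)
  rw [hamVF_apply, h1, fderiv_eval_single, map_sum, map_sum]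
  congr 1
  rw [Finset.sum_eq_single j.1]
  · obtain ⟨a, δ⟩ := j
    rcases Int.units_eq_one_or δ with rfl | rfl
    · simp [actionPoly, bar, Derivation.leibniz]
    · simp [actionPoly, bar, Derivation.leibniz]
  · intro a _ ha
    simp [actionPoly, bar, Derivation.leibniz, ha]
  · simp

theorem flow_quadHam (ω : A → ℝ) (hT : 0 ≤ T) (z : Phase A) :
    flow Set.univ (quadHam ω) T z = Part.some (rotMap ω T z) := by
  refine flow_eq_some (γ := fun t => rotMap ω t z) isOpen_univ ?_ hT ⟨?_, fun t _ => ⟨trivial, ?_⟩⟩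
  · rw [contDiffOn_univ]
    have h : quadHam ω = fun z : Phase A => ∑ a, (ω a : ℂ) * (z (a, 1) * z (a, -1)) := rfl
    rw [h]
    refine ContDiff.sum fun a _ => contDiff_const.mul ?_
    exact ((EuclideanSpace.proj (a, 1) : Phase A →L[ℂ] ℂ).contDiff).mul
      ((EuclideanSpace.proj (a, -1) : Phase A →L[ℂ] ℂ).contDiff)
  · ext j
    simp [rotMap, eigen]
  · refine (PiLp.continuousLinearEquiv 2 ℝ fun _ : A × ℤˣ => ℂ).symm.toContinuousLinearMap
      |>.hasFDerivAt.comp_hasDerivWithinAt t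
        (f := fun t j => eigen ω t (Finsupp.single j 1) * z j)
        (f' := fun j => hamVF (quadHam ω) (rotMap ω t z) j) (hasDerivWithinAt_pi.mpr fun j => ?_)
    have h1 : HasDerivAt (fun t : ℝ => Complex.exp (-(Complex.I * ((t * freq ω
        (Finsupp.single j 1) : ℝ) : ℂ))) * z j)
        (symp j * (ω j.1 * rotMap ω t z j)) t := by
      have h2 : HasDerivAt (fun t : ℝ => -(Complex.I * ((t * freq ω
          (Finsupp.single j 1) : ℝ) : ℂ))) (symp j * ω j.1) t := by
        have h3 := ((Complex.ofRealCLM.hasDerivAt (x := t)).const_mul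
          (-(Complex.I * (freq ω (Finsupp.single j 1) : ℂ))))
        refine (h3.congr_deriv ?_).congr_of_eventuallyEq (Eventually.of_forall fun t => ?_)
        · simp [symp, mul_assoc]
        · simp
          ring
      refine (h2.cexp.mul_const (z j)).congr_deriv ?_
      simp only [rotMap, eigen]
      ring
    rw [hamVF_quadHam]
    exact h1.hasDerivWithinAt

theorem isReal_rotMap {A : Type} [Fintype A] (ω : A → ℝ) (h : ℝ) {z : Phase A} (hz : IsReal z) :
    IsReal (rotMap ω h z) := by
  intro j
  have h1 : eigen ω h (Finsupp.single (bar j) 1)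
      = (starRingEnd ℂ) (eigen ω h (Finsupp.single j 1)) := by
    simp [eigen, ← Complex.exp_conj, bar]
  simp only [rotMap, map_mul, hz j, h1]

theorem norm_rotMap {A : Type} [Fintype A] (ω : A → ℝ) (h : ℝ) (z : Phase A) :
    ‖rotMap ω h z‖ = ‖z‖ := by
  simp [EuclideanSpace.norm_eq, rotMap]

/-- The size of a real point in terms of its actions. -/
theorem norm_sq_eq_sum_action {A : Type} [Fintype A] {z : Phase A} (hz : IsReal z) :
    ((‖z‖ ^ 2 : ℝ) : ℂ) = 2 * ∑ a, action a z := by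
  rw [EuclideanSpace.norm_sq_eq, Fintype.sum_prod_type, Finset.mul_sum]
  push_cast
  refine Finset.sum_congr rfl fun a _ => ?_
  rw [show (Finset.univ : Finset ℤˣ) = {1, -1} from rfl, Finset.sum_pair (by decide)]
  have h1 := hz (a, 1)
  simp only [bar] at h1
  rw [action, h1, RCLike.norm_conj, Complex.mul_conj, Complex.normSq_eq_norm_sq]
  push_cast
  ring

end HamiltonianFlow

end Splitting

end

noncomputable section

namespace Splitting

/-! ### Balls of a common radius in the projected domains. -/

section Projection

variable {d : ℕ} {N : Set (Fin d → ℤ)}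

/-- The inclusion of the indices of finitely many coordinates. -/
def inclusion (NK : Finset N) : NK × ℤˣ ↪ N × ℤˣ :=
  (Function.Embedding.subtype _).prodMap (Function.Embedding.refl _)

/-- Extension by zero from finitely many coordinates to `ℓ²`. -/
def extend (NK : Finset N) (w : Phase NK) : FullPhase N :=
  ∑ j, lp.single 2 (inclusion NK j) (w j)

theorem proj_extend (NK : Finset N) (w : Phase NK) : proj NK (extend NK w) = w := by
  ext j
  have h : ∀ i, (lp.single 2 (inclusion NK i) (w i) : FullPhase N) (inclusion NK j)
      = if i = j then w i else 0 := fun i => by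
    rw [lp.single_apply]
    by_cases hij : i = j
    · subst hij; simp
    · rw [if_neg hij, Pi.single_eq_of_ne]
      exact fun h => hij ((inclusion NK).injective h.symm)
  change (extend NK w) (inclusion NK j) = w j
  rw [extend, lp.coeFn_sum, Finset.sum_apply, Finset.sum_congr rfl fun i _ => h i]
  simp

theorem norm_extend (NK : Finset N) (w : Phase NK) : ‖extend NK w‖ = ‖w‖ := by
  have hp : 0 < (2 : ENNReal).toReal := by norm_num
  have h := lp.norm_sum_single (E := fun _ => ℂ) hp (Function.extend (inclusion NK) w 0)
    (Finset.univ.map (inclusion NK))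
  simp only [Finset.sum_map, (inclusion NK).injective.extend_apply, ENNReal.toReal_ofNat,
    Real.rpow_two] at h
  rw [← EuclideanSpace.norm_sq_eq] at h
  exact (sq_eq_sq₀ (norm_nonneg _) (norm_nonneg _)).mp h

theorem proj_add (NK : Finset N) (u v : FullPhase N) : proj NK (u + v) = proj NK u + proj NK v :=
  rfl

theorem proj_zero (NK : Finset N) : proj NK (0 : FullPhase N) = 0 := rfl

/-- The images of an open set under the projections contain balls of a common radius. -/
theorem exists_ball_subset_image_proj {U : Set (FullPhase N)} (hU : IsOpen U) {u : FullPhase N}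
    (hu : u ∈ U) : ∃ ρ > 0, ∀ NK : Finset N, Metric.ball (proj NK u) ρ ⊆ proj NK '' U := by
  obtain ⟨ρ, hρ, hball⟩ := Metric.isOpen_iff.mp hU u hu
  refine ⟨ρ, hρ, fun NK w hw => ⟨u + extend NK (w - proj NK u), hball ?_, ?_⟩⟩
  · rw [mem_ball_iff_norm, add_sub_cancel_left, norm_extend]
    exact mem_ball_iff_norm.mp hw
  · rw [proj_add, proj_extend, add_sub_cancel]

theorem isOpen_image_proj {U : Set (FullPhase N)} (hU : IsOpen U) (NK : Finset N) :
    IsOpen (proj NK '' U) := by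
  rw [Metric.isOpen_iff]
  rintro _ ⟨u, hu, rfl⟩
  obtain ⟨ρ, hρ, h⟩ := exists_ball_subset_image_proj hU hu
  exact ⟨ρ, hρ, h NK⟩

end Projection

/-! ### From tuples of indices to exponents of monomials, and the number of coordinates. -/

section Exponents

variable {X : Type*}

/-- The list of the variables of a monomial, with multiplicities. -/
theorem exists_enumeration (μ : X →₀ ℕ) :
    ∃ j : Fin μ.degree → X, ∀ f : X → ℝ, ∑ i, f (j i) = μ.sum fun x n => (n : ℝ) * f x := by
  set l := (Finsupp.toMultiset μ).toList with hl
  have hlen : l.length = μ.degree := by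
    rw [hl, Multiset.length_toList, Finsupp.card_toMultiset]
    rfl
  refine ⟨fun i => l.get (Fin.cast hlen.symm i), fun f => ?_⟩
  have h1 : ∑ i, f (l.get i) = (l.map f).sum := by
    rw [← List.sum_ofFn]
    congr 1
    conv_rhs => rw [← List.ofFn_get l, List.map_ofFn]
    rfl
  refine ((finCongr hlen.symm).sum_comp fun i => f (l.get i)).trans ?_
  rw [h1, ← Multiset.sum_coe, ← Multiset.map_coe, hl, Multiset.coe_toList]
  clear h1 hlen hl l
  induction μ using Finsupp.induction_linear with
  | zero => simp
  | add μ ν hμ hν =>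
    rw [map_add, Multiset.map_add, Multiset.sum_add, hμ, hν,
      Finsupp.sum_add_index' (by simp) (by intros; push_cast; ring)]
  | single x n => simp [Multiset.map_nsmul, Multiset.sum_nsmul]

end Exponents

section NonResonance

theorem DependsOnlyOnActions.sum_eq {A : Type} [DecidableEq A] {s : ℕ} {j : Fin s → A × ℤˣ}
    (h : DependsOnlyOnActions j) (a : A) : ∑ i, (if j i = (a, 1) then (1 : ℝ) else 0)
      = ∑ i, if j i = (a, -1) then (1 : ℝ) else 0 := by
  obtain ⟨m, e, b, hb⟩ := h
  have h1 : (1 : ℤˣ) ≠ -1 := by decide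
  rw [← e.sum_comp, ← e.sum_comp]
  simp only [Fintype.sum_sum_type, (hb _).1, (hb _).2, Prod.mk.injEq, h1, h1.symm, and_false,
    and_true, if_false, Finset.sum_const_zero, add_zero, zero_add]

/-- Reconciles the sign in `eigen`, which comes from `ξ' = -i ω ξ`, with the sign in the
non-resonance condition. -/
theorem norm_one_sub_exp_neg (x : ℝ) :
    ‖1 - Complex.exp (-(Complex.I * x))‖ = ‖1 - Complex.exp (Complex.I * x)‖ := by
  rw [← Complex.norm_conj, map_sub, map_one, ← Complex.exp_conj]
  simp

/-- The non-resonance condition on tuples, as a condition on exponents. -/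
theorem exists_tuple_of_not_resonant {A : Type} [Fintype A] [DecidableEq A] (ω : A → ℝ)
    (h : ℝ) {μ : A × ℤˣ →₀ ℕ} (hμ : ¬ Resonant μ) :
    ∃ j : Fin μ.degree → A × ℤˣ, ¬ DependsOnlyOnActions j ∧
      ‖1 - eigen ω h μ‖ = ‖1 - Complex.exp (Complex.I * (h * Omega ω j : ℝ))‖ := by
  obtain ⟨j, hj⟩ := exists_enumeration μ
  have hcount : ∀ x, ∑ i, (if j i = x then (1 : ℝ) else 0) = μ x := fun x => by
    rw [hj fun y => if y = x then 1 else 0]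
    rw [Finsupp.sum_fintype _ _ (by simp)]
    simp
  refine ⟨j, fun hd => hμ fun a => ?_, ?_⟩
  · have := hd.sum_eq a
    rw [hcount, hcount] at this
    exact_mod_cast this
  · have hΩ : Omega ω j = freq ω μ := by
      rw [Omega, hj fun x => ((x.2 : ℤ) : ℝ) * ω x.1, freq, Finsupp.liftAddHom_apply]
      exact Finsupp.sum_congr fun x _ => by simp [mul_comm]
    rw [hΩ, eigen, norm_one_sub_exp_neg]

end NonResonance

theorem card_le_of_forall_abs_le {d : ℕ} {N : Set (Fin d → ℤ)} (S : Finset N) {K : ℕ} (hK : 1 ≤ K)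
    (hS : ∀ a ∈ S, ∀ i, |(a : Fin d → ℤ) i| ≤ (K : ℤ)) :
    Fintype.card (S × ℤˣ) ≤ (2 * K) ^ (2 * d + 1) := by
  have h1 : S.card ≤ (2 * K + 1) ^ d := by
    have : S.card ≤ (Fintype.piFinset fun _ : Fin d => Finset.Icc (-(K : ℤ)) K).card :=
      Finset.card_le_card_of_injOn Subtype.val
        (fun a ha => by
          simp only [Finset.mem_coe, Fintype.mem_piFinset, Finset.mem_Icc]
          exact fun i => abs_le.mp (hS a ha i))
        Subtype.val_injective.injOn
    refine this.trans ?_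
    rw [Fintype.card_piFinset_const, Int.card_Icc]
    simp
    apply Nat.pow_le_pow_left
    omega
  -- For `K ≥ 1` this turns the count into a pure power of `2 K`; one more factor `2 K` absorbs the
  -- two signs.
  have h2 : 2 * K + 1 ≤ (2 * K) ^ 2 := by nlinarith
  rw [Fintype.card_prod, Fintype.card_coe, show Fintype.card ℤˣ = 2 from rfl, pow_succ, pow_mul]
  exact Nat.mul_le_mul (h1.trans (Nat.pow_le_pow_left h2 d)) (by omega)

end Splitting

end

noncomputable section

namespace Splitting

/-! ### The iterates as partial values. -/

section Iterates

variable {A : Type} [Fintype A] [DecidableEq A] {V : Set (Phase A)} {P : Phase A → ℂ} {ω : A → ℝ}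
  {h : ℝ} {z₀ : Phase A}

theorem iterates_succ (n : ℕ) : iterates V ω P h z₀ (n + 1)
    = (iterates V ω P h z₀ n).bind fun z => (flow V P h z).bind fun w =>
      flow Set.univ (quadHam ω) h w :=
  Function.iterate_succ_apply' _ _ _

theorem iterates_succ_eq_some (hV : IsOpen V)
    (hP : ContDiffOn ℂ ((⊤ : ℕ∞) : WithTop ℕ∞) P V) (hh : 0 ≤ h) {n : ℕ} {z : Phase A}
    (hz : iterates V ω P h z₀ n = Part.some z) {γ : ℝ → Phase A} (hγ : IsTrajectory V P h z γ) :
    iterates V ω P h z₀ (n + 1) = Part.some (rotMap ω h (γ h)) := by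
  rw [iterates_succ, hz, Part.bind_some, flow_eq_some hV hP hh hγ, Part.bind_some,
    flow_quadHam ω hh]

/-- The iterates of a real point are real. -/
theorem isReal_of_mem_iterates (hV : IsOpen V)
    (hP : ContDiffOn ℂ ((⊤ : ℕ∞) : WithTop ℕ∞) P V) (hreal : IsRealHam V P) (hh : 0 ≤ h)
    (hz₀ : IsReal z₀) (n : ℕ) : ∀ z ∈ iterates V ω P h z₀ n, IsReal z := by
  induction n with
  | zero =>
    intro z hz
    rw [Part.mem_some_iff.mp hz]
    exact hz₀
  | succ n ih =>
    intro z hz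
    rw [iterates_succ, Part.mem_bind_iff] at hz
    obtain ⟨w, hw, hz⟩ := hz
    rw [Part.mem_bind_iff] at hz
    obtain ⟨v, hv, hz⟩ := hz
    obtain ⟨γ, hγ, rfl⟩ := exists_of_mem_flow hv
    rw [flow_quadHam ω hh, Part.mem_some_iff] at hz
    rw [hz]
    exact isReal_rotMap _ _ (hγ.isReal hV hP hreal (ih w hw) h ⟨hh, le_rfl⟩)

end Iterates

/-! ### Long-time control of the actions for a polynomial model. -/

variable {c : ℕ} {b : ℕ → ℕ}

/-- The Hamiltonian `P` is approximated to order `M + 3` at the origin by the polynomial of the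
model, on a ball whose radius is bounded below by a power of `Λ⁻¹`. -/
structure Model.Approximates (m : Model c b) (M : ℕ) (V : Set (Phase m.A)) (P : Phase m.A → ℂ) :
    Prop where
  isOpen : IsOpen V
  contDiffOn : ContDiffOn ℂ ((⊤ : ℕ∞) : WithTop ℕ∞) P V
  isRealHam : IsRealHam V P
  ball_subset : Metric.ball 0 (1 / m.Λ ^ c) ⊆ V
  norm_grad_sub_le : ∀ z τ, 0 < τ → ‖z‖ ≤ τ → m.Λ ^ c * τ ≤ 1 → ∀ j,
    ‖fderiv ℂ P z (EuclideanSpace.single j 1) - MvPolynomial.eval z (pd j m.Q)‖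
      ≤ m.Λ ^ c * τ ^ (M + 2)
  norm_hamVF_le : ∀ z τ, 0 < τ → ‖z‖ ≤ τ → m.Λ ^ c * τ ≤ 1 → ‖hamVF P z‖ ≤ m.Λ ^ c * τ ^ 2

/-- On the ball of radius `3 ε` the field is at most `Λ ^ c (3 ε)²`, and the time is at most `Λ ^
c`, so the displacement is at most `9 Λ ^ (2 c) ε · ε ≤ ε`. The power `Λ ^ 4 ≥ 16` in the smallness
condition pays for the `9`. -/
theorem Model.Approximates.exists_isTrajectory {m : Model c b} {M : ℕ} {V : Set (Phase m.A)}
    {P : Phase m.A → ℂ} (hm : m.Approximates M V P) {ε : ℝ} (hε : 0 < ε)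
    (hsmall : m.Λ ^ (2 * c + 4) * ε ≤ 1) {z : Phase m.A} (hz : ‖z‖ ≤ 2 * ε) :
    ∃ γ, IsTrajectory V P m.h z γ ∧ ∀ t ∈ Set.Icc 0 m.h, ‖γ t‖ ≤ 3 * ε := by
  have hΛ := m.two_le
  have hc : 1 ≤ m.Λ ^ c := one_le_pow₀ (by linarith)
  have h16 : 16 ≤ m.Λ ^ 4 := by
    calc (16 : ℝ) = 2 ^ 4 := by norm_num
      _ ≤ m.Λ ^ 4 := pow_le_pow_left₀ (by norm_num) hΛ 4
  have hs : m.Λ ^ c * (m.Λ ^ c * (16 * ε)) ≤ 1 := by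
    refine le_trans ?_ hsmall
    rw [pow_add, two_mul, pow_add]
    have : 0 ≤ m.Λ ^ c * m.Λ ^ c * ε := by positivity
    nlinarith
  have hs' : m.Λ ^ c * (16 * ε) ≤ 1 := le_trans (le_mul_of_one_le_left (by positivity) hc) hs
  have hball : ∀ w ∈ Metric.closedBall z ε, ‖w‖ ≤ 3 * ε := fun w hw => by
    have h1 := mem_closedBall_iff_norm.mp hw
    have h2 := norm_le_insert' w z
    linarith
  have hlt : ‖z‖ + ε < 1 / m.Λ ^ c := by
    rw [lt_div_iff₀ (by positivity)]
    nlinarith [mul_pos (lt_of_lt_of_le one_pos hc) hε]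
  obtain ⟨γ, hγ, hγb⟩ := Splitting.exists_isTrajectory (U := V) (H := P) (T := m.h)
    (L := m.Λ ^ c * (3 * ε) ^ 2) hm.ball_subset
    (hm.contDiffOn.mono hm.ball_subset) m.h_pos.le hε.le hlt (by positivity)
    (fun w hw => hm.norm_hamVF_le w (3 * ε) (by positivity) (hball w hw)
      (le_trans (by gcongr; norm_num) hs')) (by
      calc m.Λ ^ c * (3 * ε) ^ 2 * m.h ≤ m.Λ ^ c * (3 * ε) ^ 2 * m.Λ ^ c := by
            gcongr
            exact m.h_le
        _ = (m.Λ ^ c * (m.Λ ^ c * (9 * ε))) * ε := by ring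
        _ ≤ 1 * ε := by
            gcongr
            exact le_trans (by gcongr; norm_num) hs
        _ = ε := one_mul ε)
  exact ⟨γ, hγ, fun t ht => hball _ (hγb t ht)⟩

/-- Near the origin the actions are almost preserved along the iterates, over a time that is
polynomially long of arbitrary order. -/
theorem exists_action_iterates_sub_le (c : ℕ) (b : ℕ → ℕ) (M : ℕ) :
    ∃ p : ℕ, ∀ (m : Model c b) (V : Set (Phase m.A)) (P : Phase m.A → ℂ),
      m.Approximates (M + 1) V P → ∀ ε : ℝ, 0 < ε → m.Λ ^ (2 * p) * ε ≤ 1 →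
      ∀ z₀, IsReal z₀ → ‖z₀‖ ≤ ε → ∀ n : ℕ, n * ε ^ M ≤ 1 →
        ∃ z, iterates V m.ω P m.h z₀ n = Part.some z ∧ ‖z‖ ≤ 2 * ε ∧
          ∀ a, ‖action a z - action a z₀‖ ≤ m.Λ ^ p * ε ^ 3 := by
  -- Taking the family of all pairs of a model and an index `a` makes the exponents independent of
  -- both.
  obtain ⟨p₁, hp₁⟩ := exists_norm_approxInt_step_le
    (s := fun i : Σ m : Model c b, m.A => i.1) (M + 1) fun i => i.2
  obtain ⟨p₂, hp₂⟩ := exists_norm_approxInt_sub_action_le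
    (s := fun i : Σ m : Model c b, m.A => i.1) (M + 1) fun i => i.2
  set q := p₁ + p₂ + 2 * M + 16 with hq
  refine ⟨q + c + 4, fun m V P hm ε hε hsmall z₀ hz₀ hz₀ε => ?_⟩
  have hΛ := m.two_le
  have hΛ1 : 1 ≤ m.Λ := by linarith
  have hle : ∀ k ≤ 2 * (q + c + 4), m.Λ ^ k * ε ≤ 1 := fun k hk =>
    le_trans (by gcongr) hsmall
  have h3Λ : (3 : ℝ) ≤ m.Λ ^ 2 := by nlinarith
  have h3ε : 3 * ε ≤ 1 := le_trans (by gcongr) (hle 2 (by omega))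
  have hε1 : ε ≤ 1 := by linarith
  set J : m.A → Phase m.A → ℂ := fun a z => MvPolynomial.eval z (approxInt m (M + 1) a) with hJ
  -- The drift in one step, on the radius `3 ε` that a trajectory starting within `2 ε` can reach.
  -- Up to powers of `Λ`, at most `ε ^ (-M)` steps add up to `ε ^ 4`, which is within the distance
  -- `ε ^ 3` between integrals and actions.
  set δ : ℝ := m.Λ ^ p₁ * (3 * ε) ^ (M + 4) with hδ
  have hδ' : δ ≤ m.Λ ^ (p₁ + 2 * M + 8) * ε ^ (M + 4) := by
    rw [hδ, mul_pow, ← mul_assoc]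
    gcongr
    calc m.Λ ^ p₁ * 3 ^ (M + 4) ≤ m.Λ ^ p₁ * (m.Λ ^ 2) ^ (M + 4) := by gcongr
      _ = m.Λ ^ (p₁ + 2 * M + 8) := by ring
  have hdrift : ∀ n : ℕ, n * ε ^ M ≤ 1 → n * δ ≤ m.Λ ^ (p₁ + 2 * M + 8) * ε ^ 3 := fun n hn => by
    calc n * δ ≤ n * (m.Λ ^ (p₁ + 2 * M + 8) * ε ^ (M + 4)) := by gcongr
      _ = (n * ε ^ M) * ε * (m.Λ ^ (p₁ + 2 * M + 8) * ε ^ 3) := by ring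
      _ ≤ 1 * 1 * (m.Λ ^ (p₁ + 2 * M + 8) * ε ^ 3) := by gcongr
      _ = m.Λ ^ (p₁ + 2 * M + 8) * ε ^ 3 := by ring
  have hact : ∀ z, ‖z‖ ≤ 3 * ε → ∀ n : ℕ, n * ε ^ M ≤ 1 → (∀ a, ‖J a z - J a z₀‖ ≤ n * δ) →
      ∀ a, ‖action a z - action a z₀‖ ≤ m.Λ ^ q * ε ^ 3 := fun z hz n hn hJz a => by
    have h1 := hp₂ ⟨m, a⟩ z (3 * ε) hz h3ε
    have h2 := hp₂ ⟨m, a⟩ z₀ (3 * ε) (by linarith) h3ε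
    have h3 := (hJz a).trans (hdrift n hn)
    have h4 : m.Λ ^ p₂ * (3 * ε) ^ 3 ≤ m.Λ ^ (p₂ + 6) * ε ^ 3 := by
      rw [mul_pow, ← mul_assoc, pow_add]
      gcongr
      calc (3 : ℝ) ^ 3 ≤ (m.Λ ^ 2) ^ 3 := by gcongr
        _ = m.Λ ^ 6 := by ring
    have h5 : m.Λ ^ (p₁ + 2 * M + 8) ≤ m.Λ ^ (q - 2) :=
      pow_le_pow_right₀ hΛ1 (by omega)
    have h6 : m.Λ ^ (p₂ + 6) ≤ m.Λ ^ (q - 2) := pow_le_pow_right₀ hΛ1 (by omega)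
    have h7 : 3 * m.Λ ^ (q - 2) ≤ m.Λ ^ q := by
      calc 3 * m.Λ ^ (q - 2) ≤ m.Λ ^ 2 * m.Λ ^ (q - 2) := by gcongr
        _ = m.Λ ^ q := by rw [← pow_add]; congr 1; omega
    have hε3 : 0 ≤ ε ^ 3 := by positivity
    have htri : ‖action a z - action a z₀‖
        ≤ ‖J a z - action a z‖ + ‖J a z - J a z₀‖ + ‖J a z₀ - action a z₀‖ := by
      have : action a z - action a z₀
          = -(J a z - action a z) + (J a z - J a z₀) + (J a z₀ - action a z₀) := by ring
      rw [this]
      exact (norm_add₃_le).trans (by rw [norm_neg])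
    calc ‖action a z - action a z₀‖
        ≤ m.Λ ^ (p₂ + 6) * ε ^ 3 + m.Λ ^ (p₁ + 2 * M + 8) * ε ^ 3 + m.Λ ^ (p₂ + 6) * ε ^ 3 :=
          htri.trans (add_le_add (add_le_add (h1.trans h4) h3) (h2.trans h4))
      _ ≤ m.Λ ^ (q - 2) * ε ^ 3 + m.Λ ^ (q - 2) * ε ^ 3 + m.Λ ^ (q - 2) * ε ^ 3 := by gcongr
      _ = 3 * m.Λ ^ (q - 2) * ε ^ 3 := by ring
      _ ≤ m.Λ ^ q * ε ^ 3 := by gcongr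
  -- Summation of the action bounds costs one factor `Λ ^ c`, and the smallness of `ε` makes the
  -- change of `‖z‖²` at most `ε²`.
  have hnorm : ∀ z, IsReal z → (∀ a, ‖action a z - action a z₀‖ ≤ m.Λ ^ q * ε ^ 3) →
      ‖z‖ ≤ 2 * ε := fun z hz hza => by
    have hcard : (Fintype.card m.A : ℝ) ≤ m.Λ ^ c := by
      refine le_trans ?_ m.card_le
      rw [Fintype.card_prod]
      exact_mod_cast Nat.le_mul_of_pos_right _ Fintype.card_pos
    have h1 : ((‖z‖ ^ 2 - ‖z₀‖ ^ 2 : ℝ) : ℂ) = 2 * ∑ a, (action a z - action a z₀) := by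
      rw [Complex.ofReal_sub, norm_sq_eq_sum_action hz, norm_sq_eq_sum_action hz₀,
        Finset.sum_sub_distrib, mul_sub]
    have h2 : |‖z‖ ^ 2 - ‖z₀‖ ^ 2| ≤ 2 * (m.Λ ^ c * (m.Λ ^ q * ε ^ 3)) := by
      rw [← Real.norm_eq_abs, ← Complex.norm_real, h1, norm_mul, Complex.norm_ofNat]
      gcongr
      refine (norm_sum_le _ _).trans ((Finset.sum_le_sum fun a _ => hza a).trans ?_)
      rw [Finset.sum_const, nsmul_eq_mul, Finset.card_univ]
      gcongr
    have h3 : 2 * (m.Λ ^ c * (m.Λ ^ q * ε ^ 3)) ≤ ε ^ 2 := by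
      calc 2 * (m.Λ ^ c * (m.Λ ^ q * ε ^ 3)) ≤ m.Λ * (m.Λ ^ c * (m.Λ ^ q * ε ^ 3)) := by gcongr
        _ = m.Λ ^ (c + q + 1) * ε * ε ^ 2 := by ring
        _ ≤ 1 * ε ^ 2 := by
          gcongr
          exact hle _ (by omega)
        _ = ε ^ 2 := one_mul _
    have h4 := (abs_le.mp h2).2
    have h5 : ‖z₀‖ ^ 2 ≤ ε ^ 2 := by gcongr
    exact le_of_sq_le_sq (by nlinarith) (by positivity)
  -- Only the drift of `J` accumulates with `n`. The bound `2 ε` is recovered afresh at each step: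
  -- the step itself gives `3 ε`, this suffices to compare `J` with the actions, and the actions
  -- give back `2 ε`.
  have key : ∀ n : ℕ, n * ε ^ M ≤ 1 → ∃ z, iterates V m.ω P m.h z₀ n = Part.some z ∧ IsReal z ∧
      ‖z‖ ≤ 2 * ε ∧ ∀ a, ‖J a z - J a z₀‖ ≤ n * δ := by
    intro n
    induction n with
    | zero => exact fun _ => ⟨z₀, rfl, hz₀, by linarith, fun a => by simp⟩
    | succ n ih =>
      intro hn
      obtain ⟨z, hz, hzr, hzε, hzJ⟩ := ih (le_trans (by gcongr; simp) hn)
      obtain ⟨γ, hγ, hγε⟩ := hm.exists_isTrajectory hε (hle _ (by omega)) hzε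
      have hh : m.h ∈ Set.Icc 0 m.h := ⟨m.h_pos.le, le_rfl⟩
      have hw : ‖rotMap m.ω m.h (γ m.h)‖ ≤ 3 * ε := by
        rw [norm_rotMap]
        exact hγε _ hh
      have hr : IsReal (rotMap m.ω m.h (γ m.h)) := isReal_rotMap _ _
        (hγ.isReal hm.isOpen hm.contDiffOn hm.isRealHam hzr _ hh)
      have hJw : ∀ a, ‖J a (rotMap m.ω m.h (γ m.h)) - J a z₀‖ ≤ (n + 1 : ℕ) * δ := fun a => by
        have hstep := hp₁ ⟨m, a⟩ P γ (3 * ε) h3ε hγε (fun t ht => (hγ.2 t ht).2)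
          fun t ht j => hm.norm_grad_sub_le _ _ (by positivity) (hγε t ht) (by
            calc m.Λ ^ c * (3 * ε) ≤ m.Λ ^ c * (m.Λ ^ 2 * ε) := by gcongr
              _ = m.Λ ^ (c + 2) * ε := by ring
              _ ≤ 1 := hle _ (by omega)) j
        rw [hγ.1] at hstep
        calc ‖J a (rotMap m.ω m.h (γ m.h)) - J a z₀‖
            ≤ ‖J a (rotMap m.ω m.h (γ m.h)) - J a z‖ + ‖J a z - J a z₀‖ :=
              norm_sub_le_norm_sub_add_norm_sub _ _ _
          _ ≤ δ + n * δ := add_le_add hstep (hzJ a)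
          _ = (n + 1 : ℕ) * δ := by push_cast; ring
      exact ⟨_, iterates_succ_eq_some hm.isOpen hm.contDiffOn m.h_pos.le hz hγ, hr,
        hnorm _ hr (hact _ hw _ hn hJw), hJw⟩
  intro n hn
  obtain ⟨z, hz, -, hzε, hzJ⟩ := key n hn
  refine ⟨z, hz, hzε, fun a => (hact z (by linarith) n hn hzJ a).trans ?_⟩
  gcongr
  omega

end Splitting

end

/-! ### From a smooth perturbation to a polynomial model. -/

noncomputable section

namespace Splitting

/-- A splitting step with a smooth perturbation `P` of a rotation, all of whose data are bounded by
powers of `Λ` with exponents `e` and `b`. -/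
structure Admissible (e : ℕ) (b : ℕ → ℕ) {A : Type} [Fintype A] [DecidableEq A] (ω : A → ℝ)
    (h Λ : ℝ) (V : Set (Phase A)) (P : Phase A → ℂ) : Prop where
  two_le : 2 ≤ Λ
  card_le : (Fintype.card (A × ℤˣ) : ℝ) ≤ Λ ^ e
  h_pos : 0 < h
  h_le : h ≤ Λ ^ e
  nonres : ∀ μ : A × ℤˣ →₀ ℕ, ¬ Resonant μ → h ≤ Λ ^ b μ.degree * ‖1 - eigen ω h μ‖
  isOpen : IsOpen V
  contDiffOn : ContDiffOn ℂ ((⊤ : ℕ∞) : WithTop ℕ∞) P V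
  isRealHam : IsRealHam V P
  iteratedFDeriv_zero : ∀ k < 3, iteratedFDeriv ℂ k P 0 = 0
  ball_subset : Metric.ball 0 (1 / Λ ^ e) ⊆ V
  norm_le : ∀ z : Phase A, ‖z‖ < 1 / Λ ^ e → ‖iteratedFDeriv ℂ 2 P z‖ ≤ Λ ^ e

namespace Admissible

variable {e : ℕ} {b : ℕ → ℕ} {A : Type} [Fintype A] [DecidableEq A] {ω : A → ℝ} {h Λ : ℝ}
  {V : Set (Phase A)} {P : Phase A → ℂ}

/-- The exponent in the bounds for the derivatives up to order `L + 2`. -/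
def derivExp (e L : ℕ) : ℕ := e + (L + e) * L

theorem norm_iteratedFDeriv_le (hP : Admissible e b ω h Λ V P) {k L : ℕ} (hk : k ≤ L)
    {z : Phase A} (hz : ‖z‖ < 1 / Λ ^ (e + L)) :
    ‖iteratedFDeriv ℂ (2 + k) P z‖ ≤ Λ ^ derivExp e L := by
  have hΛ := hP.two_le
  have hΛ1 : 1 ≤ Λ := by linarith
  have hpos : 0 < Λ := by linarith
  have hz' : ‖z‖ < 1 / Λ ^ e / 2 ^ k := by
    refine hz.trans_le ?_
    rw [div_div]
    refine one_div_le_one_div_of_le (by positivity) ?_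
    rw [pow_add]
    have : (2 : ℝ) ^ k ≤ Λ ^ L :=
      (pow_le_pow_left₀ (by norm_num) hΛ k).trans (pow_le_pow_right₀ hΛ1 hk)
    gcongr
  refine (Splitting.norm_iteratedFDeriv_le (by positivity)
    (hP.contDiffOn.mono hP.ball_subset) (by positivity) hP.norm_le k hz').trans ?_
  calc Λ ^ e * (2 ^ k / (1 / Λ ^ e)) ^ k = Λ ^ e * (2 ^ k * Λ ^ e) ^ k := by
        rw [div_div_eq_mul_div, div_one]
    _ ≤ Λ ^ e * (Λ ^ k * Λ ^ e) ^ k := by gcongr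
    _ = Λ ^ (e + (k + e) * k) := by rw [← pow_add, ← pow_mul, ← pow_add]
    _ ≤ Λ ^ derivExp e L := by
        rw [derivExp]
        gcongr

/-- The exponent in the bounds for the Taylor polynomial of degree `M + 2` and its remainder. -/
def taylorExp (e M : ℕ) : ℕ := derivExp e (M + 1) + (M + 3) * (e + 3) + e + 10

theorem bd_taylorPoly (hP : Admissible e b ω h Λ V P) (M : ℕ) :
    Bd Λ (taylorExp e M) (taylorPoly P (M + 3)) := by
  have hΛ := hP.two_le
  have hΛ1 : 1 ≤ Λ := by linarith
  refine ⟨?_, upDeg_mono (by rw [taylorExp]; nlinarith) (taylorPoly_mem_upDeg P _)⟩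
  have hterm : ∀ k ∈ Finset.range (M + 3),
      l1 (taylorPart P k) ≤ Λ ^ (e * (M + 3) + derivExp e (M + 1)) := by
    intro k hk
    rw [Finset.mem_range] at hk
    refine (l1_taylorPart_le P k).trans ?_
    rw [pow_add, pow_mul]
    have hcard : (Fintype.card (A × ℤˣ) : ℝ) ^ k ≤ (Λ ^ e) ^ (M + 3) :=
      (pow_le_pow_left₀ (by positivity) hP.card_le k).trans
        (pow_le_pow_right₀ (one_le_pow₀ hΛ1) hk.le)
    have hder : ‖iteratedFDeriv ℂ k P 0‖ ≤ Λ ^ derivExp e (M + 1) := by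
      rcases lt_or_ge k 2 with h2 | h2
      · rw [hP.iteratedFDeriv_zero k (by omega), norm_zero]
        positivity
      · obtain ⟨l, rfl⟩ := Nat.exists_eq_add_of_le h2
        exact hP.norm_iteratedFDeriv_le (by omega) (by rw [norm_zero]; positivity)
    gcongr
  calc l1 (taylorPoly P (M + 3)) ≤ ∑ k ∈ Finset.range (M + 3), l1 (taylorPart P k) := l1_sum_le _ _
    _ ≤ (M + 3 : ℕ) * Λ ^ (e * (M + 3) + derivExp e (M + 1)) := by
        refine (Finset.sum_le_sum hterm).trans_eq ?_
        rw [Finset.sum_const, Finset.card_range, nsmul_eq_mul]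
    _ ≤ Λ ^ (M + 3) * Λ ^ (e * (M + 3) + derivExp e (M + 1)) := by
        gcongr
        exact natCast_le_pow hΛ _
    _ ≤ Λ ^ taylorExp e M := by
        rw [← pow_add, taylorExp]
        exact pow_le_pow_right₀ hΛ1 (by nlinarith)

/-- Used with `n = M + 2` for the accuracy of the model, and with `n = 2`, where the Taylor
polynomial vanishes, for the size of the vector field. -/
theorem norm_grad_sub_le (hP : Admissible e b ω h Λ V P) {n M : ℕ} (hn : 1 ≤ n) (hnM : n ≤ M + 2)
    {z : Phase A} {τ : ℝ} (hτ : 0 < τ) (hz : ‖z‖ ≤ τ) (hsmall : Λ ^ taylorExp e M * τ ≤ 1)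
    (j : A × ℤˣ) :
    ‖fderiv ℂ P z (EuclideanSpace.single j 1)
      - MvPolynomial.eval z (pd j (taylorPoly P (n + 1)))‖
      ≤ Λ ^ (derivExp e (M + 1) + 2 * M + 7) * τ ^ n := by
  have hΛ := hP.two_le
  have hΛ1 : 1 ≤ Λ := by linarith
  have hpos : 0 < Λ := by linarith
  have hτρ : 2 * τ < 1 / Λ ^ (e + (M + 1)) := by
    rw [lt_div_iff₀ (by positivity)]
    have h1 : Λ ^ (e + (M + 1) + 2) ≤ Λ ^ taylorExp e M :=
      pow_le_pow_right₀ hΛ1 (by rw [taylorExp]; nlinarith)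
    have h2 : Λ ^ (e + (M + 1)) * τ * Λ ^ 2 ≤ 1 := by
      refine le_trans (le_of_eq ?_) ((mul_le_mul_of_nonneg_right h1 hτ.le).trans hsmall)
      ring
    have h3 : 0 < Λ ^ (e + (M + 1)) * τ := by positivity
    nlinarith
  have hsub : Metric.ball (0 : Phase A) (1 / Λ ^ (e + (M + 1))) ⊆ V :=
    (Metric.ball_subset_ball (one_div_le_one_div_of_le (by positivity)
      (pow_le_pow_right₀ hΛ1 (by omega)))).trans hP.ball_subset
  refine (norm_fderiv_sub_eval_pderiv_le (by positivity) (hP.contDiffOn.mono hsub) n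
    (B := Λ ^ derivExp e (M + 1)) (fun w hw => ?_) hτ hz hτρ j).trans ?_
  · obtain ⟨l, rfl⟩ := Nat.exists_eq_add_of_le hn
    have := hP.norm_iteratedFDeriv_le (k := l) (L := M + 1) (by omega) hw
    rwa [show 1 + l + 1 = 2 + l by ring]
  · gcongr
    calc ((n : ℝ) + 2) * (Λ ^ derivExp e (M + 1) * 2 ^ (n + 1))
        ≤ Λ ^ (n + 2) * (Λ ^ derivExp e (M + 1) * Λ ^ (n + 1)) := by
          gcongr
          exact_mod_cast natCast_le_pow hΛ (n + 2)
      _ = Λ ^ (derivExp e (M + 1) + 2 * n + 3) := by ring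
      _ ≤ _ := pow_le_pow_right₀ hΛ1 (by omega)

theorem norm_hamVF_le (hP : Admissible e b ω h Λ V P) {M : ℕ} {z : Phase A} {τ : ℝ} (hτ : 0 < τ)
    (hz : ‖z‖ ≤ τ) (hsmall : Λ ^ taylorExp e M * τ ≤ 1) :
    ‖hamVF P z‖ ≤ Λ ^ taylorExp e M * τ ^ 2 := by
  have hΛ := hP.two_le
  have hΛ1 : 1 ≤ Λ := by linarith
  have hpoly : taylorPoly P (2 + 1) = 0 := Finset.sum_eq_zero fun k hk => by
    simp [taylorPart, hP.iteratedFDeriv_zero k (Finset.mem_range.mp hk)]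
  have hj : ∀ j, ‖hamVF P z j‖ ≤ Λ ^ (derivExp e (M + 1) + 2 * M + 7) * τ ^ 2 := fun j => by
    have := hP.norm_grad_sub_le (n := 2) (by norm_num) (by omega) hτ hz hsmall (bar j)
    rw [hpoly, map_zero, map_zero, sub_zero] at this
    rwa [hamVF_apply, norm_mul, norm_symp, one_mul]
  refine (norm_le_sum_norm _).trans ((Finset.sum_le_sum fun j _ => hj j).trans ?_)
  rw [Finset.sum_const, nsmul_eq_mul, Finset.card_univ, ← mul_assoc]
  gcongr
  calc (Fintype.card (A × ℤˣ) : ℝ) * Λ ^ (derivExp e (M + 1) + 2 * M + 7)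
      ≤ Λ ^ e * Λ ^ (derivExp e (M + 1) + 2 * M + 7) := by
        gcongr
        exact hP.card_le
    _ ≤ Λ ^ taylorExp e M := by
        rw [← pow_add, taylorExp]
        exact pow_le_pow_right₀ hΛ1 (by nlinarith)

/-- The polynomial model of an admissible splitting step. -/
def model (hP : Admissible e b ω h Λ V P) (M : ℕ) : Model (taylorExp e M) b where
  A := A
  ω := ω
  h := h
  Λ := Λ
  Q := taylorPoly P (M + 3)
  two_le := hP.two_le
  card_le := hP.card_le.trans
    (pow_le_pow_right₀ (by linarith [hP.two_le]) (by rw [taylorExp]; omega))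
  h_pos := hP.h_pos
  h_le := hP.h_le.trans
    (pow_le_pow_right₀ (by linarith [hP.two_le]) (by rw [taylorExp]; omega))
  Q_bd := hP.bd_taylorPoly M
  Q_low := taylorPoly_mem_lowDeg hP.iteratedFDeriv_zero _
  nonres := hP.nonres

theorem approximates_model (hP : Admissible e b ω h Λ V P) (M : ℕ) :
    (hP.model M).Approximates M V P where
  isOpen := hP.isOpen
  contDiffOn := hP.contDiffOn
  isRealHam := hP.isRealHam
  ball_subset := by
    have hΛ := hP.two_le
    refine (Metric.ball_subset_ball (one_div_le_one_div_of_le ?_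
      (pow_le_pow_right₀ (?_ : 1 ≤ Λ) ?_))).trans hP.ball_subset
    · exact pow_pos (by linarith) _
    · linarith
    · rw [taylorExp]
      omega
  norm_grad_sub_le z τ hτ hz hsmall j := by
    have hΛ := hP.two_le
    refine (hP.norm_grad_sub_le (n := M + 2) (by omega) le_rfl hτ hz hsmall j).trans ?_
    have : Λ ^ (derivExp e (M + 1) + 2 * M + 7) ≤ Λ ^ taylorExp e M :=
      pow_le_pow_right₀ (by linarith) (by rw [taylorExp]; nlinarith)
    exact mul_le_mul_of_nonneg_right this (by positivity)
  norm_hamVF_le z τ hτ hz hsmall := hP.norm_hamVF_le hτ hz hsmall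

end Admissible

/-- Near the origin the actions are almost preserved along the iterates of an admissible splitting
step, over a time that is polynomially long of arbitrary order. -/
theorem exists_iterates_of_admissible (e : ℕ) (b : ℕ → ℕ) (M : ℕ) :
    ∃ p : ℕ, ∀ {A : Type} [Fintype A] [DecidableEq A] {ω : A → ℝ} {h Λ : ℝ} {V : Set (Phase A)}
      {P : Phase A → ℂ}, Admissible e b ω h Λ V P → ∀ ε : ℝ, 0 < ε → Λ ^ (2 * p) * ε ≤ 1 →
      ∀ z₀ : Phase A, IsReal z₀ → ‖z₀‖ ≤ ε → ∀ n : ℕ, n * ε ^ M ≤ 1 →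
        ∃ z, iterates V ω P h z₀ n = Part.some z ∧ ‖z‖ ≤ 2 * ε ∧
          ∀ a, ‖action a z - action a z₀‖ ≤ Λ ^ p * ε ^ 3 := by
  obtain ⟨p, hp⟩ := exists_action_iterates_sub_le (Admissible.taylorExp e (M + 1)) b M
  exact ⟨p, fun hP => hp (hP.model (M + 1)) _ _ (hP.approximates_model (M + 1))⟩

end Splitting

end

/-! ### Choice of the exponents and conclusion. -/

noncomputable section

namespace Splitting

section Exponents

variable {Λ : ℝ}

theorem le_pow_ceil (hΛ : 2 ≤ Λ) (x : ℝ) : x ≤ Λ ^ ⌈x⌉₊ :=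
  (Nat.le_ceil x).trans (natCast_le_pow hΛ _)

theorem rpow_le_pow_ceil {κ : ℝ} (hκ : 1 ≤ κ) (hκΛ : κ ≤ Λ) (x : ℝ) : κ ^ x ≤ Λ ^ ⌈x⌉₊ :=
  calc κ ^ x ≤ κ ^ (⌈x⌉₊ : ℝ) := Real.rpow_le_rpow_of_exponent_le hκ (Nat.le_ceil x)
    _ = κ ^ ⌈x⌉₊ := Real.rpow_natCast _ _
    _ ≤ Λ ^ ⌈x⌉₊ := pow_le_pow_left₀ (by linarith) hκΛ _

end Exponents

theorem exists_admissible {d : ℕ} {N : Set (Fin d → ℤ)} {U : Set (FullPhase N)} (hU : IsOpen U)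
    (hU0 : (0 : FullPhase N) ∈ U) (h₀ C β : ℝ) (hC : 0 ≤ C) {γ : ℕ → ℝ} (α : ℕ → ℝ)
    (hγ : ∀ s, 0 < γ s) :
    ∃ (e : ℕ) (b : ℕ → ℕ), ∀ (NK : ℕ → Finset N),
      (∀ K, ∀ a ∈ NK K, ∀ i, |(a : Fin d → ℤ) i| ≤ (K : ℤ)) →
      ∀ (ω : N → ℝ) (h : ℝ), 0 < h → h < h₀ → NonResonant NK ω h γ α →
      ∀ K : ℕ, 1 ≤ K → ∀ P : Phase (NK K) → ℂ,
        ContDiffOn ℂ ((⊤ : ℕ∞) : WithTop ℕ∞) P (proj (NK K) '' U) →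
        IsRealHam (proj (NK K) '' U) P → (∀ k < 3, iteratedFDeriv ℂ k P 0 = 0) →
        (∀ j : Fin 2 → NK K × ℤˣ, ∀ z ∈ proj (NK K) '' U,
          ‖partialDeriv P j z‖ ≤ C * (K : ℝ) ^ β) →
        Admissible e b (fun a : NK K => ω a) h (2 * K) (proj (NK K) '' U) P := by
  obtain ⟨ρ, hρ, hball⟩ := exists_ball_subset_image_proj hU hU0
  -- The first summand pays for passing from second partial derivatives to the operator norm, which
  -- costs the square of the number of coordinates. The others absorb `C`, `K ^ β`, `h₀` and `1 / ρ`
  -- into powers of `2 K ≥ 2`.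
  set e := (2 * d + 1) * 2 + ⌈C⌉₊ + ⌈β⌉₊ + ⌈h₀⌉₊ + ⌈1 / ρ⌉₊ with he
  refine ⟨e, fun s => ⌈α s⌉₊ + ⌈1 / γ s⌉₊, fun NK hNK ω h hh hh₀ hnr K hK P hP hPr hP0 hP2 => ?_⟩
  have hK1 : (1 : ℝ) ≤ K := by exact_mod_cast hK
  have hΛ : (2 : ℝ) ≤ 2 * K := by linarith
  have hΛ1 : (1 : ℝ) ≤ 2 * K := by linarith
  have hcard : (Fintype.card (NK K × ℤˣ) : ℝ) ≤ (2 * K) ^ (2 * d + 1) := by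
    exact_mod_cast card_le_of_forall_abs_le (NK K) hK (hNK K)
  have hsub : Metric.ball 0 (1 / (2 * (K : ℝ)) ^ e) ⊆ proj (NK K) '' U := by
    refine (Metric.ball_subset_ball ?_).trans ((proj_zero (NK K)) ▸ hball (NK K))
    rw [one_div_le (by positivity) hρ]
    exact (le_pow_ceil hΛ _).trans (pow_le_pow_right₀ hΛ1 (by omega))
  refine ⟨hΛ, hcard.trans (pow_le_pow_right₀ hΛ1 (by omega)), hh,
    hh₀.le.trans ((le_pow_ceil hΛ _).trans (pow_le_pow_right₀ hΛ1 (by omega))),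
    fun μ hμ => ?_, isOpen_image_proj hU _, hP, hPr, hP0, hsub, fun z hz => ?_⟩
  · obtain ⟨j, hj, hnorm⟩ := exists_tuple_of_not_resonant (fun a : NK K => ω a) h hμ
    have hs := hnr μ.degree K hK j hj
    rw [← hnorm, div_le_iff₀ (by positivity)] at hs
    have hγs := hγ μ.degree
    calc h = 1 / γ μ.degree * (h * γ μ.degree) := by field_simp
      _ ≤ 1 / γ μ.degree * (‖1 - eigen (fun a : NK K => ω a) h μ‖ * (K : ℝ) ^ α μ.degree) := by
          gcongr
      _ ≤ (2 * K) ^ ⌈1 / γ μ.degree⌉₊ *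
          (‖1 - eigen (fun a : NK K => ω a) h μ‖ * (2 * K) ^ ⌈α μ.degree⌉₊) := by
          gcongr
          · exact le_pow_ceil hΛ _
          · exact rpow_le_pow_ceil hK1 (by linarith) _
      _ = (2 * K) ^ (⌈α μ.degree⌉₊ + ⌈1 / γ μ.degree⌉₊) *
          ‖1 - eigen (fun a : NK K => ω a) h μ‖ := by ring
  · refine (norm_multilinear_le (iteratedFDeriv ℂ 2 P z) (C := C * (K : ℝ) ^ β) (by positivity)
      fun j => hP2 j z (hsub (by simpa using hz))).trans ?_
    calc (Fintype.card (NK K × ℤˣ) : ℝ) ^ 2 * (C * (K : ℝ) ^ β)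
        ≤ ((2 * (K : ℝ)) ^ (2 * d + 1)) ^ 2 * ((2 * K) ^ ⌈C⌉₊ * (2 * K) ^ ⌈β⌉₊) := by
          gcongr
          · exact le_pow_ceil hΛ _
          · exact rpow_le_pow_ceil hK1 (by linarith) _
      _ = (2 * (K : ℝ)) ^ ((2 * d + 1) * 2 + ⌈C⌉₊ + ⌈β⌉₊) := by
          rw [← pow_mul, ← pow_add, ← pow_add, add_assoc]
      _ ≤ (2 * (K : ℝ)) ^ e := pow_le_pow_right₀ hΛ1 (by omega)

/-- If `K ≤ ε^{-σ}` with `σ` small, then powers of `2 K` are absorbed by `ε`. -/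
theorem two_mul_pow_mul_le_one (q : ℕ) {ε K : ℝ} (hε : 0 < ε) (hε0 : ε ≤ 1 / 4 ^ q) (hK : 0 ≤ K)
    (hKε : K ≤ ε ^ (-(1 / (2 * (q + 1) : ℝ)))) : (2 * K) ^ q * ε ≤ 1 := by
  have hε1 : ε ≤ 1 := hε0.trans (by
    rw [div_le_one (by positivity)]
    exact one_le_pow₀ (by norm_num))
  -- Half of the factor `ε` absorbs `K ^ q`; the other half absorbs `2 ^ q`, which is the purpose of
  -- `ε ≤ 1 / 4 ^ q`.
  have h1 : K ^ q ≤ ε ^ (-(1 / 2) : ℝ) := by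
    calc K ^ q ≤ (ε ^ (-(1 / (2 * (q + 1) : ℝ)))) ^ q := by gcongr
      _ = ε ^ (-(1 / (2 * (q + 1) : ℝ)) * q) := by rw [Real.rpow_mul hε.le, Real.rpow_natCast]
      _ ≤ ε ^ (-(1 / 2) : ℝ) := by
          refine Real.rpow_le_rpow_of_exponent_ge hε hε1 ?_
          rw [neg_mul, neg_le_neg_iff, div_mul_eq_mul_div, one_mul,
            div_le_div_iff₀ (by positivity) (by norm_num)]
          linarith
  have h2 : 2 ^ q * ε ^ (1 / 2 : ℝ) ≤ 1 := by
    calc 2 ^ q * ε ^ (1 / 2 : ℝ) ≤ 2 ^ q * (1 / 4 ^ q : ℝ) ^ (1 / 2 : ℝ) := by gcongr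
      _ = 2 ^ q * (((1 / 2) ^ q) ^ 2 : ℝ) ^ (1 / 2 : ℝ) := by
          rw [← pow_mul, mul_comm q 2, pow_mul, one_div, ← inv_pow]
          norm_num
      _ = 1 := by
          rw [← Real.sqrt_eq_rpow, Real.sqrt_sq (by positivity), ← mul_pow]
          norm_num
  calc (2 * K) ^ q * ε = 2 ^ q * K ^ q * ε := by rw [mul_pow]
    _ ≤ 2 ^ q * ε ^ (-(1 / 2) : ℝ) * ε := by gcongr
    _ = 2 ^ q * ε ^ (1 / 2 : ℝ) := by
        rw [mul_assoc]
        congr 1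
        nth_rewrite 2 [← Real.rpow_one ε]
        rw [← Real.rpow_add hε]
        norm_num
    _ ≤ 1 := h2

/-- The smallness condition has the exponent `2 p` so that its square root trades `Λ ^ p` for half a
power of `ε`. -/
theorem mul_pow_three_le_rpow {Λ ε : ℝ} (hε : 0 < ε) (hΛ : 0 ≤ Λ) (p : ℕ)
    (h : Λ ^ (2 * p) * ε ≤ 1) : Λ ^ p * ε ^ 3 ≤ ε ^ (5 / 2 : ℝ) := by
  have h1 : Λ ^ p * ε ^ (1 / 2 : ℝ) ≤ 1 := by
    refine (sq_le_one_iff₀ (by positivity)).mp ?_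
    rw [mul_pow, ← pow_mul, mul_comm p 2, ← Real.sqrt_eq_rpow, Real.sq_sqrt hε.le]
    exact h
  calc Λ ^ p * ε ^ 3 = Λ ^ p * ε ^ (1 / 2 : ℝ) * ε ^ (5 / 2 : ℝ) := by
        rw [mul_assoc, ← Real.rpow_add hε]
        norm_num
    _ ≤ 1 * ε ^ (5 / 2 : ℝ) := by gcongr
    _ = ε ^ (5 / 2 : ℝ) := one_mul _

end Splitting

end

open Splitting in
/-- `N` is the index set (e.g. `ℤ^d` or `ℕ^d`), `NK K` its finite part at level `K`, `P K` the
nonlinearity on the open set `U_K = proj (NK K) '' U`.  Only the derivative bounds of order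
`ℓ = 2, …, max r 2` enter, so `σ`, `Cst`, `ε₀` depend on no other values of `C` and `β`. -/
theorem theorem1 (d : ℕ) (N : Set (Fin d → ℤ)) (U : Set (FullPhase N)) (hU : IsOpen U)
    (hU0 : (0 : FullPhase N) ∈ U) (r : ℕ) (hr : 1 ≤ r) (h₀ : ℝ)
    (C β : ℕ → ℝ) (hC : ∀ ℓ, 0 ≤ C ℓ) (hβ : ∀ ℓ, 0 ≤ β ℓ)
    (γ α : ℕ → ℝ) (hγ : ∀ s, 0 < γ s) :
    ∃ σ Cst ε₀ : ℝ, 0 < σ ∧ 0 < Cst ∧ 0 < ε₀ ∧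
      ∀ (NK : ℕ → Finset N), (∀ K, ∀ a ∈ NK K, ∀ i, |(a : Fin d → ℤ) i| ≤ (K : ℤ)) →
      ∀ (ω : N → ℝ) (P : ∀ K, Phase (NK K) → ℂ),
        (∀ K, ContDiffOn ℂ ((⊤ : ℕ∞) : WithTop ℕ∞) (P K) (proj (NK K) '' U)) →
        (∀ K, IsRealHam (proj (NK K) '' U) (P K)) →
        (∀ K, ∀ k < 3, iteratedFDeriv ℂ k (P K) 0 = 0) →
        (∀ ℓ, 2 ≤ ℓ → ℓ ≤ max r 2 → ∀ K, 1 ≤ K → ∀ j : Fin ℓ → NK K × ℤˣ,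
          ∀ z ∈ proj (NK K) '' U, ‖partialDeriv (P K) j z‖ ≤ C ℓ * (K : ℝ) ^ β ℓ) →
      ∀ h : ℝ, 0 < h → h < h₀ → NonResonant NK ω h γ α →
      ∀ ε : ℝ, 0 < ε → ε < ε₀ → ∀ K : ℕ, 1 ≤ K → (K : ℝ) ≤ ε ^ (-σ) →
      ∀ z₀ : Phase (NK K), IsReal z₀ → ‖z₀‖ ≤ ε →
        let zIter := iterates (proj (NK K) '' U) (fun a : NK K => ω a) (P K) h z₀
        (∀ n, ∀ z ∈ zIter n, IsReal z) ∧
        (∀ n : ℕ, (n : ℝ) ≤ ε ^ (1 - (r : ℝ)) → ∃ z ∈ zIter n, ‖z‖ ≤ 2 * ε) ∧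
        (∀ n : ℕ, (n : ℝ) ≤ ε ^ (2 - (r : ℝ)) → ∃ z ∈ zIter n, ∀ a : NK K,
          ‖action a z - action a z₀‖ ≤ Cst * ε ^ (5 / 2 : ℝ)) := by
  obtain ⟨e, b, hadm⟩ := exists_admissible hU hU0 h₀ (C 2) (β 2) (hC 2) α hγ
  -- With `r = M + 1` the first time scale `ε ^ (1 - r)` is exactly `ε ^ (-M)`.
  obtain ⟨M, rfl⟩ := Nat.exists_eq_add_of_le' hr
  obtain ⟨p, hp⟩ := exists_iterates_of_admissible e b M
  refine ⟨1 / (2 * ((2 * p : ℕ) + 1)), 1, 1 / 4 ^ (2 * p), by positivity, one_pos, by positivity,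
    ?_⟩
  intro NK hNK ω P hP hPr hP0 hPb h hh hh₀ hnr ε hε hε₀ K hK hKε z₀ hz₀ hz₀ε zIter
  have hA := hadm NK hNK ω h hh hh₀ hnr K hK (P K) (hP K) (hPr K) (hP0 K)
    (hPb 2 le_rfl (le_max_right _ _) K hK)
  have hsmall := two_mul_pow_mul_le_one (2 * p) hε hε₀.le (Nat.cast_nonneg K) hKε
  have hε1 : ε ≤ 1 := hε₀.le.trans (by
    rw [div_le_one (by positivity)]
    exact one_le_pow₀ (by norm_num))
  have hlong : ∀ n : ℕ, (n : ℝ) ≤ ε ^ (1 - ((M + 1 : ℕ) : ℝ)) → n * ε ^ M ≤ 1 := fun n hn => by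
    calc n * ε ^ M ≤ ε ^ (1 - ((M + 1 : ℕ) : ℝ)) * ε ^ M := by gcongr
      _ = 1 := by
          rw [← Real.rpow_natCast, ← Real.rpow_add hε]
          simp
  refine ⟨isReal_of_mem_iterates hA.isOpen hA.contDiffOn hA.isRealHam hh.le hz₀,
    fun n hn => ?_, fun n hn => ?_⟩
  · obtain ⟨z, hz, hzε, -⟩ := hp hA ε hε hsmall z₀ hz₀ hz₀ε n (hlong n hn)
    exact ⟨z, Part.eq_some_iff.mp hz, hzε⟩
  -- The time `ε ^ (2 - r)` is shorter than `ε ^ (1 - r)`, on which the action estimate already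
  -- holds.
  · obtain ⟨z, hz, -, hza⟩ := hp hA ε hε hsmall z₀ hz₀ hz₀ε n (hlong n (hn.trans
      (Real.rpow_le_rpow_of_exponent_ge hε hε1 (by linarith))))
    refine ⟨z, Part.eq_some_iff.mp hz, fun a => (hza a).trans ?_⟩
    rw [one_mul]
    exact mul_pow_three_le_rpow hε (by positivity) p hsmall
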